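/- Let $k$ be an algebraically closed field (of any characteristic) and let $X$ be a non-singular variety over $k$, i.e. an irreducible, reduced, separated scheme of finite type over $k$ all of whose local rings are regular. Let $m\ge 0$ be an integer. Then the functor $$Z\longmapsto \operatorname{Hom}_k\bigl(Z\times_{\operatorname{Spec} k}\operatorname{Spec} k[t]/(t^{m+1}),\,X\bigr)$$ on $k$-schemes is representable. Moreover, let $X_m$ be the $m$-jet scheme of $X$, that is, any $k$-scheme representing this functor, and let $\pi_m\colon X_m\to X$ be the projection induced by the canonical surjection $k[t]/(t^{m+1})\to k$, i.e. the composite of $X_m=X_m\times_{\operatorname{Spec} k}\operatorname{Spec} k\to X_m\times_{\operatorname{Spec} k}\operatorname{Spec} k[t]/(t^{m+1})$ with the universal family $X_m\times_{\operatorname{Spec} k}\operatorname{Spec} k[t]/(t^{m+1})\to X$. For a $k$-scheme $Y$ of finite dimension write $\omega_Y=\bigwedge^{\dim Y}\Omega_{Y/k}$ (the canonical sheaf when $Y$ is a non-singular variety). Then there is an isomorphism of $\mathcal O_{X_m}$-modules $$\omega_{X_m}\;\cong\;\pi_m^*\bigl(\omega_X^{\otimes (m+1)}\bigr).$$ -/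

import Mathlib

universe v w u

open CategoryTheory AlgebraicGeometry Opposite

noncomputable section

namespace JetSchemes

/-! ### Non-singular varieties -/

/-- Varieties over `k`: irreducible reduced separated schemes of finite type over `k`. -/
structure IsVariety {k : Type u} [Field k] (X : Over (Spec (.of k))) : Prop where
  irreducible : IrreducibleSpace X.left
  reduced : IsReduced X.left
  separated : IsSeparated X.hom
  locallyOfFiniteType : LocallyOfFiniteType X.hom
  quasiCompact : QuasiCompact X.hom

/-- A scheme is non-singular if all its local rings are regular local rings. -/
def IsNonsingular (X : Scheme.{u}) : Prop :=
  ∀ x : X, IsRegularLocalRing (X.presheaf.stalk x)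

/-- The dimension of a scheme: the Krull dimension of its underlying space, as a natural number
(with value `0` if the scheme is empty or of infinite dimension). -/
def dim (X : Scheme.{u}) : ℕ := ((topologicalKrullDim X).unbotD 0).toNat

/-! ### Tensor powers and exterior powers of sheaves of modules -/

lemma res_update {C : Type w} [Category.{v} C] {R : Cᵒᵖ ⥤ RingCat.{u}}
    (M : PresheafOfModules.{u} R) {n : ℕ} {U V : Cᵒᵖ} (f : U ⟶ V) [DecidableEq (Fin n)]
    (s : Fin n → M.obj U) (i : Fin n) (x : M.obj U) :
    (fun j => (M.map f (Function.update s i x j) : M.obj V)) =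
      Function.update (fun j => (M.map f (s j) : M.obj V)) i (M.map f x) := by
  funext j
  by_cases h : j = i
  · subst h; simp
  · simp [h]

/-- The restriction map `⋀ⁿ M(U) → ⋀ⁿ M(V)`, `s₁ ∧ ⋯ ∧ sₙ ↦ s₁|V ∧ ⋯ ∧ sₙ|V`, of a presheaf of
modules `M`. -/
def exteriorPowerRes {C : Type w} [Category.{v} C] {R : Cᵒᵖ ⥤ CommRingCat.{u}}
    (M : PresheafOfModules.{u} (R ⋙ forget₂ _ _)) (n : ℕ) {U V : Cᵒᵖ} (f : U ⟶ V) :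
    (M.obj U).exteriorPower n ⟶
      (ModuleCat.restrictScalars (R.map f).hom).obj ((M.obj V).exteriorPower n) :=
  ModuleCat.exteriorPower.desc
    { toFun := fun s => ModuleCat.exteriorPower.mk (M := M.obj V) (fun i => M.map f (s i))
      map_update_add' := by
        intro _ s i x y
        simp only [res_update, map_add]
        exact AlternatingMap.map_update_add (exteriorPower.ιMulti (R.obj V) n) _ _ _ _
      map_update_smul' := by
        intro _ s i r x
        simp only [res_update, M.map_smul]
        exact AlternatingMap.map_update_smul (exteriorPower.ιMulti (R.obj V) n) _ _ _ _
      map_eq_zero_of_eq' := by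
        intro s i j h hij
        exact AlternatingMap.map_eq_zero_of_eq (exteriorPower.ιMulti (R.obj V) n) _
          (congrArg (fun x => M.map f x) h) hij }

lemma exteriorPowerRes_mk {C : Type w} [Category.{v} C] {R : Cᵒᵖ ⥤ CommRingCat.{u}}
    (M : PresheafOfModules.{u} (R ⋙ forget₂ _ _)) (n : ℕ) {U V : Cᵒᵖ} (f : U ⟶ V)
    (s : Fin n → M.obj U) :
    exteriorPowerRes M n f (ModuleCat.exteriorPower.mk s) =
      ModuleCat.exteriorPower.mk (M := M.obj V) (fun i => M.map f (s i)) :=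
  ModuleCat.exteriorPower.desc_mk _ _

/-- The `n`-th exterior power of a presheaf of modules, `U ↦ ⋀ⁿ M(U)`. -/
def presheafExteriorPower {C : Type w} [Category.{v} C] {R : Cᵒᵖ ⥤ CommRingCat.{u}}
    (M : PresheafOfModules.{u} (R ⋙ forget₂ _ _)) (n : ℕ) :
    PresheafOfModules.{u} (R ⋙ forget₂ _ _) where
  obj U := (M.obj U).exteriorPower n
  map f := exteriorPowerRes M n f
  map_id U := by
    apply ModuleCat.exteriorPower.hom_ext
    ext s
    refine (exteriorPowerRes_mk M n (𝟙 U) s).trans ?_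
    simp
    rfl
  map_comp f g := by
    apply ModuleCat.exteriorPower.hom_ext
    ext s
    refine (exteriorPowerRes_mk M n (f ≫ g) s).trans ?_
    simp only [M.map_comp]
    exact ((congrArg (exteriorPowerRes M n g) (exteriorPowerRes_mk M n f s)).trans
      (exteriorPowerRes_mk M n g _)).symm

/-- The sheaf of modules associated with a presheaf of modules on a scheme. -/
def sheafify {X : Scheme.{u}} (M : X.PresheafOfModules) : X.Modules :=
  (PresheafOfModules.sheafification (𝟙 X.ringCatSheaf.obj)).obj M

/-- The `n`-th exterior power of a sheaf of modules: the sheaf associated with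
`U ↦ ⋀ⁿ M(U)`. -/
def exteriorPower {X : Scheme.{u}} (M : X.Modules) (n : ℕ) : X.Modules :=
  sheafify (presheafExteriorPower (R := X.presheaf) M.val n)

/-- The tensor product of two sheaves of modules: the sheaf associated with
`U ↦ M(U) ⊗ N(U)`. -/
def tensor {X : Scheme.{u}} (M N : X.Modules) : X.Modules :=
  sheafify (PresheafOfModules.Monoidal.tensorObj (R := X.presheaf) M.val N.val)

/-- The tensor powers of a sheaf of modules, with `M^{⊗ 0} = 𝒪_X`. -/
def tensorPower {X : Scheme.{u}} (M : X.Modules) : ℕ → X.Modules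
  | 0 => SheafOfModules.unit X.ringCatSheaf
  | n + 1 => tensor (tensorPower M n) M

/-! ### Differentials and the canonical sheaf -/

/-- The morphism `k → 𝒪_X` from the constant presheaf `k` given by the structure morphism of a
`k`-scheme `X`. -/
def structureMap {k : Type u} [Field k] (X : Over (Spec (.of k))) :
    (Functor.const X.left.Opensᵒᵖ).obj (CommRingCat.of k) ⟶ X.left.presheaf where
  app U := (Scheme.ΓSpecIso (.of k)).inv ≫ X.hom.appTop ≫ X.left.presheaf.map (homOfLE le_top).op
  naturality U V f := by
    simp [← Functor.map_comp]
    rfl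

/-- The sheaf of differentials `Ω_{X/k}`: the sheaf associated with `U ↦ Ω_{𝒪_X(U)/k}`. -/
def cotangentSheaf {k : Type u} [Field k] (X : Over (Spec (.of k))) : X.left.Modules :=
  sheafify (PresheafOfModules.DifferentialsConstruction.relativeDifferentials' (structureMap X))

/-- The canonical sheaf `ω_X = ⋀^{dim X} Ω_{X/k}` of a non-singular variety `X`. -/
def canonicalSheaf {k : Type u} [Field k] (X : Over (Spec (.of k))) : X.left.Modules :=
  exteriorPower (cotangentSheaf X) (dim X.left)

/-! ### Jet schemes -/

open Polynomial in
/-- The ring `k[t]/(t^{m+1})`. -/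
abbrev TruncatedPolynomial (k : Type u) [Field k] (m : ℕ) : Type u :=
  k[X] ⧸ Ideal.span {(X ^ (m + 1) : k[X])}

open Polynomial in
/-- The canonical surjection `k[t]/(t^{m+1}) → k`, `t ↦ 0`. -/
def TruncatedPolynomial.toField (k : Type u) [Field k] (m : ℕ) :
    TruncatedPolynomial k m →ₐ[k] k :=
  Ideal.Quotient.liftₐ _ (aeval (0 : k)) (by
    intro a ha
    obtain ⟨b, rfl⟩ := Ideal.mem_span_singleton.mp ha
    simp)

/-- The `k`-scheme `Spec k[t]/(t^{m+1})`. -/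
def fatPoint (k : Type u) [Field k] (m : ℕ) : Over (Spec (.of k)) :=
  Over.mk (Spec.map (CommRingCat.ofHom (algebraMap k (TruncatedPolynomial k m))))

/-- The functor `Z ↦ Z ×_{Spec k} Spec k[t]/(t^{m+1})` on `k`-schemes. -/
def prodFatPoint (k : Type u) [Field k] (m : ℕ) : Over (Spec (.of k)) ⥤ Over (Spec (.of k)) :=
  Over.pullback (fatPoint k m).hom ⋙ Over.map (fatPoint k m).hom

/-- The functor `Z ↦ Hom_k(Z ×_{Spec k} Spec k[t]/(t^{m+1}), X)` of families of `m`-jets of `X`.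
The `m`-jet scheme `X_m` of `X` is the `k`-scheme that represents it. -/
def jetFunctor {k : Type u} [Field k] (X : Over (Spec (.of k))) (m : ℕ) :
    (Over (Spec (.of k)))ᵒᵖ ⥤ Type u :=
  (prodFatPoint k m).op ⋙ yoneda.obj X

/-- The point `Spec k → Spec k[t]/(t^{m+1})`, given by the canonical surjection. -/
def fatPoint.origin (k : Type u) [Field k] (m : ℕ) :
    Spec (.of k) ⟶ (fatPoint k m).left :=
  Spec.map (CommRingCat.ofHom (TruncatedPolynomial.toField k m : TruncatedPolynomial k m →+* k))

lemma fatPoint.origin_comp (k : Type u) [Field k] (m : ℕ) :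
    fatPoint.origin k m ≫ (fatPoint k m).hom = 𝟙 _ := by
  change Spec.map _ ≫ Spec.map _ = _
  rw [← Spec.map_comp, ← CommRingCat.ofHom_comp, (TruncatedPolynomial.toField k m).comp_algebraMap]
  exact Spec.map_id _

/-- The morphism `Z = Z ×_{Spec k} Spec k → Z ×_{Spec k} Spec k[t]/(t^{m+1})` given by the canonical
surjection `k[t]/(t^{m+1}) → k`. -/
def zeroSection {k : Type u} [Field k] (Z : Over (Spec (.of k))) (m : ℕ) :
    Z ⟶ (prodFatPoint k m).obj Z :=
  Over.homMk
    (Limits.pullback.lift (f := Z.hom) (g := (fatPoint k m).hom)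
      (𝟙 Z.left) (Z.hom ≫ fatPoint.origin k m) (by
        simp [fatPoint.origin_comp]))
    ((Limits.pullback.lift_snd_assoc (f := Z.hom) (g := (fatPoint k m).hom) _ _ _ _).trans (by
      simp [fatPoint.origin_comp]))

/-- The universal family of `m`-jets `Λ : X_m ×_{Spec k} Spec k[t]/(t^{m+1}) → X` on the `m`-jet
scheme `J = X_m`. -/
def universalFamily {k : Type u} [Field k] {X J : Over (Spec (.of k))} {m : ℕ}
    (hJ : (jetFunctor X m).RepresentableBy J) : (prodFatPoint k m).obj J ⟶ X :=
  hJ.homEquiv (𝟙 J)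

/-- The projection `π_m : X_m → X` from the `m`-jet scheme `J = X_m`. -/
def jetProjection {k : Type u} [Field k] {X J : Over (Spec (.of k))} {m : ℕ}
    (hJ : (jetFunctor X m).RepresentableBy J) : J ⟶ X :=
  zeroSection J m ≫ universalFamily hJ

end JetSchemes

end

/-!
The `m`-jet scheme of `Spec A` is the spectrum of the algebra `B` which carries the universal
homomorphism `γ : A → B[t]/(t^{m+1})`; it exists as the quotient of a polynomial ring in the symbols
`a^{(j)}` by all relations between the coefficients of jets (`isUniversalJet_universalJet`). A family
of jets takes values in an open subset as soon as its origins do, because `k[t]/(t^{m+1})` has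
a single point (`surjective_zeroSection`). Therefore the jet schemes of the affine open subsets of `X`
form a relative gluing datum over `X`, and the glued scheme represents the functor of jets
(`isRepresentable_jetFunctor`). For the same reason, for any representing scheme `J` with projection
`π`, the preimage of an affine open subset `U` is affine and is the jet scheme of `U`
(`isAffineOpen_preimage`, `isUniversalJet_jetHom`).

For the isomorphism, both sides are line bundles, which are compared through their transition
functions. A non-singular variety of dimension `n` has, locally, functions `x₁, …, xₙ` whose
differentials form a basis of `Ω`: at a closed point these are regular parameters, which generate by
Nakayama's lemma, and there are no relations because the rank at the generic point is the transcendence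
degree (`exists_bijective_D_of_isRegularLocalRing`). If `γ(x) = ∑ x^{(j)} t^j`, then the differentials
of the `x_i^{(j)}` form a basis of `Ω_B` (`IsUniversalJet.bijective_D`): they generate since `d ⊗ 1`
composed with `γ` is a derivation of `A`, and they are independent since a derivation `∂` of `A` yields
deformations `γ + ε t^j γ∂` of the universal jet, hence derivations of `B` which are dual to them.

If `dy_i = ∑ g_{il} dx_l`, then comparison of the coefficients of `t^j` gives
`dy_i^{(j)} = ∑_{q ≤ j} g_{il}^{(j-q)} dx_l^{(q)}`. This matrix is block triangular with `m + 1` diagonal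
blocks equal to `π^* g`, so its determinant is `π^* (det g)^{m+1}` (`det_jetMatrix`). Thus `ω_J` and
`π^* ω_X^{⊗ (m+1)}` have the same transition functions with respect to the local generators
`⋀ dx_i^{(j)}` and `(dx₁ ∧ ⋯ ∧ dxₙ)^{⊗ (m+1)}`, and such line bundles are isomorphic
(`nonempty_iso_pullback_of_isGenerator`).

It remains to see that the exterior power in the definition of `ω_J` is the top one, that is, that `J`
has dimension `n(m + 1)` (`dim_jetScheme`). The dimension of a finitely generated algebra is at most
the number of generators of its differentials (`ringKrullDim_le_of_span_eq_top`); and where `X` is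
étale over affine space, jets may be prescribed by their origin and the higher coefficients of the
coordinates, so that the jet scheme contains a product of an open subset of `X` with an affine space
of dimension `nm` (`IsUniversalJet.exists_surjective`).
-/

noncomputable section

namespace JetSchemes

/-! ### Sections of sheaves of modules -/

section Frames

variable {X : Scheme.{u}}

/-- Restriction of functions to a smaller open subset. -/
def ores (X : Scheme.{u}) {V U : X.Opens} (h : V ≤ U) : Γ(X, U) →+* Γ(X, V) :=
  (X.presheaf.map (homOfLE h).op).hom

lemma ores_ores {W V U : X.Opens} (h : W ≤ V) (h' : V ≤ U) (r : Γ(X, U)) :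
    ores X h (ores X h' r) = ores X (h.trans h') r := by
  have := X.presheaf.map_comp (homOfLE h').op (homOfLE h).op
  exact (congrArg (fun f => f.hom r) this).symm

instance (P : X.PresheafOfModules) (U : X.Opens) : Module Γ(X, U) (P.obj (op U)) :=
  (P.obj (op U)).isModule

/-- Restriction of sections of a presheaf of modules to a smaller open subset. -/
def res (P : X.PresheafOfModules) {V U : X.Opens} (h : V ≤ U) :
    P.obj (op U) →+ P.obj (op V) :=
  (P.presheaf.map (homOfLE h).op).hom

lemma res_smul (P : X.PresheafOfModules) {V U : X.Opens} (h : V ≤ U) (r : Γ(X, U))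
    (s : P.obj (op U)) : res P h (r • s) = ores X h r • res P h s :=
  P.map_smul (homOfLE h).op r s

lemma res_res (P : X.PresheafOfModules) {W V U : X.Opens} (h : W ≤ V) (h' : V ≤ U)
    (s : P.obj (op U)) : res P h (res P h' s) = res P (h.trans h') s :=
  (P.map_comp_apply (homOfLE h').op (homOfLE h).op s).symm

lemma ores_ext {U : X.Opens} {s t : Γ(X, U)}
    (h : ∀ x ∈ U, ∃ (W : X.Opens) (hW : W ≤ U), x ∈ W ∧ ores X hW s = ores X hW t) : s = t := by
  choose W hW hx e using h
  refine X.sheaf.eq_of_locally_eq' (fun x : U => W x.1 x.2) U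
    (fun x => homOfLE (hW x.1 x.2)) (fun x hxU => ?_) s t (fun x => e x.1 x.2)
  simp only [TopologicalSpace.Opens.mem_iSup]
  exact ⟨⟨x, hxU⟩, hx x hxU⟩

lemma ores_glue {ι : Type u} {U : X.Opens} (V : ι → X.Opens) (hV : ∀ i, V i ≤ U)
    (hU : U ≤ ⨆ i, V i) (s : ∀ i, Γ(X, V i))
    (hs : ∀ i j, ores X inf_le_left (s i) = ores X (inf_le_right : V i ⊓ V j ≤ V j) (s j)) :
    ∃ t : Γ(X, U), ∀ i, ores X (hV i) t = s i := by
  obtain ⟨t, ht, -⟩ := X.sheaf.existsUnique_gluing' V U (fun i => homOfLE (hV i)) hU s hs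
  exact ⟨t, ht⟩

/-- The sheaf of abelian groups underlying a sheaf of modules. -/
abbrev abSheaf (M : X.Modules) : TopCat.Sheaf Ab.{u} X := ⟨M.val.presheaf, M.isSheaf⟩

lemma res_ext (M : X.Modules) {U : X.Opens} {s t : M.val.obj (op U)}
    (h : ∀ x ∈ U, ∃ (W : X.Opens) (hW : W ≤ U), x ∈ W ∧ res M.val hW s = res M.val hW t) :
    s = t := by
  choose W hW hx e using h
  refine (abSheaf M).eq_of_locally_eq' (fun x : U => W x.1 x.2) U
    (fun x => homOfLE (hW x.1 x.2)) (fun x hxU => ?_) s t (fun x => e x.1 x.2)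
  simp only [TopologicalSpace.Opens.mem_iSup]
  exact ⟨⟨x, hxU⟩, hx x hxU⟩

lemma res_glue (M : X.Modules) {ι : Type u} {U : X.Opens} (V : ι → X.Opens)
    (hV : ∀ i, V i ≤ U) (hU : U ≤ ⨆ i, V i) (s : ∀ i, M.val.obj (op (V i)))
    (hs : ∀ i j, res M.val inf_le_left (s i) =
      res M.val (inf_le_right : V i ⊓ V j ≤ V j) (s j)) :
    ∃ t : M.val.obj (op U), ∀ i, res M.val (hV i) t = s i := by
  obtain ⟨t, ht, -⟩ := (abSheaf M).existsUnique_gluing' V U (fun i => homOfLE (hV i)) hU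
    (fun i => s i) (fun i j => hs i j)
  exact ⟨t, ht⟩

/-- The canonical map from the sections of a presheaf of modules to those of its associated
sheaf. -/
def toSheafify (P : X.PresheafOfModules) (U : X.Opens) :
    P.obj (op U) →ₗ[Γ(X, U)] (sheafify P).val.obj (op U) where
  toFun s := (CategoryTheory.toSheafify _ P.presheaf).app (op U) s
  map_add' s t := map_add ((CategoryTheory.toSheafify _ P.presheaf).app (op U)).hom s t
  map_smul' r s := ((((PresheafOfModules.toSheafify (𝟙 X.ringCatSheaf.obj)
    (CategoryTheory.toSheafify _ P.presheaf)).app (op U)).hom.map_smul r s))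

lemma res_toSheafify (P : X.PresheafOfModules) {V U : X.Opens} (h : V ≤ U) (s : P.obj (op U)) :
    res (sheafify P).val h (toSheafify P U s) = toSheafify P V (res P h s) :=
  (NatTrans.naturality_apply (CategoryTheory.toSheafify _ P.presheaf) (homOfLE h).op s).symm

lemma toSheafify_locally_injective (P : X.PresheafOfModules) {U : X.Opens} {s t : P.obj (op U)}
    (h : toSheafify P U s = toSheafify P U t) (x : X) (hx : x ∈ U) :
    ∃ (W : X.Opens) (hW : W ≤ U), x ∈ W ∧ res P hW s = res P hW t := by
  obtain ⟨W, f, hf, hxW⟩ := Presheaf.equalizerSieve_mem (Opens.grothendieckTopology X)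
    (CategoryTheory.toSheafify (Opens.grothendieckTopology X) P.presheaf) (X := op U) s t h x hx
  exact ⟨W, leOfHom f, hxW, hf⟩

lemma toSheafify_locally_surjective (P : X.PresheafOfModules) {U : X.Opens}
    (s : (sheafify P).val.obj (op U)) (x : X) (hx : x ∈ U) :
    ∃ (W : X.Opens) (hW : W ≤ U) (p : P.obj (op W)), x ∈ W ∧
      toSheafify P W p = res (sheafify P).val hW s := by
  obtain ⟨W, f, ⟨p, hp⟩, hxW⟩ := Presheaf.imageSieve_mem (Opens.grothendieckTopology X)
    (CategoryTheory.toSheafify (Opens.grothendieckTopology X) P.presheaf) (U := op U) s x hx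
  exact ⟨W, leOfHom f, p, hxW, hp⟩


/-! ### Frames -/

/-- A finite family of sections over `U` is a frame if over each open subset of `U` it restricts to
a basis. -/
def IsFrame {ι : Type} [Fintype ι] (P : X.PresheafOfModules) (U : X.Opens)
    (e : ι → P.obj (op U)) : Prop :=
  ∀ (W : X.Opens) (h : W ≤ U),
    Function.Bijective (fun r : ι → Γ(X, W) => ∑ i, r i • res P h (e i))

section Frame
variable {ι : Type} [Fintype ι]

lemma res_sum (P : X.PresheafOfModules) {U V : X.Opens} (h : V ≤ U) (r : ι → Γ(X, U))
    (e : ι → P.obj (op U)) :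
    res P h (∑ i, r i • e i) = ∑ i, ores X h (r i) • res P h (e i) := by
  simp only [map_sum, res_smul]

/-- If a family of sections of a presheaf restricts to a basis over the members of a basis of open
subsets, it gives a frame of the associated sheaf. -/
lemma isFrame_sheafify (P : X.PresheafOfModules) {U : X.Opens} {e : ι → P.obj (op U)}
    (B : Set X.Opens) (hB : ∀ V ≤ U, ∀ x ∈ V, ∃ W ∈ B, W ≤ V ∧ x ∈ W)
    (h : ∀ W ∈ B, ∀ hW : W ≤ U,
      Function.Bijective (fun r : ι → Γ(X, W) => ∑ i, r i • res P hW (e i))) :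
    IsFrame (sheafify P).val U (fun i => toSheafify P U (e i)) := by
  intro V hV
  have eqn : ∀ (W : X.Opens) (hW : W ≤ U) (r : ι → Γ(X, W)),
      ∑ i, r i • res (sheafify P).val hW (toSheafify P U (e i)) =
        toSheafify P W (∑ i, r i • res P hW (e i)) := by
    intro W hW r
    simp only [res_toSheafify, map_sum, map_smul]
  have inj : ∀ (V' : X.Opens) (hV' : V' ≤ U) (r s : ι → Γ(X, V')),
      ∑ i, r i • res (sheafify P).val hV' (toSheafify P U (e i)) =
      ∑ i, s i • res (sheafify P).val hV' (toSheafify P U (e i)) → r = s := by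
    intro V' hV' r s hrs
    simp only [eqn] at hrs
    funext i
    apply ores_ext
    intro x hx
    obtain ⟨W, hW, hxW, hf⟩ := toSheafify_locally_injective P hrs x hx
    obtain ⟨W', hW'B, hW', hxW'⟩ := hB W (hW.trans hV') x hxW
    refine ⟨W', hW'.trans hW, hxW', ?_⟩
    refine congrFun ((h W' hW'B ((hW'.trans hW).trans hV')).1
      (a₁ := fun i => ores X _ (r i)) (a₂ := fun i => ores X _ (s i)) ?_) i
    have := congrArg (res P hW') hf
    simpa only [res_sum, res_res, ores_ores] using this
  refine ⟨fun r s => inj V hV r s, ?_⟩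
  intro s
  -- a section is locally a combination of the frame; the coefficients agree on overlaps, and glue
  have key : ∀ x : V, ∃ (W : X.Opens) (hW : W ≤ V) (r : ι → Γ(X, W)), x.1 ∈ W ∧ W ∈ B ∧
      ∑ i, r i • res (sheafify P).val (hW.trans hV) (toSheafify P U (e i)) =
        res (sheafify P).val hW s := by
    intro x
    obtain ⟨W, hW, p, hxW, hp⟩ := toSheafify_locally_surjective P s x.1 x.2
    obtain ⟨W', hW'B, hW', hxW'⟩ := hB W (hW.trans hV) x hxW
    obtain ⟨r, hr⟩ := (h W' hW'B ((hW'.trans hW).trans hV)).2 (res P hW' p)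
    refine ⟨W', hW'.trans hW, r, hxW', hW'B, ?_⟩
    rw [eqn]
    refine (congrArg (toSheafify P W') hr).trans ?_
    rw [← res_toSheafify, hp, res_res]
  choose W hW r hxW hWB hr using key
  have cover : V ≤ ⨆ x, W x := fun x hx => by
    simp only [TopologicalSpace.Opens.mem_iSup]
    exact ⟨⟨x, hx⟩, hxW ⟨x, hx⟩⟩
  have compat : ∀ i x y, ores X inf_le_left (r x i) =
      ores X (inf_le_right : W x ⊓ W y ≤ W y) (r y i) := by
    intro i x y
    refine congrFun (inj (W x ⊓ W y) (inf_le_left.trans ((hW x).trans hV))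
      (fun i => ores X inf_le_left (r x i)) (fun i => ores X inf_le_right (r y i)) ?_) i
    have hx := congrArg (res (sheafify P).val (inf_le_left : W x ⊓ W y ≤ _)) (hr x)
    have hy := congrArg (res (sheafify P).val (inf_le_right : W x ⊓ W y ≤ _)) (hr y)
    simp only [res_sum, res_res] at hx hy ⊢
    rw [hx, hy]
  choose t ht using fun i => ores_glue W hW cover (fun x => r x i) (compat i)
  refine ⟨t, ?_⟩
  apply res_ext
  intro x hx
  refine ⟨W ⟨x, hx⟩, hW _, hxW ⟨x, hx⟩, ?_⟩
  rw [← hr ⟨x, hx⟩, res_sum]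
  simp only [res_res, ht]

end Frame

end Frames

/-! ### Tensor powers and exterior powers of frames -/

section Generators

variable {X : Scheme.{u}}

/-- A section over `U` is a generator if over each open subset of `U` its restriction is a basis
of the module of sections. -/
def IsGenerator (P : X.PresheafOfModules) (U : X.Opens) (e : P.obj (op U)) : Prop :=
  ∀ (W : X.Opens) (h : W ≤ U), Function.Bijective (fun r : Γ(X, W) => r • res P h e)

lemma isFrame_unit_iff {P : X.PresheafOfModules} {U : X.Opens} {e : P.obj (op U)} :
    IsFrame P U (fun _ : Unit => e) ↔ IsGenerator P U e := by
  refine forall_congr' fun W => forall_congr' fun h => ?_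
  have : (fun r : Unit → Γ(X, W) => ∑ i, r i • res P h e) =
      (fun r : Γ(X, W) => r • res P h e) ∘ (Equiv.funUnique Unit Γ(X, W)) := by
    funext r; simp
  rw [this]
  exact (Equiv.funUnique Unit Γ(X, W)).bijective_comp _

lemma IsGenerator.sheafify {P : X.PresheafOfModules} {U : X.Opens} {e : P.obj (op U)}
    (h : IsGenerator P U e) : IsGenerator (sheafify P).val U (toSheafify P U e) := by
  rw [← isFrame_unit_iff] at h ⊢
  exact isFrame_sheafify P Set.univ (fun V _ x hx => ⟨V, trivial, le_rfl, hx⟩)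
    (fun W _ hW => h W hW)

/-- The section `1` of the structure sheaf. -/
def unitSection (X : Scheme.{u}) (U : X.Opens) :
    (SheafOfModules.unit X.ringCatSheaf).val.obj (op U) := (1 : Γ(X, U))

lemma res_unitSection {U V : X.Opens} (h : V ≤ U) :
    res (SheafOfModules.unit X.ringCatSheaf).val h (unitSection X U) = unitSection X V :=
  map_one (ores X h)

lemma isGenerator_unitSection (U : X.Opens) :
    IsGenerator (SheafOfModules.unit X.ringCatSheaf).val U (unitSection X U) := by
  intro W h
  rw [res_unitSection]
  have : (fun r : Γ(X, W) => r • unitSection X W) = fun r => r :=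
    funext fun r => mul_one (r : Γ(X, W))
  rw [this]
  exact Function.bijective_id

/-- The section `s ⊗ t` of the tensor product of two sheaves of modules. -/
def tensorSection (M N : X.Modules) {U : X.Opens} (s : M.val.obj (op U)) (t : N.val.obj (op U)) :
    (tensor M N).val.obj (op U) :=
  toSheafify (PresheafOfModules.Monoidal.tensorObj (R := X.presheaf) M.val N.val) U
    (s ⊗ₜ[Γ(X, U)] t : TensorProduct Γ(X, U) (M.val.obj (op U)) (N.val.obj (op U)))

lemma res_tensorSection (M N : X.Modules) {U V : X.Opens} (h : V ≤ U) (s : M.val.obj (op U))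
    (t : N.val.obj (op U)) :
    res (tensor M N).val h (tensorSection M N s t) =
      tensorSection M N (res M.val h s) (res N.val h t) :=
  res_toSheafify _ _ _

lemma tensorSection_smul_smul (M N : X.Modules) {U : X.Opens} (r r' : Γ(X, U))
    (s : M.val.obj (op U)) (t : N.val.obj (op U)) :
    tensorSection M N (r • s) (r' • t) = (r * r') • tensorSection M N s t := by
  refine Eq.trans ?_ ((toSheafify (PresheafOfModules.Monoidal.tensorObj (R := X.presheaf)
    M.val N.val) U).map_smul (r * r')
    (s ⊗ₜ[Γ(X, U)] t : TensorProduct Γ(X, U) (M.val.obj (op U)) (N.val.obj (op U))))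
  exact congrArg (toSheafify (PresheafOfModules.Monoidal.tensorObj (R := X.presheaf) M.val N.val) U)
    (TensorProduct.smul_tmul_smul (R := Γ(X, U)) r r' s t)

lemma bijective_smul_tmul {R M N : Type*} [CommRing R] [AddCommGroup M] [Module R M]
    [AddCommGroup N] [Module R N] {s : M} {t : N} (hs : Function.Bijective fun r : R => r • s)
    (ht : Function.Bijective fun r : R => r • t) :
    Function.Bijective fun r : R => r • (s ⊗ₜ[R] t) := by
  let e₁ : R ≃ₗ[R] M := LinearEquiv.ofBijective (LinearMap.toSpanSingleton R M s) hs
  let e₂ : R ≃ₗ[R] N := LinearEquiv.ofBijective (LinearMap.toSpanSingleton R N t) ht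
  have : (fun r : R => r • (s ⊗ₜ[R] t)) =
      ((TensorProduct.lid R R).symm.trans (TensorProduct.congr e₁ e₂)) := by
    funext r
    have h₁ : e₁ 1 = s := one_smul R s
    have h₂ : e₂ r = r • t := rfl
    simp [h₁, h₂]
  rw [this]
  exact LinearEquiv.bijective _

lemma IsGenerator.tensorSection {M N : X.Modules} {U : X.Opens} {s : M.val.obj (op U)}
    {t : N.val.obj (op U)} (hs : IsGenerator M.val U s) (ht : IsGenerator N.val U t) :
    IsGenerator (tensor M N).val U (tensorSection M N s t) := by
  refine IsGenerator.sheafify ?_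
  intro W h
  exact bijective_smul_tmul (hs W h) (ht W h)

/-- The section `s ⊗ ⋯ ⊗ s` of a tensor power of a sheaf of modules. -/
def tensorPowerSection (M : X.Modules) {U : X.Opens} (s : M.val.obj (op U)) :
    ∀ n : ℕ, (tensorPower M n).val.obj (op U)
  | 0 => unitSection X U
  | n + 1 => tensorSection _ _ (tensorPowerSection M s n) s

lemma res_tensorPowerSection (M : X.Modules) {U V : X.Opens} (h : V ≤ U) (s : M.val.obj (op U))
    (n : ℕ) : res (tensorPower M n).val h (tensorPowerSection M s n) =
      tensorPowerSection M (res M.val h s) n := by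
  induction n with
  | zero => exact res_unitSection h
  | succ n ih => exact (res_tensorSection _ _ h _ _).trans (by rw [ih]; rfl)

lemma tensorPowerSection_smul (M : X.Modules) {U : X.Opens} (r : Γ(X, U)) (s : M.val.obj (op U))
    (n : ℕ) : tensorPowerSection M (r • s) n = r ^ n • tensorPowerSection M s n := by
  induction n with
  | zero => rw [pow_zero, one_smul]; rfl
  | succ n ih =>
    rw [pow_succ]
    refine Eq.trans ?_ (tensorSection_smul_smul _ _ (r ^ n) r _ _)
    rw [← ih]
    rfl

lemma IsGenerator.tensorPowerSection {M : X.Modules} {U : X.Opens} {s : M.val.obj (op U)}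
    (hs : IsGenerator M.val U s) (n : ℕ) :
    IsGenerator (tensorPower M n).val U (tensorPowerSection M s n) := by
  induction n with
  | zero => exact isGenerator_unitSection U
  | succ n ih => exact IsGenerator.tensorSection ih hs

section ExteriorPower

/-- An alternating map of top degree multiplies by the determinant under a change of family. -/
lemma alternatingMap_sum {R M N ι : Type*} [CommRing R] [AddCommGroup M] [Module R M]
    [AddCommGroup N] [Module R N] [Fintype ι] [DecidableEq ι] (ω : M [⋀^ι]→ₗ[R] N) (e f : ι → M)
    (G : Matrix ι ι R) (h : ∀ i, f i = ∑ j, G i j • e j) : ω f = G.det • ω e := by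
  have key : ω.compLinearMap (Fintype.linearCombination R e) =
      (LinearMap.toSpanSingleton R N (ω e)).compAlternatingMap (Pi.basisFun R ι).det := by
    refine Module.Basis.ext_alternating (Pi.basisFun R ι) fun v hv => ?_
    let σ : Equiv.Perm ι := Equiv.ofBijective v (Finite.injective_iff_bijective.1 hv)
    have hσ : ∀ i, v i = σ i := fun i => rfl
    have h1 : (fun i => Fintype.linearCombination R e ((Pi.basisFun R ι) (v i))) = e ∘ σ := by
      funext i
      simp [Fintype.linearCombination_apply_single, hσ]
    have h2 : (fun i => (Pi.basisFun R ι) (v i)) = (Pi.basisFun R ι) ∘ σ := rfl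
    rw [AlternatingMap.compLinearMap_apply, LinearMap.compAlternatingMap_apply, h1, h2,
      AlternatingMap.map_perm, AlternatingMap.map_perm, Module.Basis.det_self]
    simp
  have hf : f = fun i => Fintype.linearCombination R e (G i) := by
    funext i
    rw [h i, Fintype.linearCombination_apply]
  rw [hf]
  exact (congrArg (fun φ => φ G) key).trans (congrArg (· • ω e) (Pi.basisFun_det_apply G))

/-- The top exterior power of a free module is free on the product of the members of a basis. -/
lemma bijective_smul_ιMulti {R M : Type*} [CommRing R] [AddCommGroup M] [Module R M] {n : ℕ}
    {e : Fin n → M} (he : Function.Bijective fun r : Fin n → R => ∑ i, r i • e i) :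
    Function.Bijective fun r : R => r • _root_.exteriorPower.ιMulti R n e := by
  let φ : (Fin n → R) ≃ₗ[R] M := LinearEquiv.ofBijective (Fintype.linearCombination R e) he
  let b : Module.Basis (Fin n) R M := (Pi.basisFun R (Fin n)).map φ
  have hb : ⇑b = e := by
    funext i
    have : φ (Pi.single i 1) = Fintype.linearCombination R e (Pi.single i 1) := rfl
    simp [b, this, Fintype.linearCombination_apply_single]
  constructor
  · let D := _root_.exteriorPower.alternatingMapLinearEquiv b.det
    have hD : D (_root_.exteriorPower.ιMulti R n e) = 1 := by
      rw [_root_.exteriorPower.alternatingMapLinearEquiv_apply_ιMulti, ← hb, b.det_self]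
    intro r s hrs
    have := congrArg D hrs
    simpa [hD] using this
  · let S := LinearMap.range (LinearMap.toSpanSingleton R _ (_root_.exteriorPower.ιMulti R n e))
    suffices S = ⊤ by
      intro x
      exact (this ▸ Submodule.mem_top : x ∈ S)
    rw [eq_top_iff, ← _root_.exteriorPower.ιMulti_span, Submodule.span_le]
    rintro _ ⟨v, rfl⟩
    refine ⟨Matrix.det (fun i => b.repr (v i)), ?_⟩
    rw [LinearMap.toSpanSingleton_apply]
    refine (alternatingMap_sum _ _ _ _ fun i => ?_).symm
    conv_lhs => rw [← b.sum_repr (v i), hb]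

/-- The section `s₁ ∧ ⋯ ∧ sₙ` of an exterior power of a sheaf of modules. -/
def wedgeSection (M : X.Modules) {n : ℕ} {U : X.Opens} (s : Fin n → M.val.obj (op U)) :
    (exteriorPower M n).val.obj (op U) :=
  toSheafify (presheafExteriorPower (R := X.presheaf) M.val n) U
    (_root_.exteriorPower.ιMulti Γ(X, U) n s)

lemma res_wedgeSection (M : X.Modules) {n : ℕ} {U V : X.Opens} (h : V ≤ U)
    (s : Fin n → M.val.obj (op U)) :
    res (exteriorPower M n).val h (wedgeSection M s) =
      wedgeSection M (fun i => res M.val h (s i)) :=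
  (res_toSheafify _ _ _).trans
    (congrArg (toSheafify (presheafExteriorPower (R := X.presheaf) M.val n) V)
      (exteriorPowerRes_mk (R := X.presheaf) M.val n (homOfLE h).op s))

lemma wedgeSection_sum (M : X.Modules) {n : ℕ} {U : X.Opens} (e f : Fin n → M.val.obj (op U))
    (G : Matrix (Fin n) (Fin n) Γ(X, U)) (h : ∀ i, f i = ∑ j, G i j • e j) :
    wedgeSection M f = G.det • wedgeSection M e := by
  refine Eq.trans ?_ ((toSheafify (presheafExteriorPower (R := X.presheaf) M.val n) U).map_smul
    G.det (_root_.exteriorPower.ιMulti Γ(X, U) n e))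
  exact congrArg (toSheafify (presheafExteriorPower (R := X.presheaf) M.val n) U)
    (alternatingMap_sum _ _ _ _ h)

lemma IsFrame.wedgeSection {M : X.Modules} {n : ℕ} {U : X.Opens} {e : Fin n → M.val.obj (op U)}
    (he : IsFrame M.val U e) : IsGenerator (exteriorPower M n).val U (wedgeSection M e) := by
  refine IsGenerator.sheafify ?_
  intro W h
  have : res (presheafExteriorPower (R := X.presheaf) M.val n) h
      (_root_.exteriorPower.ιMulti Γ(X, U) n e) =
      _root_.exteriorPower.ιMulti Γ(X, W) n (fun i => res M.val h (e i)) :=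
    exteriorPowerRes_mk (R := X.presheaf) M.val n (homOfLE h).op e
  rw [this]
  exact bijective_smul_ιMulti (he W h)

end ExteriorPower

end Generators

/-! ### Gluing isomorphisms of sheaves of modules -/

section Gluing

variable {X : Scheme.{u}}

section Gluing

/-- The map on sections over `U` induced by a morphism of sheaves of modules. -/
def homSec {L N : X.Modules} (φ : L ⟶ N) (U : X.Opens) :
    L.val.obj (op U) →ₗ[Γ(X, U)] N.val.obj (op U) :=
  (φ.val.app (op U)).hom

lemma res_homSec {L N : X.Modules} (φ : L ⟶ N) {V U : X.Opens} (h : V ≤ U)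
    (s : L.val.obj (op U)) : res N.val h (homSec φ U s) = homSec φ V (res L.val h s) :=
  (PresheafOfModules.naturality_apply φ.val (homOfLE h).op s).symm

lemma hom_ext_homSec {L N : X.Modules} {φ ψ : L ⟶ N} (h : ∀ U s, homSec φ U s = homSec ψ U s) :
    φ = ψ := by
  apply Scheme.Modules.hom_ext
  intro U
  ext s
  exact h U s

/-- A morphism of sheaves of modules from compatible linear maps on sections. -/
def homOfSec {L N : X.Modules} (f : ∀ U : X.Opens, L.val.obj (op U) →ₗ[Γ(X, U)] N.val.obj (op U))
    (hf : ∀ (V U : X.Opens) (h : V ≤ U) (s : L.val.obj (op U)),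
      res N.val h (f U s) = f V (res L.val h s)) : L ⟶ N :=
  ⟨{ app := fun U => ModuleCat.ofHom (f U.unop)
     naturality := by
      intro U V g
      ext s
      exact (hf V.unop U.unop (leOfHom g.unop) s).symm }⟩

variable {L N : X.Modules} {ι : Type u} {V : ι → X.Opens} {l : ∀ i, L.val.obj (op (V i))}

/-- Two morphisms which agree on generators over the members of an open cover are equal. -/
lemma hom_ext_of_isGenerator (hV : ∀ x : X, ∃ i, x ∈ V i) (hl : ∀ i, IsGenerator L.val (V i) (l i))
    {φ ψ : L ⟶ N} (h : ∀ i, homSec φ _ (l i) = homSec ψ _ (l i)) : φ = ψ := by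
  apply hom_ext_homSec
  intro U s
  apply res_ext
  intro x hx
  obtain ⟨i, hi⟩ := hV x
  refine ⟨U ⊓ V i, inf_le_left, ⟨hx, hi⟩, ?_⟩
  obtain ⟨r, hr⟩ := (hl i (U ⊓ V i) inf_le_right).2 (res L.val inf_le_left s)
  simp only at hr
  rw [res_homSec, res_homSec, ← hr, map_smul, map_smul, ← res_homSec, ← res_homSec, h]

/-- A morphism out of a sheaf of modules with local generators is determined by a family of images
of these generators with the same transition functions. -/
lemma exists_hom_of_isGenerator (hV : ∀ x : X, ∃ i, x ∈ V i)
    (hl : ∀ i, IsGenerator L.val (V i) (l i)) (n : ∀ i, N.val.obj (op (V i)))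
    (hn : ∀ i j, ∃ g : Γ(X, V i ⊓ V j),
      res L.val inf_le_right (l j) = g • res L.val inf_le_left (l i) ∧
      res N.val inf_le_right (n j) = g • res N.val inf_le_left (n i)) :
    ∃ φ : L ⟶ N, ∀ i, homSec φ _ (l i) = n i := by
  -- the image of a section is characterized by its local expressions in the generators
  have key : ∀ (U : X.Opens) (s : L.val.obj (op U)), ∃ t : N.val.obj (op U),
      ∀ i (W : X.Opens) (hU : W ≤ U) (hi : W ≤ V i) (r : Γ(X, W)),
        res L.val hU s = r • res L.val hi (l i) → res N.val hU t = r • res N.val hi (n i) := by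
    intro U s
    choose r hr using fun i => (hl i (U ⊓ V i) inf_le_right).2 (res L.val inf_le_left s)
    simp only at hr
    have cover : U ≤ ⨆ i, U ⊓ V i := fun x hx => by
      obtain ⟨i, hi⟩ := hV x
      simp only [TopologicalSpace.Opens.mem_iSup]
      exact ⟨i, hx, hi⟩
    -- two local expressions of the same section have the same image
    have indep : ∀ i j (W : X.Opens) (hi : W ≤ V i) (hj : W ≤ V j) (a b : Γ(X, W)),
        a • res L.val hi (l i) = b • res L.val hj (l j) →
        a • res N.val hi (n i) = b • res N.val hj (n j) := by
      intro i j W hi hj a b hab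
      obtain ⟨g, hg, hg'⟩ := hn i j
      have h1 := congrArg (res L.val (le_inf hi hj)) hg
      have h2 := congrArg (res N.val (le_inf hi hj)) hg'
      simp only [res_smul, res_res] at h1 h2
      rw [h1, smul_smul] at hab
      rw [h2, smul_smul]
      rw [(hl i W hi).1 hab]
    obtain ⟨t, ht⟩ := res_glue N (fun i => U ⊓ V i) (fun i => inf_le_left) cover
      (fun i => r i • res N.val inf_le_right (n i)) (by
        intro i j
        have hi := congrArg (res L.val (inf_le_left : (U ⊓ V i) ⊓ (U ⊓ V j) ≤ _)) (hr i)
        have hj := congrArg (res L.val (inf_le_right : (U ⊓ V i) ⊓ (U ⊓ V j) ≤ _)) (hr j)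
        simp only [res_smul, res_res] at hi hj ⊢
        exact indep i j _ _ _ _ _ (hi.trans hj.symm))
    refine ⟨t, fun i W hU hi a ha => ?_⟩
    have h1 := congrArg (res N.val (le_inf hU hi)) (ht i)
    have h2 := congrArg (res L.val (le_inf hU hi)) (hr i)
    simp only [res_smul, res_res] at h1 h2
    rw [h1]
    exact indep i i W hi hi _ _ (h2.trans ha)
  choose f hf using key
  -- it suffices to know the image over the sets `U ⊓ V i`
  have uniq : ∀ (U : X.Opens) (s : L.val.obj (op U)) (t : N.val.obj (op U)),
      (∀ i, ∃ r : Γ(X, U ⊓ V i), res L.val inf_le_left s = r • res L.val inf_le_right (l i) ∧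
        res N.val inf_le_left t = r • res N.val inf_le_right (n i)) → f U s = t := by
    intro U s t h
    apply res_ext
    intro x hx
    obtain ⟨i, hi⟩ := hV x
    obtain ⟨r, h1, h2⟩ := h i
    exact ⟨U ⊓ V i, inf_le_left, ⟨hx, hi⟩, (hf U s i _ inf_le_left inf_le_right r h1).trans h2.symm⟩
  have coord : ∀ (U : X.Opens) (s : L.val.obj (op U)) i, ∃ r : Γ(X, U ⊓ V i),
      res L.val inf_le_left s = r • res L.val inf_le_right (l i) ∧
        res N.val inf_le_left (f U s) = r • res N.val inf_le_right (n i) := by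
    intro U s i
    obtain ⟨r, hr⟩ := (hl i (U ⊓ V i) inf_le_right).2 (res L.val inf_le_left s)
    exact ⟨r, hr.symm, hf U s i _ _ _ r hr.symm⟩
  have f_add : ∀ U s s', f U (s + s') = f U s + f U s' := by
    intro U s s'
    apply uniq
    intro i
    obtain ⟨r, h1, h2⟩ := coord U s i
    obtain ⟨r', h1', h2'⟩ := coord U s' i
    exact ⟨r + r', by rw [map_add, h1, h1', add_smul], by rw [map_add, h2, h2', add_smul]⟩
  have f_smul : ∀ U (a : Γ(X, U)) s, f U (a • s) = a • f U s := by
    intro U a s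
    apply uniq
    intro i
    obtain ⟨r, h1, h2⟩ := coord U s i
    exact ⟨ores X inf_le_left a * r, by rw [res_smul, h1, mul_smul],
      by rw [res_smul, h2, mul_smul]⟩
  have f_res : ∀ (W U : X.Opens) (h : W ≤ U) s, f W (res L.val h s) = res N.val h (f U s) := by
    intro W U h s
    apply uniq
    intro i
    obtain ⟨r, h1, h2⟩ := coord U s i
    have h1 := congrArg (res L.val (inf_le_inf_right (V i) h)) h1
    have h2 := congrArg (res N.val (inf_le_inf_right (V i) h)) h2
    simp only [res_smul, res_res] at h1 h2
    exact ⟨ores X (inf_le_inf_right (V i) h) r, by rw [res_res, h1], by rw [res_res, h2]⟩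
  refine ⟨homOfSec (fun U => { toFun := f U, map_add' := f_add U, map_smul' := f_smul U })
    (fun W U h s => (f_res W U h s).symm), fun i => ?_⟩
  refine uniq (V i) (l i) (n i) fun j => ?_
  obtain ⟨g, h1, h2⟩ := hn j i
  have h1 := congrArg (res L.val (inf_comm (V i) (V j)).le) h1
  have h2 := congrArg (res N.val (inf_comm (V i) (V j)).le) h2
  simp only [res_smul, res_res] at h1 h2
  exact ⟨_, h1, h2⟩

end Gluing

section Pullback

variable {J : Scheme.{u}} (π : J ⟶ X)

/-- If `T` has local generators on `X` and `L` has local generators on `J` over the preimages, with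
the same transition functions, then `L` is the pullback of `T`: both represent the same functor, since
morphisms to `N` are given by sections of `N` over the preimages with these transition functions. -/
theorem nonempty_iso_pullback_of_isGenerator (T : X.Modules) (L : J.Modules) {ι : Type u}
    {U : ι → X.Opens} (hU : ∀ x : X, ∃ i, x ∈ U i) {t : ∀ i, T.val.obj (op (U i))}
    (ht : ∀ i, IsGenerator T.val (U i) (t i)) {l : ∀ i, L.val.obj (op (π ⁻¹ᵁ U i))}
    (hl : ∀ i, IsGenerator L.val (π ⁻¹ᵁ U i) (l i))
    (h : ∀ i j, ∃ g : Γ(X, U i ⊓ U j),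
      res T.val inf_le_right (t j) = g • res T.val inf_le_left (t i) ∧
      res L.val (π.preimage_mono inf_le_right) (l j) =
        (π.app _).hom g • res L.val (π.preimage_mono inf_le_left) (l i)) :
    Nonempty (L ≅ (Scheme.Modules.pullback π).obj T) := by
  obtain ⟨φ, hφ⟩ := exists_hom_of_isGenerator (N := (Scheme.Modules.pushforward π).obj L) hU ht l
    (fun i j => h i j)
  let adj := Scheme.Modules.pullbackPushforwardAdjunction π
  let ψ : (Scheme.Modules.pullback π).obj T ⟶ L := (adj.homEquiv T L).symm φ
  have hJ : ∀ x : J, ∃ i, x ∈ π ⁻¹ᵁ U i := fun x => hU (π x)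
  have hψ : ∀ (N : J.Modules) (b : L ⟶ N),
      adj.homEquiv T N (ψ ≫ b) = φ ≫ (Scheme.Modules.pushforward π).map b := by
    intro N b
    rw [Adjunction.homEquiv_naturality_right, Equiv.apply_symm_apply]
  have : IsIso ψ := by
    rw [isIso_iff_coyoneda_map_bijective]
    intro N
    constructor
    · intro b b' hb
      have hb : ψ ≫ b = ψ ≫ b' := hb
      have hb := congrArg (adj.homEquiv T N) hb
      rw [hψ, hψ] at hb
      refine hom_ext_of_isGenerator hJ hl fun i => ?_
      have := congrArg (fun χ => homSec χ (U i) (t i)) hb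
      change homSec b _ (homSec φ (U i) (t i)) = homSec b' _ (homSec φ (U i) (t i)) at this
      rwa [hφ] at this
    · intro a
      let α := adj.homEquiv T N a
      obtain ⟨b, hb⟩ := exists_hom_of_isGenerator (N := N) hJ hl
        (fun i => (homSec α (U i) (t i) : N.val.obj (op (π ⁻¹ᵁ U i)))) (fun i j => by
          obtain ⟨g, h1, h2⟩ := h i j
          refine ⟨(π.app _).hom g, h2, ?_⟩
          have := congrArg (homSec α (U i ⊓ U j)) h1
          rw [map_smul, ← res_homSec, ← res_homSec] at this
          exact this)
      refine ⟨b, (adj.homEquiv T N).injective ?_⟩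
      change adj.homEquiv T N (ψ ≫ b) = _
      rw [hψ]
      refine hom_ext_of_isGenerator hU ht fun i => ?_
      change homSec b _ (homSec φ (U i) (t i)) = _
      rw [hφ]
      exact hb i
  exact ⟨(asIso ψ).symm⟩

end Pullback

end Gluing

/-! ### Jets with values in algebras -/

section Jets

open TensorProduct Polynomial

section JetRing

variable (k : Type u) [Field k] (m : ℕ)

/-- The ring `k[t]/(t^{m+1})`. This copy of `TruncatedPolynomial k m` has its own ring structure, so
that the additive structures on `B ⊗[k] JetRing k m` found by unification all agree. -/
def JetRing : Type u := TruncatedPolynomial k m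

instance : CommRing (JetRing k m) := inferInstanceAs (CommRing (TruncatedPolynomial k m))

instance : Algebra k (JetRing k m) := inferInstanceAs (Algebra k (TruncatedPolynomial k m))

/-- The class of a polynomial in `k[t]/(t^{m+1})`. -/
def JetRing.mk : k[X] →ₐ[k] JetRing k m := Ideal.Quotient.mkₐ k (Ideal.span {(X ^ (m + 1) : k[X])})

lemma JetRing.mk_surjective : Function.Surjective (mk k m) := Ideal.Quotient.mk_surjective

/-- The canonical surjection `k[t]/(t^{m+1}) → k`. -/
def JetRing.toField : JetRing k m →ₐ[k] k := TruncatedPolynomial.toField k m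

/-- The class of `t` in `k[t]/(t^{m+1})`. -/
def JetRing.t : JetRing k m := mk k m X

/-- The coefficient of `t^j` of an element of `k[t]/(t^{m+1})`; it is zero if `j > m`. -/
def JetRing.coeff (j : ℕ) : JetRing k m →ₗ[k] k :=
  lcoeff k j ∘ₗ (AdjoinRoot.modByMonicHom (g := (X ^ (m + 1) : k[X])) (monic_X_pow _))

variable {k m}

lemma JetRing.coeff_mk {j : ℕ} (hj : j ≤ m) (p : k[X]) :
    coeff k m j (mk k m p) = p.coeff j := by
  have h : coeff k m j (mk k m p) = (p %ₘ X ^ (m + 1)).coeff j :=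
    congrArg (fun q => q.coeff j) (AdjoinRoot.modByMonicHom_mk (monic_X_pow (m + 1)) p)
  rw [h]
  conv_rhs => rw [← modByMonic_add_div p (X ^ (m + 1) : k[X])]
  rw [Polynomial.coeff_add, Polynomial.coeff_X_pow_mul', if_neg (by omega), add_zero]

lemma JetRing.coeff_t_pow {j : ℕ} (hj : j ≤ m) (i : ℕ) :
    coeff k m j (t k m ^ i) = if j = i then 1 else 0 := by
  rw [t, ← map_pow, coeff_mk hj, Polynomial.coeff_X_pow]

lemma JetRing.coeff_mul {j : ℕ} (hj : j ≤ m) (r s : JetRing k m) :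
    coeff k m j (r * s) = ∑ p ∈ Finset.HasAntidiagonal.antidiagonal j, coeff k m p.1 r * coeff k m p.2 s := by
  obtain ⟨p, rfl⟩ := mk_surjective k m r
  obtain ⟨q, rfl⟩ := mk_surjective k m s
  rw [← map_mul, coeff_mk hj, Polynomial.coeff_mul]
  refine Finset.sum_congr rfl fun x hx => ?_
  have := Finset.HasAntidiagonal.mem_antidiagonal.mp hx
  rw [coeff_mk (by omega), coeff_mk (by omega)]

lemma JetRing.sum_coeff (r : JetRing k m) :
    ∑ j ∈ Finset.range (m + 1), coeff k m j r • t k m ^ j = r := by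
  obtain ⟨p, rfl⟩ := mk_surjective k m r
  have : ∑ j ∈ Finset.range (m + 1), coeff k m j (mk k m p) • t k m ^ j =
      mk k m (∑ j ∈ Finset.range (m + 1), p.coeff j • X ^ j : k[X]) := by
    rw [map_sum]
    refine Finset.sum_congr rfl fun j hj => ?_
    rw [coeff_mk (by simpa [Nat.lt_succ_iff] using hj), t, ← map_pow]
    rfl
  rw [this]
  refine Ideal.Quotient.eq.mpr ?_
  rw [Ideal.mem_span_singleton, Polynomial.X_pow_dvd_iff]
  intro d hd
  simp only [Polynomial.coeff_sub, Polynomial.finsetSum_coeff, Polynomial.coeff_smul,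
    Polynomial.coeff_X_pow, smul_eq_mul, mul_ite, mul_one, mul_zero]
  rw [Finset.sum_ite_eq, if_pos (Finset.mem_range.mpr hd), sub_self]

end JetRing

section JetCoeff

variable {k : Type u} [Field k] (m : ℕ) {B C : Type u} [CommRing B] [Algebra k B]
  [CommRing C] [Algebra k C]

/-- The coefficient of `t^j` of an element of `B[t]/(t^{m+1}) = B ⊗ k[t]/(t^{m+1})`. -/
def jetCoeff (j : ℕ) : B ⊗[k] JetRing k m →ₗ[B] B :=
  (AlgebraTensorModule.rid k B B).toLinearMap ∘ₗ
    AlgebraTensorModule.lTensor B B (JetRing.coeff k m j)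

@[simp]
lemma jetCoeff_tmul (j : ℕ) (b : B) (r : JetRing k m) :
    jetCoeff m j (b ⊗ₜ[k] r) = JetRing.coeff k m j r • b := by
  simp [jetCoeff]

lemma jetCoeff_map (σ : B →ₐ[k] C) (j : ℕ) (u : B ⊗[k] JetRing k m) :
    jetCoeff m j (Algebra.TensorProduct.map σ (AlgHom.id k _) u) = σ (jetCoeff m j u) := by
  induction u with
  | zero => simp
  | add u v hu hv => simp [hu, hv]
  | tmul b r => simp

lemma jetCoeff_mul {j : ℕ} (hj : j ≤ m) (u v : B ⊗[k] JetRing k m) :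
    jetCoeff m j (u * v) =
      ∑ p ∈ Finset.HasAntidiagonal.antidiagonal j, jetCoeff m p.1 u * jetCoeff m p.2 v := by
  induction u with
  | zero => simp
  | add u u' hu hu' => simp only [add_mul, map_add, hu, hu', Finset.sum_add_distrib]
  | tmul b r =>
    induction v with
    | zero => simp
    | add v v' hv hv' => simp only [mul_add, map_add, hv, hv', Finset.sum_add_distrib]
    | tmul c s =>
      rw [Algebra.TensorProduct.tmul_mul_tmul, jetCoeff_tmul, JetRing.coeff_mul hj,
        Finset.sum_smul]
      simp only [jetCoeff_tmul, smul_mul_smul_comm]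

lemma sum_jetCoeff (u : B ⊗[k] JetRing k m) :
    ∑ j ∈ Finset.range (m + 1), jetCoeff m j u ⊗ₜ[k] (JetRing.t k m ^ j) = u := by
  induction u with
  | zero => simp
  | add u v hu hv => simp only [map_add, add_tmul, Finset.sum_add_distrib, hu, hv]
  | tmul b r =>
    conv_rhs => rw [← JetRing.sum_coeff r, tmul_sum]
    simp only [jetCoeff_tmul, smul_tmul]

lemma jet_ext {u v : B ⊗[k] JetRing k m}
    (h : ∀ j ≤ m, jetCoeff m j u = jetCoeff m j v) : u = v := by
  rw [← sum_jetCoeff m u, ← sum_jetCoeff m v]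
  exact Finset.sum_congr rfl fun j hj => by rw [h j (by simpa [Nat.lt_succ_iff] using hj)]

lemma jetCoeff_tmul_t_pow {j : ℕ} (hj : j ≤ m) (b : B) (i : ℕ) :
    jetCoeff m j (b ⊗ₜ[k] (JetRing.t k m ^ i)) = if j = i then b else 0 := by
  rw [jetCoeff_tmul, JetRing.coeff_t_pow hj]
  split_ifs <;> simp

lemma jetCoeff_sum_tmul {j : ℕ} (hj : j ≤ m) (b : ℕ → B) :
    jetCoeff m j (∑ i ∈ Finset.range (m + 1), b i ⊗ₜ[k] (JetRing.t k m ^ i)) = b j := by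
  simp only [map_sum, jetCoeff_tmul_t_pow m hj]
  rw [Finset.sum_ite_eq, if_pos (Finset.mem_range.mpr (by omega))]

variable (k B) in
/-- The reduction `B[t]/(t^{m+1}) → B` modulo `t`. -/
def jetZero : B ⊗[k] JetRing k m →ₐ[k] B :=
  (Algebra.TensorProduct.rid k k B).toAlgHom.comp
    (Algebra.TensorProduct.map (AlgHom.id k B) (JetRing.toField k m))

lemma JetRing.coeff_zero (r : JetRing k m) :
    coeff k m 0 r = JetRing.toField k m r := by
  obtain ⟨p, rfl⟩ := JetRing.mk_surjective k m r
  rw [coeff_mk (Nat.zero_le m)]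
  change _ = aeval 0 p
  rw [Polynomial.coeff_zero_eq_aeval_zero]

lemma jetZero_apply (u : B ⊗[k] JetRing k m) : jetZero k m B u = jetCoeff m 0 u := by
  induction u with
  | zero => simp
  | add u v hu hv => rw [map_add, map_add, hu, hv]
  | tmul b r => simp [jetZero, JetRing.coeff_zero]

end JetCoeff

/-- A jet `γ : A → B[t]/(t^{m+1})` is universal if `B` represents the functor
`C ↦ Hom_k(A, C[t]/(t^{m+1}))` on `k`-algebras through `γ`. -/
def IsUniversalJet {k : Type u} [Field k] {m : ℕ} {A B : Type u} [CommRing A] [Algebra k A]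
    [CommRing B] [Algebra k B] (γ : A →ₐ[k] B ⊗[k] JetRing k m) : Prop :=
  ∀ (C : Type u) [CommRing C] [Algebra k C], Function.Bijective fun σ : B →ₐ[k] C =>
    (Algebra.TensorProduct.map σ (AlgHom.id k (JetRing k m))).comp γ

section Existence

variable {k : Type u} [Field k] (m : ℕ) (A : Type u) [CommRing A] [Algebra k A]

/-- The polynomial ring in variables `a^{(j)}`, for `a ∈ A` and `0 ≤ j ≤ m`. -/
abbrev JetPolynomial (k : Type u) [Field k] (m : ℕ) (A : Type u) : Type u :=
  MvPolynomial (A × Fin (m + 1)) k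

variable {m A} in
/-- Evaluation of the variables `a^{(j)}` at the coefficients of a jet. -/
def jetEval {C : Type u} [CommRing C] [Algebra k C] (δ : A →ₐ[k] C ⊗[k] JetRing k m) :
    JetPolynomial k m A →ₐ[k] C :=
  MvPolynomial.aeval fun p => jetCoeff m p.2 (δ p.1)

variable (k) in
/-- The relations satisfied by the coefficients of all jets of `A`. -/
def jetIdeal : Ideal (JetPolynomial k m A) where
  carrier := {p | ∀ (C : Type u) [CommRing C] [Algebra k C]
    (δ : A →ₐ[k] C ⊗[k] JetRing k m), jetEval δ p = 0}
  zero_mem' := fun _ _ _ _ => map_zero _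
  add_mem' := fun hp hq C _ _ δ => by rw [map_add, hp C δ, hq C δ, add_zero]
  smul_mem' := fun r p hp C _ _ δ => by rw [smul_eq_mul, map_mul, hp C δ, mul_zero]

variable (k) in
/-- The coordinate ring of the `m`-jet scheme of `Spec A`. -/
abbrev JetAlgebra : Type u := JetPolynomial k m A ⧸ jetIdeal k m A

variable {m A} in
/-- The homomorphism out of the jet algebra which classifies a jet. -/
def jetLift {C : Type u} [CommRing C] [Algebra k C] (δ : A →ₐ[k] C ⊗[k] JetRing k m) :
    JetAlgebra k m A →ₐ[k] C :=
  Ideal.Quotient.liftₐ _ (jetEval δ) fun _ hp => hp C δ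

/-- Identities over the jet algebra can be checked on all jets, by the choice of its relations. -/
lemma jetAlgebra_eq_zero {u : JetAlgebra k m A ⊗[k] JetRing k m}
    (h : ∀ (C : Type u) [CommRing C] [Algebra k C] (δ : A →ₐ[k] C ⊗[k] JetRing k m),
      Algebra.TensorProduct.map (jetLift δ) (AlgHom.id k _) u = 0) : u = 0 := by
  apply jet_ext
  intro j _
  obtain ⟨p, hp⟩ := Ideal.Quotient.mk_surjective (jetCoeff m j u)
  rw [map_zero, ← hp, Ideal.Quotient.eq_zero_iff_mem]
  intro C _ _ δ
  have := jetCoeff_map m (jetLift δ) j u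
  rw [h C δ, map_zero, ← hp] at this
  exact this.symm

/-- The series `∑ a^{(j)} t^j`. The index runs over natural numbers, so the variables are extended by
zero to `j > m`. -/
def jetSeries (a : A) : JetAlgebra k m A ⊗[k] JetRing k m :=
  ∑ j ∈ Finset.range (m + 1), (if h : j < m + 1 then
    Ideal.Quotient.mk (jetIdeal k m A) (MvPolynomial.X (a, ⟨j, h⟩)) else 0) ⊗ₜ[k]
      (JetRing.t k m ^ j)

lemma jetCoeff_jetSeries (a : A) (j : Fin (m + 1)) : jetCoeff m j (jetSeries (k := k) m A a) =
    Ideal.Quotient.mk (jetIdeal k m A) (MvPolynomial.X (a, j)) := by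
  rw [jetSeries, jetCoeff_sum_tmul m (Nat.lt_succ_iff.mp j.2), dif_pos j.2]

lemma map_jetLift_jetSeries {C : Type u} [CommRing C] [Algebra k C]
    (δ : A →ₐ[k] C ⊗[k] JetRing k m) (a : A) :
    Algebra.TensorProduct.map (jetLift δ) (AlgHom.id k _) (jetSeries m A a) = δ a := by
  apply jet_ext
  intro j hj
  rw [jetCoeff_map, jetCoeff_jetSeries m A a ⟨j, Nat.lt_succ_iff.mpr hj⟩]
  exact MvPolynomial.aeval_X _ _

variable (k) in
/-- The universal jet of `A`. -/
def universalJet : A →ₐ[k] JetAlgebra k m A ⊗[k] JetRing k m where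
  toFun := jetSeries m A
  map_one' := by
    rw [← sub_eq_zero]
    refine jetAlgebra_eq_zero m A fun C _ _ δ => ?_
    rw [map_sub, map_jetLift_jetSeries, map_one, map_one (Algebra.TensorProduct.map _ _), sub_self]
  map_mul' a b := by
    rw [← sub_eq_zero]
    refine jetAlgebra_eq_zero m A fun C _ _ δ => ?_
    simp only [map_sub, map_mul, map_jetLift_jetSeries, sub_self]
  map_zero' := by
    refine jetAlgebra_eq_zero m A fun C _ _ δ => ?_
    rw [map_jetLift_jetSeries, map_zero]
  map_add' a b := by
    rw [← sub_eq_zero]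
    refine jetAlgebra_eq_zero m A fun C _ _ δ => ?_
    simp only [map_sub, map_add, map_jetLift_jetSeries, sub_self]
  commutes' c := by
    rw [← sub_eq_zero]
    refine jetAlgebra_eq_zero m A fun C _ _ δ => ?_
    rw [map_sub, map_jetLift_jetSeries, AlgHom.commutes, AlgHom.commutes, sub_self]

lemma isUniversalJet_universalJet : IsUniversalJet (universalJet k m A) := by
  intro C _ _
  constructor
  · intro σ τ h
    apply Ideal.Quotient.algHom_ext
    apply MvPolynomial.algHom_ext
    rintro ⟨a, j⟩
    have := congrArg (fun δ => jetCoeff m j (δ a)) h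
    simp only [AlgHom.comp_apply, jetCoeff_map] at this
    have e : jetCoeff m j (universalJet k m A a) = _ := jetCoeff_jetSeries m A a j
    rw [e] at this
    exact this
  · intro δ
    exact ⟨jetLift δ, AlgHom.ext fun a => map_jetLift_jetSeries m A δ a⟩

end Existence

section Generators

variable {k : Type u} [Field k] {m : ℕ} {A B : Type u} [CommRing A] [Algebra k A]
  [CommRing B] [Algebra k B] {γ : A →ₐ[k] B ⊗[k] JetRing k m}

/-- The coefficients of the universal jet of a set of generators generate: the universal jet factors
through the subalgebra which they generate. -/
lemma IsUniversalJet.adjoin_eq_top (hγ : IsUniversalJet γ) {s : Set A}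
    (hs : Algebra.adjoin k s = ⊤) :
    Algebra.adjoin k {b | ∃ a ∈ s, ∃ j ≤ m, jetCoeff m j (γ a) = b} = ⊤ := by
  set S := Algebra.adjoin k {b | ∃ a ∈ s, ∃ j ≤ m, jetCoeff m j (γ a) = b} with hS
  let i : S ⊗[k] JetRing k m →ₐ[k] B ⊗[k] JetRing k m :=
    Algebra.TensorProduct.map S.val (AlgHom.id k _)
  have hi : Function.Injective i := by
    intro u v huv
    apply jet_ext
    intro j _
    apply Subtype.val_injective
    have := congrArg (jetCoeff m j) huv
    rwa [jetCoeff_map, jetCoeff_map] at this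
  have hγi : ∀ a, γ a ∈ i.range := by
    suffices (⊤ : Subalgebra k A) ≤ i.range.comap γ from fun a => this trivial
    rw [← hs, Algebra.adjoin_le_iff]
    intro a ha
    have hmem : ∀ j, (if h : j ≤ m then jetCoeff m j (γ a) else 0) ∈ S := by
      intro j
      split_ifs with h
      · exact Algebra.subset_adjoin ⟨a, ha, j, h, rfl⟩
      · exact S.zero_mem
    refine ⟨∑ j ∈ Finset.range (m + 1), (⟨_, hmem j⟩ : S) ⊗ₜ[k] (JetRing.t k m ^ j), ?_⟩
    apply jet_ext
    intro j hj
    refine (jetCoeff_map m S.val j _).trans ?_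
    rw [jetCoeff_sum_tmul m hj]
    exact dif_pos hj
  let γ' : A →ₐ[k] S ⊗[k] JetRing k m :=
    (AlgEquiv.ofInjective i hi).symm.toAlgHom.comp (γ.codRestrict i.range hγi)
  have hγ' : i.comp γ' = γ := by
    ext a
    exact congrArg Subtype.val ((AlgEquiv.ofInjective i hi).apply_symm_apply ⟨γ a, hγi a⟩)
  obtain ⟨σ, hσ⟩ := (hγ S).2 γ'
  have key : S.val.comp σ = AlgHom.id k B := by
    apply (hγ B).1
    simp only at hσ ⊢
    rw [Algebra.TensorProduct.map_id, AlgHom.id_comp]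
    refine Eq.trans ?_ hγ'
    rw [← hσ, ← AlgHom.comp_assoc]
    congr 1
    ext <;> simp [i]
  rw [eq_top_iff]
  intro b _
  have := congrArg (fun f => f b) key
  simp only [AlgHom.comp_apply, AlgHom.id_apply] at this
  rw [← this]
  exact (σ b).2

lemma IsUniversalJet.finiteType (hγ : IsUniversalJet γ) [hA : Algebra.FiniteType k A] :
    Algebra.FiniteType k B := by
  classical
  obtain ⟨s, hs⟩ := hA.out
  refine ⟨⟨(s ×ˢ Finset.range (m + 1)).image fun p => jetCoeff m p.2 (γ p.1), ?_⟩⟩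
  rw [← hγ.adjoin_eq_top hs]
  congr 1
  ext b
  simp only [Finset.coe_image, Finset.coe_product, Set.mem_image, Set.mem_prod, Finset.mem_coe,
    Finset.mem_range, Prod.exists, Set.mem_ofPred_eq, Nat.lt_succ_iff]
  constructor
  · rintro ⟨a, j, ⟨ha, hj⟩, rfl⟩; exact ⟨a, ha, j, hj, rfl⟩
  · rintro ⟨a, ha, j, hj, rfl⟩; exact ⟨a, j, ⟨ha, hj⟩, rfl⟩

end Generators

end Jets

/-! ### Differentials of the algebra of jets -/

section JetDifferentials

open TensorProduct Polynomial

section Differentials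

variable {k : Type u} [Field k] {m : ℕ} {A B : Type u} [CommRing A] [Algebra k A]
  [CommRing B] [Algebra k B]

/-- The difference of two homomorphisms which agree modulo an ideal of square zero is a derivation,
so it is compatible with relations between differentials. -/
lemma sub_eq_sum_of_D_eq_sum {S : Type u} [CommRing S] [Algebra k S] (f g : A →ₐ[k] S)
    (hfg : ∀ a b, (f a - g a) * (f b - g b) = 0) {ι : Type*} [Fintype ι] {y : A} {x c : ι → A}
    (h : KaehlerDifferential.D k A y = ∑ l, c l • KaehlerDifferential.D k A (x l)) :
    f y - g y = ∑ l, g (c l) * (f (x l) - g (x l)) := by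
  let := g.toRingHom.toAlgebra
  have : IsScalarTower k A S := IsScalarTower.of_algebraMap_eq fun r => (g.commutes r).symm
  have hsmul (a : A) (s : S) : a • s = g a * s := rfl
  let d : Derivation k A S := Derivation.mk' (f.toLinearMap - g.toLinearMap) (by
    intro a b
    have := hfg a b
    simp only [LinearMap.sub_apply, AlgHom.toLinearMap_apply, map_mul, hsmul]
    linear_combination this)
  have key := congrArg d.liftKaehlerDifferential h
  simp only [map_sum, map_smul, Derivation.liftKaehlerDifferential_comp_D, hsmul] at key
  exact key

/-- Relations between differentials in `A` induce relations between the differentials of the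
coefficients of a jet of `A`. -/
lemma D_jetCoeff_eq_sum (γ : A →ₐ[k] B ⊗[k] JetRing k m) {ι : Type*} [Fintype ι] {y : A}
    {x c : ι → A} (h : KaehlerDifferential.D k A y = ∑ l, c l • KaehlerDifferential.D k A (x l))
    {j : ℕ} (hj : j ≤ m) :
    KaehlerDifferential.D k B (jetCoeff m j (γ y)) =
      ∑ l, ∑ p ∈ Finset.HasAntidiagonal.antidiagonal j, jetCoeff m p.1 (γ (c l)) •
        KaehlerDifferential.D k B (jetCoeff m p.2 (γ (x l))) := by
  let : Module Bᵐᵒᵖ (Ω[B⁄k]) := Module.compHom _ ((RingHom.id B).fromOpposite mul_comm)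
  have : IsCentralScalar B (Ω[B⁄k]) := ⟨fun _ _ => rfl⟩
  -- `θ = id + ε d`; applied to the coefficients of jets it deforms `γ` in the direction `d ∘ γ`
  let θ : B →ₐ[k] TrivSqZeroExt B (Ω[B⁄k]) := AlgHom.ofLinearMap
    ((TrivSqZeroExt.inlAlgHom k B (Ω[B⁄k])).toLinearMap +
      (TrivSqZeroExt.inrHom B (Ω[B⁄k])).restrictScalars k ∘ₗ (KaehlerDifferential.D k B).toLinearMap)
    (by ext <;> simp) (by intro a b; ext <;> simp)
  let θ₀ : B →ₐ[k] TrivSqZeroExt B (Ω[B⁄k]) := TrivSqZeroExt.inlAlgHom k B (Ω[B⁄k])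
  have hθ (b : B) : θ b - θ₀ b = TrivSqZeroExt.inr (KaehlerDifferential.D k B b) := by
    ext <;> simp [θ, θ₀]
  have hc (j : ℕ) (a : A) : jetCoeff m j (Algebra.TensorProduct.map θ (AlgHom.id k (JetRing k m)) (γ a) -
      Algebra.TensorProduct.map θ₀ (AlgHom.id k (JetRing k m)) (γ a)) =
      TrivSqZeroExt.inr (KaehlerDifferential.D k B (jetCoeff m j (γ a))) := by
    rw [map_sub, jetCoeff_map, jetCoeff_map, hθ]
  have key := sub_eq_sum_of_D_eq_sum
    ((Algebra.TensorProduct.map θ (AlgHom.id k (JetRing k m))).comp γ)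
    ((Algebra.TensorProduct.map θ₀ (AlgHom.id k (JetRing k m))).comp γ) (by
      intro a b
      apply jet_ext
      intro j hj
      rw [jetCoeff_mul m hj, map_zero]
      refine Finset.sum_eq_zero fun p _ => ?_
      simp only [AlgHom.comp_apply]
      rw [hc, hc, TrivSqZeroExt.inr_mul_inr]) h
  simp only [AlgHom.comp_apply] at key
  apply TrivSqZeroExt.inr_injective (R := B)
  rw [← hc, key, map_sum, ← TrivSqZeroExt.inrHom_apply, map_sum]
  refine Finset.sum_congr rfl fun l _ => ?_
  rw [jetCoeff_mul m hj, map_sum]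
  refine Finset.sum_congr rfl fun p _ => ?_
  rw [hc, jetCoeff_map, TrivSqZeroExt.inrHom_apply, TrivSqZeroExt.inr_smul]
  exact TrivSqZeroExt.inl_mul_eq_smul _ _

lemma span_D_eq_top_of_adjoin_eq_top {s : Set B} (hs : Algebra.adjoin k s = ⊤) :
    Submodule.span B (KaehlerDifferential.D k B '' s) = ⊤ := by
  rw [eq_top_iff, ← KaehlerDifferential.span_range_derivation, Submodule.span_le]
  rintro _ ⟨b, rfl⟩
  have hb : b ∈ Algebra.adjoin k s := hs ▸ trivial
  induction hb using Algebra.adjoin_induction with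
  | mem x hx => exact Submodule.subset_span ⟨x, hx, rfl⟩
  | algebraMap r => simp
  | add x y _ _ hx hy => rw [map_add]; exact Submodule.add_mem _ hx hy
  | mul x y _ _ hx hy =>
    rw [Derivation.leibniz]
    exact Submodule.add_mem _ (Submodule.smul_mem _ _ hy) (Submodule.smul_mem _ _ hx)

variable {γ : A →ₐ[k] B ⊗[k] JetRing k m}

/-- A derivation of `A` deforms the universal jet in the direction `t^j`, and so induces a
derivation of `B`. -/
lemma IsUniversalJet.exists_derivation (hγ : IsUniversalJet γ) (d : Derivation k A A) (j : ℕ) :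
    ∃ δ : Derivation k B B, ∀ a, ∀ q ≤ m, δ (jetCoeff m q (γ a)) =
      jetCoeff m q (γ (d a) * (1 ⊗ₜ[k] (JetRing.t k m ^ j))) := by
  let ι₀ : B →ₐ[k] DualNumber B := TrivSqZeroExt.inlAlgHom k B B
  let I := Algebra.TensorProduct.map ι₀ (AlgHom.id k (JetRing k m))
  -- the deformation `γ + ε t^j γ ∘ d`
  let e : DualNumber B ⊗[k] JetRing k m := DualNumber.eps ⊗ₜ[k] (JetRing.t k m ^ j)
  have he : e * e = 0 := by
    simp only [e, Algebra.TensorProduct.tmul_mul_tmul, DualNumber.eps_mul_eps, zero_tmul]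
  let η : A →ₐ[k] DualNumber B ⊗[k] JetRing k m := AlgHom.ofLinearMap
    ((I.comp γ).toLinearMap + (LinearMap.mulRight k e) ∘ₗ (I.comp γ).toLinearMap ∘ₗ d.toLinearMap)
    (by simp) (by
      intro a b
      simp only [LinearMap.add_apply, LinearMap.comp_apply, AlgHom.toLinearMap_apply,
        Derivation.coeFn_coe, LinearMap.mulRight_apply, map_mul, Derivation.leibniz, smul_eq_mul,
        map_add]
      linear_combination (- ((I.comp γ) (d a) * (I.comp γ) (d b))) * he)
  have hη (a) : η a = I (γ a) + I (γ (d a)) * e := rfl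
  obtain ⟨σ, hσ⟩ := (hγ (DualNumber B)).2 η
  let π : DualNumber B →ₐ[k] B := (TrivSqZeroExt.fstHom k B B)
  have hπσ : π.comp σ = AlgHom.id k B := by
    apply (hγ B).1
    ext1 a
    have h1 : Algebra.TensorProduct.map (π.comp σ) (AlgHom.id k (JetRing k m)) (γ a) =
        Algebra.TensorProduct.map π (AlgHom.id k (JetRing k m)) (η a) := by
      rw [← hσ]
      apply jet_ext
      intro q _
      simp only [AlgHom.comp_apply, jetCoeff_map]
    refine h1.trans ?_
    apply jet_ext
    intro q hq
    simp only [AlgHom.comp_apply, jetCoeff_map, hη, map_add, AlgHom.id_apply]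
    rw [jetCoeff_mul m hq, map_sum, Finset.sum_eq_zero, add_zero, jetCoeff_map]
    · simp [π, ι₀]
    · intro p _
      simp [e, π]
  have hfst (b : B) : (σ b).fst = b := congrArg (fun f => f b) hπσ
  refine ⟨Derivation.mk' ((TrivSqZeroExt.sndHom B B).restrictScalars k ∘ₗ σ.toLinearMap) ?_, ?_⟩
  · intro a b
    simp [hfst, mul_comm]
  · intro a q hq
    change (σ (jetCoeff m q (γ a))).snd = _
    rw [← jetCoeff_map, jetCoeff_mul m hq]
    have : Algebra.TensorProduct.map σ (AlgHom.id k (JetRing k m)) (γ a) = η a := by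
      rw [← hσ]; rfl
    rw [this, hη, map_add, jetCoeff_mul m hq, jetCoeff_map, TrivSqZeroExt.snd_add]
    rw [← TrivSqZeroExt.sndHom_apply B B (∑ _ ∈ _, _), map_sum]
    rw [show (ι₀ (jetCoeff m q (γ a))).snd = 0 from rfl, zero_add]
    refine Finset.sum_congr rfl fun p hp => ?_
    rw [jetCoeff_map]
    simp [e, ι₀]

/-- If the differentials `dx_i` form a basis of `Ω_A`, then the differentials of the coefficients
of the universal jet of the `x_i` form a basis of `Ω_B`. -/
lemma IsUniversalJet.bijective_D (hγ : IsUniversalJet γ) {ι : Type} [Fintype ι] {x : ι → A}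
    (hx : Function.Bijective fun r : ι → A => ∑ i, r i • KaehlerDifferential.D k A (x i)) :
    Function.Bijective fun r : ι × Fin (m + 1) → B =>
      ∑ p, r p • KaehlerDifferential.D k B (jetCoeff m p.2 (γ (x p.1))) := by
  classical
  constructor
  -- the derivations of `B` given by the dual basis of the `dx_i` and the directions `t^j` separate
  -- the `dx_i^{(j)}`
  · let φ : (ι → A) →ₗ[A] Ω[A⁄k] := Fintype.linearCombination A fun i => KaehlerDifferential.D k A (x i)
    have hφ (r) : φ r = ∑ i, r i • KaehlerDifferential.D k A (x i) := rfl
    let E : (ι → A) ≃ₗ[A] Ω[A⁄k] := LinearEquiv.ofBijective φ hx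
    have hE (l : ι) : E.symm (KaehlerDifferential.D k A (x l)) = Pi.single l 1 := by
      rw [LinearEquiv.symm_apply_eq]
      change _ = φ _
      simp [hφ, Pi.single_apply]
    have key (i : ι) (j : Fin (m + 1)) : ∃ l : Ω[B⁄k] →ₗ[B] B, ∀ p : ι × Fin (m + 1),
        l (KaehlerDifferential.D k B (jetCoeff m p.2 (γ (x p.1)))) = if p = (i, j) then 1 else 0 := by
      obtain ⟨δ, hδ⟩ := hγ.exists_derivation
        ((LinearMap.proj i ∘ₗ E.symm.toLinearMap).compDer (KaehlerDifferential.D k A)) j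
      refine ⟨δ.liftKaehlerDifferential, fun p => ?_⟩
      rw [Derivation.liftKaehlerDifferential_comp_D, hδ _ _ (Nat.lt_succ_iff.mp p.2.2)]
      have : ((LinearMap.proj i ∘ₗ E.symm.toLinearMap).compDer (KaehlerDifferential.D k A)) (x p.1) =
          (Pi.single p.1 1 : ι → A) i := congrFun (hE p.1) i
      rw [this]
      by_cases hi : p.1 = i
      · subst hi
        rw [Pi.single_eq_same, map_one, one_mul, jetCoeff_tmul_t_pow m (Nat.lt_succ_iff.mp p.2.2)]
        simp [Prod.ext_iff, Fin.ext_iff]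
      · rw [Pi.single_eq_of_ne (Ne.symm hi), map_zero, zero_mul, map_zero, if_neg]
        rintro rfl
        exact hi rfl
    intro r s hrs
    funext p
    obtain ⟨l, hl⟩ := key p.1 p.2
    have := congrArg l hrs
    simpa [hl] using this
  · have hspan := span_D_eq_top_of_adjoin_eq_top (hγ.adjoin_eq_top (s := Set.univ) (by simp))
    change Function.Surjective (Fintype.linearCombination B fun p : ι × Fin (m + 1) =>
      KaehlerDifferential.D k B (jetCoeff m p.2 (γ (x p.1))))
    rw [← LinearMap.range_eq_top, Fintype.range_linearCombination, eq_top_iff, ← hspan,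
      Submodule.span_le]
    rintro _ ⟨_, ⟨a, -, j, hj, rfl⟩, rfl⟩
    obtain ⟨r, hr⟩ := hx.2 (KaehlerDifferential.D k A a)
    rw [D_jetCoeff_eq_sum γ hr.symm hj]
    refine Submodule.sum_mem _ fun l _ => Submodule.sum_mem _ fun p hp => Submodule.smul_mem _ _ ?_
    have := Finset.HasAntidiagonal.mem_antidiagonal.mp hp
    exact Submodule.subset_span ⟨(l, ⟨p.2, by omega⟩), rfl⟩

/-- The matrix of the coefficients of the jets of a matrix `g`, which expresses the differentials of
the coefficients of the `y_i` through those of the `x_l` if `dy_i = ∑ g_il dx_l`. -/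
def jetMatrix (γ : A →ₐ[k] B ⊗[k] JetRing k m) {ι : Type} (g : Matrix ι ι A) :
    Matrix (ι × Fin (m + 1)) (ι × Fin (m + 1)) B := fun p q =>
  if q.2 ≤ p.2 then jetCoeff m (p.2 - q.2) (γ (g p.1 q.1)) else 0

lemma D_jetCoeff_eq_sum_jetMatrix (γ : A →ₐ[k] B ⊗[k] JetRing k m) {ι : Type} [Fintype ι]
    {x y : ι → A} {g : Matrix ι ι A}
    (h : ∀ i, KaehlerDifferential.D k A (y i) = ∑ l, g i l • KaehlerDifferential.D k A (x l))
    (p : ι × Fin (m + 1)) :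
    KaehlerDifferential.D k B (jetCoeff m p.2 (γ (y p.1))) = ∑ q, jetMatrix γ g p q •
      KaehlerDifferential.D k B (jetCoeff m q.2 (γ (x q.1))) := by
  obtain ⟨i, j⟩ := p
  rw [D_jetCoeff_eq_sum γ (h i) (Nat.lt_succ_iff.mp j.2), Fintype.sum_prod_type]
  refine Finset.sum_congr rfl fun l _ => ?_
  rw [← Finset.Nat.sum_antidiagonal_swap]
  simp only [Prod.fst_swap, Prod.snd_swap]
  rw [Finset.Nat.sum_antidiagonal_eq_sum_range_succ
    (fun q p => jetCoeff m p (γ (g i l)) • KaehlerDifferential.D k B (jetCoeff m q (γ (x l))))]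
  simp only [jetMatrix, Fin.le_def, ite_smul, zero_smul]
  rw [Fin.sum_univ_eq_sum_range (fun q => if q ≤ (j : ℕ) then jetCoeff m (j - q) (γ (g i l)) •
    KaehlerDifferential.D k B (jetCoeff m q (γ (x l))) else 0), ← Finset.sum_filter]
  refine Finset.sum_congr ?_ fun _ _ => rfl
  ext q
  have := j.2
  simp only [Finset.mem_range, Finset.mem_filter]
  omega

/-- The matrix of jets is block triangular, with `m + 1` diagonal blocks equal to the image of
`g` in `B`. -/
lemma det_jetMatrix (γ : A →ₐ[k] B ⊗[k] JetRing k m) {ι : Type} [Fintype ι] [DecidableEq ι]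
    (g : Matrix ι ι A) : (jetMatrix γ g).det = jetCoeff m 0 (γ g.det) ^ (m + 1) := by
  have hb : (jetMatrix γ g).BlockTriangular fun p => OrderDual.toDual p.2 := by
    intro p q hpq
    exact if_neg (not_le.mpr hpq)
  rw [hb.det_fintype]
  have (j : (Fin (m + 1))ᵒᵈ) : ((jetMatrix γ g).toSquareBlock (fun p => OrderDual.toDual p.2) j).det =
      jetCoeff m 0 (γ g.det) := by
    let e : ι ≃ {p : ι × Fin (m + 1) // OrderDual.toDual p.2 = j} :=
      { toFun := fun i => ⟨(i, OrderDual.ofDual j), rfl⟩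
        invFun := fun p => p.1.1
        left_inv := fun _ => rfl
        right_inv := by rintro ⟨⟨i, q⟩, rfl⟩; rfl }
    rw [← jetZero_apply, ← AlgHom.comp_apply, AlgHom.map_det, ← Matrix.det_submatrix_equiv_self e]
    congr 1
    ext i l
    simp [Matrix.toSquareBlock, Matrix.toSquareBlockProp, jetMatrix, e, jetZero_apply]
  rw [Finset.prod_congr rfl fun j _ => this j]
  simp

end Differentials

end JetDifferentials

/-! ### Jets in étale coordinates -/

section JetEtale

open TensorProduct Polynomial

section EtaleCoordinates

variable {k : Type u} [Field k] {m : ℕ} {A B : Type u} [CommRing A] [Algebra k A]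
  [CommRing B] [Algebra k B]

lemma exists_algHom_lift_of_formallySmooth {P S C : Type u} [CommRing P] [Algebra k P] [Algebra P A]
    [IsScalarTower k P A] [Algebra.FormallySmooth P A] [CommRing S] [Algebra k S] [CommRing C]
    [Algebra k C] (f : P →ₐ[k] S) (g : A →ₐ[k] C) (π : S →ₐ[k] C) (hπ : Function.Surjective π)
    (hker : IsNilpotent (RingHom.ker π)) (h : ∀ p, g (algebraMap P A p) = π (f p)) :
    ∃ G : A →ₐ[k] S, (∀ a, π (G a) = g a) ∧ ∀ p, G (algebraMap P A p) = f p := by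
  let := f.toRingHom.toAlgebra
  let := (π.comp f).toRingHom.toAlgebra
  have : IsScalarTower k P S := IsScalarTower.of_algebraMap_eq fun r => (f.commutes r).symm
  let g' : A →ₐ[P] C := { g.toRingHom with commutes' := h }
  let π' : S →ₐ[P] C := { π.toRingHom with commutes' := fun _ => rfl }
  refine ⟨(Algebra.FormallySmooth.liftOfSurjective g' π' hπ hker).restrictScalars k,
    fun a => Algebra.FormallySmooth.liftOfSurjective_apply g' π' hπ hker a,
    fun p => AlgHom.commutes _ p⟩

lemma isNilpotent_ker_jetZero : IsNilpotent (RingHom.ker (jetZero k m B)) := by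
  have hle : RingHom.ker (jetZero k m B) ≤ Ideal.span {(1 : B) ⊗ₜ[k] JetRing.t k m} := by
    intro u hu
    rw [RingHom.mem_ker, jetZero_apply] at hu
    rw [← sum_jetCoeff m u, Finset.sum_range_succ', hu, zero_tmul, add_zero]
    refine Ideal.sum_mem _ fun j _ => ?_
    rw [Ideal.mem_span_singleton]
    exact ⟨jetCoeff m (j + 1) u ⊗ₜ[k] (JetRing.t k m ^ j), by
      rw [Algebra.TensorProduct.tmul_mul_tmul, one_mul, pow_succ']⟩
  have ht : JetRing.t k m ^ (m + 1) = 0 := by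
    rw [JetRing.t, ← map_pow]
    exact Ideal.Quotient.eq_zero_iff_mem.mpr (Ideal.subset_span rfl)
  refine ⟨m + 1, ?_⟩
  have := Ideal.pow_right_mono hle (m + 1)
  rwa [Ideal.span_singleton_pow, Algebra.TensorProduct.tmul_pow, ht, tmul_zero,
    Ideal.span_singleton_zero, le_bot_iff] at this

lemma jetZero_surjective : Function.Surjective (jetZero k m B) := fun b =>
  ⟨b ⊗ₜ[k] 1, by simp [jetZero]⟩

/-- If `A` is formally smooth over a polynomial ring in `x_1, …, x_n`, then jets of `A` may be
prescribed by their value at `t = 0` and the higher coefficients of the `x_i`, by the infinitesimal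
lifting property. -/
lemma IsUniversalJet.exists_surjective {γ : A →ₐ[k] B ⊗[k] JetRing k m} (hγ : IsUniversalJet γ)
    (n : ℕ) [Algebra (MvPolynomial (Fin n) k) A] [IsScalarTower k (MvPolynomial (Fin n) k) A]
    [Algebra.FormallySmooth (MvPolynomial (Fin n) k) A] :
    ∃ σ : B →ₐ[k] MvPolynomial (Fin n × Fin m) A, Function.Surjective σ := by
  let C := MvPolynomial (Fin n × Fin m) A
  let c (i : Fin n) (j : ℕ) : C := if h : j = 0 then
    algebraMap A C (algebraMap (MvPolynomial (Fin n) k) A (MvPolynomial.X i)) else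
    if h' : j - 1 < m then MvPolynomial.X (i, ⟨j - 1, h'⟩) else 0
  let f : MvPolynomial (Fin n) k →ₐ[k] C ⊗[k] JetRing k m := MvPolynomial.aeval fun i =>
    ∑ j ∈ Finset.range (m + 1), c i j ⊗ₜ[k] (JetRing.t k m ^ j)
  have hf : (IsScalarTower.toAlgHom k A C).comp (IsScalarTower.toAlgHom k (MvPolynomial (Fin n) k) A) =
      (jetZero k m C).comp f := by
    apply MvPolynomial.algHom_ext
    intro i
    simp only [AlgHom.comp_apply, f, MvPolynomial.aeval_X, jetZero_apply]
    rw [jetCoeff_sum_tmul m (Nat.zero_le m)]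
    simp [c]
  obtain ⟨G, hG, hGf⟩ := exists_algHom_lift_of_formallySmooth f (IsScalarTower.toAlgHom k A C)
    (jetZero k m C) jetZero_surjective isNilpotent_ker_jetZero (fun p => congrArg (fun F => F p) hf)
  obtain ⟨σ, hσ⟩ := (hγ C).2 G
  have hσc (j : ℕ) (a : A) : σ (jetCoeff m j (γ a)) = jetCoeff m j (G a) := by
    rw [← hσ]
    exact (jetCoeff_map m σ j _).symm
  have hA (a : A) : MvPolynomial.C a ∈ σ.range := by
    refine ⟨jetCoeff m 0 (γ a), ?_⟩
    refine (hσc 0 a).trans ?_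
    rw [← jetZero_apply, hG]
    rfl
  have hX (p : Fin n × Fin m) : MvPolynomial.X p ∈ σ.range := by
    refine ⟨jetCoeff m (p.2 + 1) (γ (algebraMap (MvPolynomial (Fin n) k) A (MvPolynomial.X p.1))), ?_⟩
    refine (hσc _ _).trans ?_
    rw [hGf, MvPolynomial.aeval_X, jetCoeff_sum_tmul m (by omega)]
    simp [c]
  refine ⟨σ, fun q => ?_⟩
  change q ∈ σ.range
  induction q using MvPolynomial.induction_on with
  | C a => exact hA a
  | add p q hp hq => exact add_mem hp hq
  | mul_X p i hp => exact mul_mem hp (hX i)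

end EtaleCoordinates

end JetEtale

/-! ### Dimension and differentials -/

section Dim

open TensorProduct

section Dimension

variable {k : Type u} [Field k] {A B : Type u} [CommRing A] [Algebra k A]
  [CommRing B] [Algebra k B]

/-- For a finitely generated extension of a perfect field, the transcendence degree is the dimension
of the space of differentials: the extension is étale over the polynomial ring in a separating
transcendence basis. -/
lemma card_eq_finrank_kaehlerDifferential [PerfectField k] {K : Type u} [Field K] [Algebra k K]
    [Algebra.EssFiniteType k K] {ι : Type} [Fintype ι] {x : ι → K} (hx : IsTranscendenceBasis k x) :
    Fintype.card ι = Module.finrank K (Ω[K⁄k]) := by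
  classical
  obtain ⟨s, hs, hsep⟩ := exists_isTranscendenceBasis_and_isSeparable_of_perfectField k K
  let P := MvPolynomial s k
  let v : s → K := (↑)
  let : Algebra P K := (MvPolynomial.aeval v).toAlgebra
  have hPK : algebraMap P K = (MvPolynomial.aeval v : P →ₐ[k] K) := rfl
  have : IsScalarTower k P K := IsScalarTower.of_algebraMap_eq fun r => by
    rw [hPK]; exact ((MvPolynomial.aeval v).commutes r).symm
  let L := FractionRing P
  have hinj : Function.Injective (algebraMap P K) := hs.1
  have : FaithfulSMul P K := (faithfulSMul_iff_algebraMap_injective _ _).mpr hinj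
  let : Algebra L K := FractionRing.liftAlgebra P K
  have : Algebra.IsSeparable L K := by
    have hr : Set.range v = s := Subtype.range_coe
    have : Algebra.IsSeparable (IntermediateField.adjoin k (Set.range v)) K := by rwa [hr]
    refine Algebra.IsSeparable.of_equiv_equiv hs.1.aevalEquivField.symm.toRingEquiv (RingEquiv.refl K) ?_
    ext y
    obtain ⟨z, rfl⟩ := hs.1.aevalEquivField.surjective y
    change algebraMap L K (hs.1.aevalEquivField.symm (hs.1.aevalEquivField z)) = _
    rw [AlgEquiv.symm_apply_apply]
    exact (hs.1.aevalEquivField_apply_coe z).symm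
  have : Algebra.FormallyEtale L K := Algebra.FormallyEtale.of_isSeparable L K
  have : Algebra.FormallyEtale P L := Algebra.FormallyEtale.of_isLocalization (nonZeroDivisors P)
  have : Algebra.FormallyEtale P K := Algebra.FormallyEtale.comp P L K
  let b : Module.Basis s K (Ω[K⁄k]) := ((KaehlerDifferential.mvPolynomialBasis k s).baseChange K).map
    (KaehlerDifferential.tensorKaehlerEquivOfFormallyEtale k P K)
  rw [Module.finrank_eq_card_basis b]
  have := hx.lift_cardinalMk_eq hs
  simpa using this

lemma ringKrullDim_le_of_isIntegral [Algebra A B] [Algebra.IsIntegral A B] :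
    ringKrullDim B ≤ ringKrullDim A :=
  Order.krullDim_le_of_strictMono (fun p : PrimeSpectrum B => p.comap (algebraMap A B))
    fun p q h => Ideal.IsIntegral.comap_lt_comap (I := p.asIdeal) (J := q.asIdeal) h

/-- The dimension of a finitely generated domain is at most the dimension of the space of
differentials of its fraction field. -/
lemma ringKrullDim_le_finrank_kaehlerDifferential [PerfectField k] [IsDomain A]
    [Algebra.FiniteType k A] (K : Type u) [Field K] [Algebra k K] [Algebra A K] [IsScalarTower k A K]
    [IsFractionRing A K] : ringKrullDim A ≤ Module.finrank K (Ω[K⁄k]) := by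
  obtain ⟨s, g, hg, hfin⟩ := exists_finite_inj_algHom_of_fg k A
  let := g.toRingHom.toAlgebra
  have : Module.Finite (MvPolynomial (Fin s) k) A := hfin
  have h1 := ringKrullDim_le_of_isIntegral (A := MvPolynomial (Fin s) k) (B := A)
  rw [MvPolynomial.ringKrullDim_of_isNoetherianRing, ringKrullDim_eq_zero_of_field, zero_add] at h1
  have : Algebra.EssFiniteType k K :=
    have : Algebra.EssFiniteType A K := Algebra.EssFiniteType.of_isLocalization _ (nonZeroDivisors A)
    Algebra.EssFiniteType.comp k A K
  have hx : IsTranscendenceBasis k fun i : Fin s => algebraMap A K (g (MvPolynomial.X i)) := by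
    let := ((IsScalarTower.toAlgHom k A K).comp g).toRingHom.toAlgebra
    have : IsScalarTower (MvPolynomial (Fin s) k) A K := IsScalarTower.of_algebraMap_eq fun _ => rfl
    have : IsScalarTower k (MvPolynomial (Fin s) k) K :=
      IsScalarTower.of_algebraMap_eq fun r => (((IsScalarTower.toAlgHom k A K).comp g).commutes r).symm
    have : FaithfulSMul (MvPolynomial (Fin s) k) K := (faithfulSMul_iff_algebraMap_injective _ _).mpr
      ((IsFractionRing.injective A K).comp hg)
    have : Algebra.IsAlgebraic A K := IsLocalization.isAlgebraic K (nonZeroDivisors A)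
    have : FaithfulSMul (MvPolynomial (Fin s) k) A :=
      (faithfulSMul_iff_algebraMap_injective _ _).mpr hg
    have : Algebra.IsAlgebraic (MvPolynomial (Fin s) k) K := Algebra.IsAlgebraic.trans _ A K
    exact (IsTranscendenceBasis.mvPolynomial (Fin s) k).algebraMap_comp
  rw [← card_eq_finrank_kaehlerDifferential hx]
  simpa using h1

lemma span_D_algebraMap_eq_top (M : Submonoid A) [Algebra A B] [IsScalarTower k A B]
    [IsLocalization M B] :
    Submodule.span B (Set.range fun a : A => KaehlerDifferential.D k B (algebraMap A B a)) = ⊤ := by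
  rw [← KaehlerDifferential.span_range_map_derivation_of_isLocalization k A B M]
  congr 2
  ext a
  simp

/-- The dimension of a finitely generated algebra is at most the number of generators of its module
of differentials. -/
lemma ringKrullDim_le_of_span_eq_top [PerfectField k] [Algebra.FiniteType k B] {ι : Type} [Fintype ι]
    {x : ι → B} (hx : Submodule.span B (Set.range fun i => KaehlerDifferential.D k B (x i)) = ⊤) :
    ringKrullDim B ≤ Fintype.card ι := by
  -- a chain of primes is a chain in the domain `C`, the quotient by its smallest member
  refine iSup_le fun l => ?_
  let p := l.head
  let C := B ⧸ p.asIdeal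
  let K := FractionRing C
  have hC : (l.length : WithBot ℕ∞) ≤ ringKrullDim C := by
    rw [ringKrullDim_quotient]
    let l' : LTSeries (PrimeSpectrum.zeroLocus (R := B) p.asIdeal) :=
      { length := l.length
        toFun := fun i => ⟨l i, l.monotone (Fin.zero_le i)⟩
        step := fun i => l.step i }
    exact le_iSup (fun l : LTSeries (PrimeSpectrum.zeroLocus (R := B) p.asIdeal) =>
      (l.length : WithBot ℕ∞)) l'
  refine hC.trans ((ringKrullDim_le_finrank_kaehlerDifferential (k := k) K).trans ?_)
  have : Submodule.span K (Set.range fun i => KaehlerDifferential.D k K (algebraMap B K (x i))) = ⊤ := by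
    rw [eq_top_iff, ← span_D_algebraMap_eq_top (k := k) (B := K) (nonZeroDivisors C), Submodule.span_le]
    rintro _ ⟨c, rfl⟩
    obtain ⟨b, rfl⟩ := Ideal.Quotient.mk_surjective c
    have hb : KaehlerDifferential.D k B b ∈ Submodule.span B (Set.range fun i => KaehlerDifferential.D k B (x i)) :=
      hx ▸ trivial
    have := Submodule.mem_map_of_mem (f := KaehlerDifferential.map k k B K) hb
    rw [Submodule.map_span, ← Set.range_comp] at this
    refine Submodule.span_subset_span B K _ ?_
    have e : KaehlerDifferential.map k k B K ∘ (fun i => KaehlerDifferential.D k B (x i)) =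
        fun i => KaehlerDifferential.D k K (algebraMap B K (x i)) := by ext i; simp
    rw [e, KaehlerDifferential.map_D] at this
    exact this
  have h2 := finrank_le_of_span_eq_top this
  exact_mod_cast h2

lemma bijective_D_of_isLocalization (M : Submonoid A) [Algebra A B] [IsScalarTower k A B]
    [IsLocalization M B] {ι : Type} [Fintype ι] {x : ι → A}
    (hx : Function.Bijective fun r : ι → A => ∑ i, r i • KaehlerDifferential.D k A (x i)) :
    Function.Bijective fun r : ι → B => ∑ i, r i • KaehlerDifferential.D k B (algebraMap A B (x i)) := by
  let e : (ι → A) ≃ₗ[A] Ω[A⁄k] := LinearEquiv.ofBijective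
    (Fintype.linearCombination A fun i => KaehlerDifferential.D k A (x i)) hx
  let b := (Module.Basis.ofEquivFun e.symm).ofIsLocalizedModule B M (KaehlerDifferential.map k k A B)
  have hb (i : ι) : b i = KaehlerDifferential.D k B (algebraMap A B (x i)) := by
    classical
    have : e (Pi.single i 1) = KaehlerDifferential.D k A (x i) := by
      change Fintype.linearCombination A (fun i => KaehlerDifferential.D k A (x i)) _ = _
      simp [Fintype.linearCombination_apply, Pi.single_apply]
    simp [b, this]
  have := b.equivFun.symm.bijective
  convert this using 1
  funext r
  simp [Module.Basis.equivFun_symm_apply, hb]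

/-- A local ring of a variety over an algebraically closed field `k` at a closed point has residue
field `k`. -/
lemma exists_sub_algebraMap_mem_maximalIdeal [IsAlgClosed k] [Algebra.FiniteType k A]
    (𝔪 : Ideal A) [h𝔪 : 𝔪.IsMaximal] (L : Type u) [CommRing L] [Algebra k L] [Algebra A L]
    [IsScalarTower k A L] [IsLocalization.AtPrime L 𝔪] [IsLocalRing L] (l : L) :
    ∃ c : k, l - algebraMap k L c ∈ IsLocalRing.maximalIdeal L := by
  let := Ideal.Quotient.field 𝔪
  have : Module.Finite k (A ⧸ 𝔪) := finite_of_finite_type_of_isJacobsonRing k (A ⧸ 𝔪)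
  have hbij : Function.Bijective (algebraMap k (A ⧸ 𝔪)) :=
    IsAlgClosed.algebraMap_bijective_of_isIntegral
  have hA (a : A) : ∃ c : k, a - algebraMap k A c ∈ 𝔪 := by
    obtain ⟨c, hc⟩ := hbij.2 (Ideal.Quotient.mk 𝔪 a)
    exact ⟨c, Ideal.Quotient.eq.mp hc.symm⟩
  have hmem {a : A} : algebraMap A L a ∈ IsLocalRing.maximalIdeal L ↔ a ∈ 𝔪 :=
    IsLocalization.AtPrime.to_map_mem_maximal_iff L 𝔪 a
  obtain ⟨⟨a, s⟩, h⟩ := IsLocalization.surj 𝔪.primeCompl l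
  obtain ⟨c, hc⟩ := hA a
  obtain ⟨d, hd⟩ := hA s
  have hd0 : d ≠ 0 := by
    rintro rfl
    rw [map_zero, sub_zero] at hd
    exact s.2 hd
  refine ⟨c / d, ?_⟩
  have hs : algebraMap A L s ∉ IsLocalRing.maximalIdeal L := fun h => s.2 (hmem.mp h)
  refine ((IsLocalRing.maximalIdeal.isMaximal L).isPrime.mem_or_mem ?_).resolve_right hs
  have h2 := Ideal.sub_mem _ (hmem.mpr hc) (Ideal.mul_mem_left _ (algebraMap k L (c / d)) (hmem.mpr hd))
  convert h2 using 1
  have h3 : algebraMap k L c = algebraMap k L (c / d) * algebraMap k L d := by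
    rw [← map_mul, div_mul_cancel₀ _ hd0]
  rw [map_sub, map_sub, ← IsScalarTower.algebraMap_apply, ← IsScalarTower.algebraMap_apply, h3]
  dsimp only at h
  linear_combination h

/-- On a regular local ring `L` of a variety over an algebraically closed field at a closed point,
the differentials of a system of parameters form a basis: they generate by Nakayama's lemma, and
there are no more of them than the rank at the generic point. -/
lemma exists_bijective_D_of_isRegularLocalRing [IsAlgClosed k] [IsDomain A] [Algebra.FiniteType k A]
    (𝔪 : Ideal A) [h𝔪 : 𝔪.IsMaximal] (L : Type u) [CommRing L] [Algebra k L] [Algebra A L]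
    [IsScalarTower k A L] [IsLocalization.AtPrime L 𝔪] [IsRegularLocalRing L] :
    ∃ (n : ℕ) (x : Fin n → A), ringKrullDim A = n ∧
      Function.Bijective fun r : Fin n → L => ∑ i, r i • KaehlerDifferential.D k L (algebraMap A L (x i)) := by
  have hle : 𝔪.primeCompl ≤ nonZeroDivisors A := 𝔪.primeCompl_le_nonZeroDivisors
  have : IsDomain L := IsLocalization.isDomain_of_le_nonZeroDivisors L hle
  have : Algebra.EssFiniteType A L := Algebra.EssFiniteType.of_isLocalization _ 𝔪.primeCompl
  have : Algebra.EssFiniteType k L := Algebra.EssFiniteType.comp k A L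
  -- parameters can be chosen in `A`, as numerators
  obtain ⟨x, hx⟩ : ∃ x : Fin (IsLocalRing.maximalIdeal L).spanFinrank → A,
      Ideal.span (Set.range fun i => algebraMap A L (x i)) = IsLocalRing.maximalIdeal L := by
    obtain ⟨s, hs, hspan⟩ :=
      Submodule.FG.exists_span_finset_card_eq_spanFinrank (IsLocalRing.maximalIdeal L).fg_of_isNoetherianRing
    let e : Fin (IsLocalRing.maximalIdeal L).spanFinrank ≃ s := (Fintype.equivFinOfCardEq (by simpa using hs)).symm
    choose a ha using fun l : L => IsLocalization.surj 𝔪.primeCompl l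
    refine ⟨fun i => (a (e i)).1, ?_⟩
    refine Eq.trans ?_ hspan
    apply le_antisymm
    · refine Ideal.span_le.mpr ?_
      rintro _ ⟨i, rfl⟩
      change algebraMap A L (a (e i)).1 ∈ _
      rw [← ha]
      exact Ideal.mul_mem_right _ _ (Submodule.subset_span (e i).2)
    · refine Submodule.span_le.mpr fun l hl => ?_
      obtain ⟨i, hi⟩ := e.surjective ⟨l, hl⟩
      have hu : IsUnit (algebraMap A L (a l).2) := IsLocalization.map_units L (a l).2
      rw [SetLike.mem_coe, ← Ideal.mul_unit_mem_iff_mem _ hu, ha]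
      exact Ideal.subset_span ⟨i, by change algebraMap A L (a (e i)).1 = _; rw [hi]⟩
  have h3 : ((IsLocalRing.maximalIdeal L).spanFinrank : WithBot ℕ∞) ≤ ringKrullDim A := by
    rw [IsRegularLocalRing.spanFinrank_maximalIdeal, IsLocalization.AtPrime.ringKrullDim_eq_height 𝔪 L]
    exact Ideal.height_le_ringKrullDim_of_ne_top h𝔪.ne_top
  generalize (IsLocalRing.maximalIdeal L).spanFinrank = h at x hx h3
  have hspan : Submodule.span L (Set.range fun i => KaehlerDifferential.D k L (algebraMap A L (x i))) = ⊤ := by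
    rw [eq_top_iff]
    refine Submodule.le_of_le_smul_of_le_jacobson_bot (I := IsLocalRing.maximalIdeal L)
      (Module.finite_def.mp inferInstance) (IsLocalRing.maximalIdeal_le_jacobson _) ?_
    rw [← KaehlerDifferential.span_range_derivation, Submodule.span_le]
    rintro _ ⟨l, rfl⟩
    obtain ⟨c, hc⟩ := exists_sub_algebraMap_mem_maximalIdeal (k := k) 𝔪 L l
    have hD : KaehlerDifferential.D k L l = KaehlerDifferential.D k L (l - algebraMap k L c) := by simp
    rw [SetLike.mem_coe, hD]
    generalize l - algebraMap k L c = y at hc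
    rw [← hx, Ideal.mem_span_range_iff_exists_fun] at hc
    obtain ⟨r, rfl⟩ := hc
    rw [map_sum]
    refine Submodule.sum_mem _ fun i _ => ?_
    rw [Derivation.leibniz]
    refine Submodule.add_mem _
      (Submodule.mem_sup_left (Submodule.smul_mem _ _ (Submodule.subset_span ⟨i, rfl⟩)))
      (Submodule.mem_sup_right (Submodule.smul_mem_smul ?_
        (Submodule.subset_span ⟨_, rfl⟩)))
    rw [← hx]
    exact Ideal.subset_span ⟨i, rfl⟩
  let K := FractionRing A
  let φ : L →ₐ[A] K := IsLocalization.liftAlgHom (M := 𝔪.primeCompl) (f := Algebra.ofId A K)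
    fun s => IsLocalization.map_units K (⟨s, hle s.2⟩ : nonZeroDivisors A)
  let := φ.toRingHom.toAlgebra
  have : IsScalarTower A L K := IsScalarTower.of_algebraMap_eq fun a => (φ.commutes a).symm
  have : IsScalarTower k L K := IsScalarTower.of_algebraMap_eq fun a => by
    rw [IsScalarTower.algebraMap_apply k A K, IsScalarTower.algebraMap_apply k A L,
      ← IsScalarTower.algebraMap_apply A L K]
  have : IsFractionRing L K :=
    IsFractionRing.isFractionRing_of_isDomain_of_isLocalization 𝔪.primeCompl L K
  have hspanK : Submodule.span K (Set.range fun i => KaehlerDifferential.D k K (algebraMap A K (x i))) = ⊤ := by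
    have := span_eq_top_of_isLocalizedModule K (nonZeroDivisors L) (KaehlerDifferential.map k k L K) hspan
    rw [← Set.range_comp] at this
    have e : KaehlerDifferential.map k k L K ∘ (fun i => KaehlerDifferential.D k L (algebraMap A L (x i))) =
        fun i => KaehlerDifferential.D k K (algebraMap A K (x i)) := by
      funext i
      rw [Function.comp_apply, KaehlerDifferential.map_D, ← IsScalarTower.algebraMap_apply]
    rwa [e] at this
  have h1 : ringKrullDim A ≤ Module.finrank K (Ω[K⁄k]) := ringKrullDim_le_finrank_kaehlerDifferential K
  have h2 : Module.finrank K (Ω[K⁄k]) ≤ h := by simpa using finrank_le_of_span_eq_top hspanK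
  have h4 : ((Module.finrank K (Ω[K⁄k]) : ℕ) : WithBot ℕ∞) ≤ h := by exact_mod_cast h2
  have h5 : h ≤ Module.finrank K (Ω[K⁄k]) := by exact_mod_cast h3.trans h1
  refine ⟨h, x, le_antisymm (h1.trans h4) h3, ?_, ?_⟩
  · have hK : LinearIndependent K fun i => KaehlerDifferential.D k K (algebraMap A K (x i)) :=
      linearIndependent_of_top_le_span_of_card_eq_finrank hspanK.ge (by simp; omega)
    change Function.Injective (Fintype.linearCombination L fun i =>
      KaehlerDifferential.D k L (algebraMap A L (x i)))
    rw [injective_iff_map_eq_zero]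
    intro r hr
    have := congrArg (KaehlerDifferential.map k k L K) hr
    rw [Fintype.linearCombination_apply, map_sum, map_zero] at this
    have := Fintype.linearIndependent_iff.mp hK (fun i => algebraMap L K (r i)) (by
      rw [← this]
      refine Finset.sum_congr rfl fun i _ => ?_
      rw [map_smul, KaehlerDifferential.map_D, algebraMap_smul, ← IsScalarTower.algebraMap_apply])
    funext i
    exact IsFractionRing.injective L K ((this i).trans (map_zero _).symm)
  · change Function.Surjective (Fintype.linearCombination L fun i =>
      KaehlerDifferential.D k L (algebraMap A L (x i)))
    rw [← LinearMap.range_eq_top, Fintype.range_linearCombination, hspan]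

/-- A basis of differentials at a point of a variety is a basis in a neighbourhood. -/
lemma exists_notMem_bijective_D [IsDomain A] [Algebra.FiniteType k A]
    (𝔪 : Ideal A) [h𝔪 : 𝔪.IsPrime] (L : Type u) [CommRing L] [Algebra k L] [Algebra A L]
    [IsScalarTower k A L] [IsLocalization.AtPrime L 𝔪] {ι : Type} [Fintype ι] {x : ι → A}
    (hx : Function.Bijective fun r : ι → L =>
      ∑ i, r i • KaehlerDifferential.D k L (algebraMap A L (x i))) :
    ∃ f ∉ 𝔪, ∀ (A' : Type u) [CommRing A'] [Algebra k A'] [Algebra A A'] [IsScalarTower k A A']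
      [IsLocalization.Away f A'], Function.Bijective fun r : ι → A' =>
        ∑ i, r i • KaehlerDifferential.D k A' (algebraMap A A' (x i)) := by
  let N := Submodule.span A (Set.range fun i => KaehlerDifferential.D k A (x i))
  let F := KaehlerDifferential.map k k A L
  have h1 (ω : Ω[A⁄k]) : ∃ f : 𝔪.primeCompl, f • ω ∈ N := by
    obtain ⟨r, hr⟩ := hx.2 (F ω)
    obtain ⟨s, hs⟩ := IsLocalization.exist_integer_multiples_of_finite 𝔪.primeCompl r
    choose a ha using hs
    have h0 : F (s • ω - ∑ i, a i • KaehlerDifferential.D k A (x i)) = 0 := by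
      rw [map_sub, map_sum, Submonoid.smul_def, map_smul, ← hr, Finset.smul_sum, sub_eq_zero]
      refine Finset.sum_congr rfl fun i _ => ?_
      rw [map_smul, KaehlerDifferential.map_D, ← algebraMap_smul L (a i), ha, ← smul_assoc]
    obtain ⟨c, hc⟩ := (IsLocalizedModule.eq_zero_iff 𝔪.primeCompl F).mp h0
    refine ⟨c * s, ?_⟩
    rw [smul_sub, sub_eq_zero] at hc
    rw [mul_smul, hc]
    exact N.smul_mem _ (Submodule.sum_mem _ fun i _ => N.smul_mem _ (Submodule.subset_span ⟨i, rfl⟩))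
  have h2 (t : Finset (Ω[A⁄k])) : ∃ f : 𝔪.primeCompl, ∀ ω ∈ t, f • ω ∈ N := by
    classical
    induction t using Finset.induction with
    | empty => exact ⟨1, by simp⟩
    | insert ω t _ ih =>
      obtain ⟨f, hf⟩ := ih
      obtain ⟨g, hg⟩ := h1 ω
      refine ⟨f * g, fun η hη => ?_⟩
      rcases Finset.mem_insert.mp hη with rfl | hη
      · rw [mul_smul]; exact N.smul_mem _ hg
      · rw [mul_comm, mul_smul]; exact N.smul_mem _ (hf _ hη)
  obtain ⟨t, ht⟩ := (Module.finite_def.mp (inferInstance : Module.Finite A (Ω[A⁄k])))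
  obtain ⟨f, hf⟩ := h2 t
  have h3 (ω : Ω[A⁄k]) : (f : A) • ω ∈ N := by
    have : ω ∈ Submodule.span A (t : Set (Ω[A⁄k])) := ht ▸ trivial
    induction this using Submodule.span_induction with
    | mem ω h => exact hf ω h
    | zero => rw [smul_zero]; exact N.zero_mem
    | add ω η _ _ h h' => rw [smul_add]; exact N.add_mem h h'
    | smul a ω _ h => rw [smul_comm]; exact N.smul_mem _ h
  have hlin : LinearIndependent A fun i => KaehlerDifferential.D k A (x i) := by
    rw [Fintype.linearIndependent_iff]
    intro r hr
    have := congrArg F hr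
    rw [map_sum, map_zero] at this
    have h0 : (fun i => algebraMap A L (r i)) = 0 := hx.1 (by
      simp only [Pi.zero_apply, zero_smul, Finset.sum_const_zero]
      rw [← this]
      refine Finset.sum_congr rfl fun i _ => ?_
      rw [map_smul, KaehlerDifferential.map_D, algebraMap_smul])
    intro i
    exact IsLocalization.injective L 𝔪.primeCompl_le_nonZeroDivisors
      ((congrFun h0 i).trans (map_zero _).symm)
  refine ⟨f, f.2, fun A' _ _ _ _ _ => ⟨?_, ?_⟩⟩
  · have := LinearIndependent.of_isLocalizedModule A' (.powers (f : A))
      (KaehlerDifferential.map k k A A') hlin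
    have h4 : (KaehlerDifferential.map k k A A') ∘ (fun i => KaehlerDifferential.D k A (x i)) =
        fun i => KaehlerDifferential.D k A' (algebraMap A A' (x i)) := by ext; simp
    rw [h4] at this
    exact LinearIndependent.fintypeLinearCombination_injective this
  · change Function.Surjective (Fintype.linearCombination A' fun i =>
      KaehlerDifferential.D k A' (algebraMap A A' (x i)))
    rw [← LinearMap.range_eq_top, Fintype.range_linearCombination, eq_top_iff,
      ← KaehlerDifferential.span_range_map_derivation_of_isLocalization k A A' (.powers (f : A)),
      Submodule.span_le]
    rintro _ ⟨a, rfl⟩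
    have hu : IsUnit (algebraMap A A' f) := IsLocalization.Away.algebraMap_isUnit _
    have := Submodule.mem_map_of_mem (f := KaehlerDifferential.map k k A A')
      (h3 (KaehlerDifferential.D k A a))
    rw [Submodule.map_span, ← Set.range_comp] at this
    have := Submodule.span_subset_span A A' _ this
    rw [map_smul, ← algebraMap_smul A', SetLike.mem_coe, Submodule.smul_mem_iff_of_isUnit _ hu] at this
    have e : KaehlerDifferential.map k k A A' ∘ (fun i => KaehlerDifferential.D k A (x i)) =
        fun i => KaehlerDifferential.D k A' (algebraMap A A' (x i)) := by ext i; simp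
    rwa [e] at this

/-- A variety over a perfect field is, on some non-empty open subset, étale over affine space. -/
lemma exists_formallyEtale_mvPolynomial [PerfectField k] [IsDomain A] [Algebra.FiniteType k A] :
    ∃ f : A, f ≠ 0 ∧ ∀ (A' : Type u) [CommRing A'] [Algebra k A'] [Algebra A A'] [IsScalarTower k A A']
      [IsLocalization.Away f A'], ∃ (n : ℕ) (_ : Algebra (MvPolynomial (Fin n) k) A'),
        IsScalarTower k (MvPolynomial (Fin n) k) A' ∧
        Algebra.FormallyEtale (MvPolynomial (Fin n) k) A' := by
  have : Algebra.FinitePresentation k A := Algebra.FinitePresentation.of_finiteType.mp inferInstance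
  let K := Localization.AtPrime (⊥ : Ideal A)
  have : IsFractionRing A K := by
    simpa [Ideal.primeCompl_bot] using Localization.isLocalization (M := (⊥ : Ideal A).primeCompl)
  let : Field K := IsFractionRing.toField A
  have : Algebra.EssFiniteType A K := Algebra.EssFiniteType.of_isLocalization _ (nonZeroDivisors A)
  have : Algebra.EssFiniteType k K := Algebra.EssFiniteType.comp k A K
  have : Algebra.IsSmoothAt k (⊥ : Ideal A) :=
    (Algebra.FormallySmooth.of_perfectField : Algebra.FormallySmooth k K)
  obtain ⟨f, hf, n, _, _, _⟩ :=
    Algebra.IsSmoothAt.exists_isStandardEtale_mvPolynomial (R := k) (p := (⊥ : Ideal A))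
  refine ⟨f, hf, fun A' _ _ _ _ _ => ?_⟩
  let e : Localization.Away f ≃ₐ[k] A' :=
    (IsLocalization.algEquiv (.powers f) (Localization.Away f) A').restrictScalars k
  let : Algebra (MvPolynomial (Fin n) k) A' :=
    (e.toAlgHom.comp (IsScalarTower.toAlgHom k (MvPolynomial (Fin n) k) (Localization.Away f))).toRingHom.toAlgebra
  let e' : Localization.Away f ≃ₐ[MvPolynomial (Fin n) k] A' := { e with commutes' := fun _ => rfl }
  refine ⟨n, inferInstance, IsScalarTower.of_algebraMap_eq fun r => ?_, Algebra.FormallyEtale.of_equiv e'⟩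
  exact ((e.toAlgHom.comp (IsScalarTower.toAlgHom k (MvPolynomial (Fin n) k)
    (Localization.Away f))).commutes r).symm

lemma card_eq_of_formallyEtale_mvPolynomial [Nontrivial A] (n : ℕ) [Algebra (MvPolynomial (Fin n) k) A]
    [IsScalarTower k (MvPolynomial (Fin n) k) A] [Algebra.FormallyEtale (MvPolynomial (Fin n) k) A]
    {ι : Type} [Fintype ι] {x : ι → A}
    (hx : Function.Bijective fun r : ι → A => ∑ i, r i • KaehlerDifferential.D k A (x i)) :
    Fintype.card ι = n := by
  let e : (ι → A) ≃ₗ[A] Ω[A⁄k] := LinearEquiv.ofBijective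
    (Fintype.linearCombination A fun i => KaehlerDifferential.D k A (x i)) hx
  let b : Module.Basis (Fin n) A (Ω[A⁄k]) := ((KaehlerDifferential.mvPolynomialBasis k (Fin n)).baseChange A).map
    (KaehlerDifferential.tensorKaehlerEquivOfFormallyEtale k (MvPolynomial (Fin n) k) A)
  have h1 := Module.finrank_eq_card_basis b
  rw [← e.finrank_eq, Module.finrank_fintype_fun_eq_card] at h1
  simpa using h1

/-- The jet scheme of a variety of dimension `n` with étale coordinates has dimension at least
`n(m + 1)`, as it contains the product of the variety with an affine space of dimension `nm`. -/
lemma IsUniversalJet.le_ringKrullDim {m : ℕ} {γ : A →ₐ[k] B ⊗[k] JetRing k m} (hγ : IsUniversalJet γ)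
    [Nontrivial A] (n' : ℕ) [Algebra (MvPolynomial (Fin n') k) A]
    [IsScalarTower k (MvPolynomial (Fin n') k) A] [Algebra.FormallyEtale (MvPolynomial (Fin n') k) A]
    {n : ℕ} (hn : ringKrullDim A = n) {x : Fin n → A}
    (hx : Function.Bijective fun r : Fin n → A => ∑ i, r i • KaehlerDifferential.D k A (x i)) :
    ((n * (m + 1) : ℕ) : WithBot ℕ∞) ≤ ringKrullDim B := by
  obtain rfl : n = n' := by simpa using card_eq_of_formallyEtale_mvPolynomial n' hx
  obtain ⟨σ, hσ⟩ := hγ.exists_surjective n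
  refine le_trans ?_ (ringKrullDim_le_of_surjective σ.toRingHom hσ)
  refine le_trans ?_ (ringKrullDim_add_natCard_le_ringKrullDim_mvPolynomial (R := A) (Fin n × Fin m))
  rw [hn]
  simp only [Nat.card_eq_fintype_card, Fintype.card_prod, Fintype.card_fin]
  norm_cast
  rw [mul_add, mul_one, add_comm]

end Dimension

end Dim

/-! ### Jets over affine schemes -/

section AffineJet

open TensorProduct Limits

section AffineJets

variable {k : Type u} [Field k]

/-- The affine `k`-scheme `Spec A`. -/
abbrev specOver (k : Type u) [Field k] (A : Type u) [CommRing A] [Algebra k A] : Over (Spec (.of k)) :=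
  Over.mk (Spec.map (CommRingCat.ofHom (algebraMap k A)))

variable {A B C : Type u} [CommRing A] [Algebra k A] [CommRing B] [Algebra k B]
  [CommRing C] [Algebra k C]

/-- The morphism of `k`-schemes given by a homomorphism of `k`-algebras. -/
def specMap (f : A →ₐ[k] B) : specOver k B ⟶ specOver k A :=
  Over.homMk (Spec.map (CommRingCat.ofHom f.toRingHom)) (by
    change Spec.map _ ≫ Spec.map _ = Spec.map _
    rw [← Spec.map_comp, ← CommRingCat.ofHom_comp]
    congr 2
    exact f.comp_algebraMap)

lemma specMap_left (f : A →ₐ[k] B) : (specMap f).left = Spec.map (CommRingCat.ofHom f.toRingHom) :=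
  rfl

lemma specMap_comp (f : A →ₐ[k] B) (g : B →ₐ[k] C) : specMap (g.comp f) = specMap g ≫ specMap f := by
  apply Over.OverMorphism.ext
  exact Spec.map_comp (CommRingCat.ofHom f.toRingHom) (CommRingCat.ofHom g.toRingHom)

lemma specMap_bijective : Function.Bijective (specMap : (A →ₐ[k] B) → (specOver k B ⟶ specOver k A)) := by
  constructor
  · intro f g h
    have := congrArg (fun φ => φ.left) h
    have := Spec.map_injective this
    exact AlgHom.ext fun a => congrArg (fun φ => φ.hom a) this
  · intro φ
    obtain ⟨f, hf⟩ := Spec.map_surjective φ.left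
    have hw := Over.w φ
    change φ.left ≫ Spec.map _ = Spec.map _ at hw
    rw [← hf, ← Spec.map_comp] at hw
    have := Spec.map_injective hw
    refine ⟨{ f.hom with commutes' := fun r => congrArg (fun φ => φ.hom r) this }, ?_⟩
    ext1
    exact hf

variable (m : ℕ)

/-- The projection `Z × Spec k[t]/(t^{m+1}) → Z`. -/
def prodFst (Z : Over (Spec (.of k))) : ((prodFatPoint k m).obj Z).left ⟶ Z.left :=
  pullback.fst Z.hom (fatPoint k m).hom

/-- The projection `Z × Spec k[t]/(t^{m+1}) → Spec k[t]/(t^{m+1})`. -/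
def prodSnd (Z : Over (Spec (.of k))) : ((prodFatPoint k m).obj Z).left ⟶ (fatPoint k m).left :=
  pullback.snd Z.hom (fatPoint k m).hom

variable {m} in
lemma prodFatPoint_hom_ext {T : Scheme.{u}} {Z : Over (Spec (.of k))}
    {f g : T ⟶ ((prodFatPoint k m).obj Z).left} (h₁ : f ≫ prodFst m Z = g ≫ prodFst m Z)
    (h₂ : f ≫ prodSnd m Z = g ≫ prodSnd m Z) : f = g :=
  pullback.hom_ext h₁ h₂

lemma prodFatPoint_map_left_fst {Y Z : Over (Spec (.of k))} (f : Y ⟶ Z) :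
    ((prodFatPoint k m).map f).left ≫ prodFst m Z =
      prodFst m Y ≫ f.left :=
  pullback.lift_fst _ _ _

lemma prodFatPoint_map_left_snd {Y Z : Over (Spec (.of k))} (f : Y ⟶ Z) :
    ((prodFatPoint k m).map f).left ≫ prodSnd m Z =
      prodSnd m Y :=
  pullback.lift_snd _ _ _

lemma zeroSection_left_fst (Z : Over (Spec (.of k))) :
    (zeroSection Z m).left ≫ prodFst m Z = 𝟙 _ :=
  pullback.lift_fst _ _ _

lemma zeroSection_left_snd (Z : Over (Spec (.of k))) :
    (zeroSection Z m).left ≫ prodSnd m Z = Z.hom ≫ fatPoint.origin k m :=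
  pullback.lift_snd _ _ _

lemma zeroSection_naturality {Y Z : Over (Spec (.of k))} (f : Y ⟶ Z) :
    zeroSection Y m ≫ (prodFatPoint k m).map f = f ≫ zeroSection Z m := by
  ext1
  apply prodFatPoint_hom_ext
  · simp only [Over.comp_left, Category.assoc]
    rw [prodFatPoint_map_left_fst, zeroSection_left_fst, reassoc_of% zeroSection_left_fst, Category.comp_id]
  · simp only [Over.comp_left, Category.assoc]
    rw [prodFatPoint_map_left_snd, zeroSection_left_snd, zeroSection_left_snd, Over.w_assoc]

variable (C) in
/-- The identification `Spec C ×_k Spec k[t]/(t^{m+1}) = Spec (C ⊗ k[t]/(t^{m+1}))`. -/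
def jetSpecIso : specOver k (C ⊗[k] JetRing k m) ≅ (prodFatPoint k m).obj (specOver k C) :=
  Over.isoMk (pullbackSpecIso k C (JetRing k m)).symm (by
    refine (pullbackSpecIso_inv_snd_assoc k C (JetRing k m) _).trans ?_
    refine (Spec.map_comp (CommRingCat.ofHom (algebraMap k (JetRing k m))) _).symm.trans ?_
    change Spec.map _ = Spec.map _
    congr 1
    ext r
    exact (Algebra.TensorProduct.includeRight (R := k) (A := C) (B := JetRing k m)).commutes r)

lemma jetSpecIso_hom_left_fst : (jetSpecIso (k := k) C m).hom.left ≫ prodFst m (specOver k C) =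
    Spec.map (CommRingCat.ofHom (algebraMap C (C ⊗[k] JetRing k m))) :=
  pullbackSpecIso_inv_fst k C (JetRing k m)

lemma jetSpecIso_hom_left_snd : (jetSpecIso (k := k) C m).hom.left ≫ prodSnd m (specOver k C) =
    Spec.map (CommRingCat.ofHom (Algebra.TensorProduct.includeRight (R := k) (A := C) (B := JetRing k m)).toRingHom) :=
  pullbackSpecIso_inv_snd k C (JetRing k m)

lemma jetSpecIso_naturality (σ : B →ₐ[k] C) :
    specMap (Algebra.TensorProduct.map σ (AlgHom.id k (JetRing k m))) ≫ (jetSpecIso B m).hom =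
      (jetSpecIso C m).hom ≫ (prodFatPoint k m).map (specMap σ) := by
  ext1
  apply prodFatPoint_hom_ext
  · simp only [Over.comp_left, Category.assoc]
    rw [prodFatPoint_map_left_fst, reassoc_of% jetSpecIso_hom_left_fst, jetSpecIso_hom_left_fst,
      specMap_left, specMap_left, ← Spec.map_comp, ← Spec.map_comp]
    congr 1
  · simp only [Over.comp_left, Category.assoc]
    rw [prodFatPoint_map_left_snd, jetSpecIso_hom_left_snd, jetSpecIso_hom_left_snd, specMap_left]
    refine (Spec.map_comp _ _).symm.trans (congrArg Spec.map ?_)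
    ext b
    simp

lemma specMap_jetZero : specMap (jetZero k m C) ≫ (jetSpecIso C m).hom = zeroSection (specOver k C) m := by
  ext1
  apply prodFatPoint_hom_ext
  · simp only [Over.comp_left, Category.assoc]
    rw [jetSpecIso_hom_left_fst, zeroSection_left_fst, specMap_left, ← Spec.map_comp]
    refine Eq.trans ?_ (Spec.map_id _)
    congr 1
    ext b
    simp [jetZero]
  · simp only [Over.comp_left, Category.assoc]
    rw [jetSpecIso_hom_left_snd, zeroSection_left_snd, specMap_left]
    refine (Spec.map_comp _ _).symm.trans (Eq.trans (congrArg Spec.map ?_) (Spec.map_comp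
      (CommRingCat.ofHom (JetRing.toField k m).toRingHom) (CommRingCat.ofHom (algebraMap k C))))
    ext b
    simp [jetZero, Algebra.smul_def]

/-- Jets of `Spec A` over `Spec C` are homomorphisms `A → C[t]/(t^{m+1})`. -/
def affineJet (δ : A →ₐ[k] C ⊗[k] JetRing k m) :
    (prodFatPoint k m).obj (specOver k C) ⟶ specOver k A :=
  (jetSpecIso C m).inv ≫ specMap δ

variable {m}

lemma affineJet_bijective : Function.Bijective
    (affineJet m : (A →ₐ[k] C ⊗[k] JetRing k m) → _) :=
  ((jetSpecIso C m).symm.homFromEquiv.symm.bijective).comp specMap_bijective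

lemma map_affineJet (δ : A →ₐ[k] B ⊗[k] JetRing k m) (σ : B →ₐ[k] C) :
    (prodFatPoint k m).map (specMap σ) ≫ affineJet m δ =
      affineJet m ((Algebra.TensorProduct.map σ (AlgHom.id k (JetRing k m))).comp δ) := by
  rw [affineJet, affineJet, specMap_comp, ← Category.assoc, ← Category.assoc]
  congr 1
  rw [Iso.comp_inv_eq, Category.assoc, jetSpecIso_naturality, Iso.inv_hom_id_assoc]

lemma zeroSection_affineJet (δ : A →ₐ[k] C ⊗[k] JetRing k m) :
    zeroSection (specOver k C) m ≫ affineJet m δ = specMap ((jetZero k m C).comp δ) := by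
  rw [← specMap_jetZero, affineJet, Category.assoc, Iso.hom_inv_id_assoc, specMap_comp]

/-- A jet is universal if and only if it represents the jets over affine schemes. -/
lemma isUniversalJet_iff {γ : A →ₐ[k] B ⊗[k] JetRing k m} : IsUniversalJet γ ↔
    ∀ (C : Type u) [CommRing C] [Algebra k C], Function.Bijective
      fun f : specOver k C ⟶ specOver k B => (prodFatPoint k m).map f ≫ affineJet m γ := by
  refine forall_congr' fun C => forall_congr' fun _ => forall_congr' fun _ => ?_
  rw [← Function.Bijective.of_comp_iff _ specMap_bijective, ← affineJet_bijective.of_comp_iff' ]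
  have : (fun f : specOver k C ⟶ specOver k B => (prodFatPoint k m).map f ≫ affineJet m γ) ∘ specMap =
      affineJet m ∘ fun σ => (Algebra.TensorProduct.map σ (AlgHom.id k (JetRing k m))).comp γ :=
    funext fun σ => map_affineJet γ σ
  rw [this]

end AffineJets

end AffineJet

/-! ### Gluing families of jets -/

section JetLocal

open TensorProduct Limits

section Locality

variable {k : Type u} [Field k] {m : ℕ}

lemma isPullback_prodFst {Y Z : Over (Spec (.of k))} (f : Y ⟶ Z) :
    IsPullback ((prodFatPoint k m).map f).left (prodFst m Y) (prodFst m Z) f.left := by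
  have h₁ : IsPullback (prodSnd m Z) (prodFst m Z) (fatPoint k m).hom Z.hom :=
    (IsPullback.of_hasPullback Z.hom (fatPoint k m).hom).flip
  have h₂ : IsPullback (prodSnd m Y) (prodFst m Y) (fatPoint k m).hom Y.hom :=
    (IsPullback.of_hasPullback Y.hom (fatPoint k m).hom).flip
  refine IsPullback.of_right ?_ (prodFatPoint_map_left_fst m f) h₁
  rw [prodFatPoint_map_left_snd, Over.w]
  exact h₂

/-- A family of open immersions of `k`-schemes which covers the target. -/
structure IsCover {Z : Over (Spec (.of k))} {I : Type u} {U : I → Over (Spec (.of k))}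
    (c : ∀ i, U i ⟶ Z) : Prop where
  isOpenImmersion : ∀ i, IsOpenImmersion (c i).left
  exists_mem_range : ∀ z : Z.left, ∃ i, z ∈ Set.range (c i).left

namespace IsCover

variable {Z Y : Over (Spec (.of k))} {I : Type u} {U : I → Over (Spec (.of k))} {c : ∀ i, U i ⟶ Z}

/-- The open cover of the underlying scheme. -/
def openCover (hc : IsCover c) : Z.left.OpenCover :=
  Scheme.Cover.mkOfCovers I (fun i => (U i).left) (fun i => (c i).left)
    (fun z => (hc.exists_mem_range z).imp fun _ h => h) hc.isOpenImmersion

lemma prod (m : ℕ) (hc : IsCover c) : IsCover fun i => (prodFatPoint k m).map (c i) where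
  isOpenImmersion i :=
    have := hc.isOpenImmersion i
    MorphismProperty.of_isPullback (P := @IsOpenImmersion) (isPullback_prodFst (c i)).flip this
  exists_mem_range z := by
    obtain ⟨i, y, hy⟩ := hc.exists_mem_range (prodFst m Z z)
    obtain ⟨w, hw, -⟩ := Scheme.exists_preimage_of_isPullback (isPullback_prodFst (m := m) (c i)) z y hy.symm
    exact ⟨i, w, hw⟩

lemma hom_ext (hc : IsCover c) {f g : Z ⟶ Y} (h : ∀ i, c i ≫ f = c i ≫ g) : f = g := by
  ext1
  exact Scheme.Cover.hom_ext hc.openCover _ _ fun i => congrArg (fun φ => φ.left) (h i)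

/-- Morphisms of `k`-schemes can be glued. -/
lemma exists_hom (hc : IsCover c) (f : ∀ i, U i ⟶ Y)
    (h : ∀ (i j : I) (W : Over (Spec (.of k))) (p : W ⟶ U i) (q : W ⟶ U j),
      p ≫ c i = q ≫ c j → p ≫ f i = q ≫ f j) :
    ∃ g : Z ⟶ Y, ∀ i, c i ≫ g = f i := by
  obtain ⟨g, hg⟩ : ∃ g : Z.left ⟶ Y.left, ∀ i, (c i).left ≫ g = (f i).left := by
    refine ⟨Scheme.Cover.glueMorphisms hc.openCover (fun i => (f i).left) fun i j => ?_,
      fun i => Scheme.Cover.ι_glueMorphisms hc.openCover (fun i => (f i).left) _ i⟩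
    let W : Over (Spec (.of k)) := Over.mk (pullback.fst (c i).left (c j).left ≫ (U i).hom)
    let p : W ⟶ U i := Over.homMk (pullback.fst (c i).left (c j).left)
    let q : W ⟶ U j := Over.homMk (pullback.snd (c i).left (c j).left) (by
      simp only [W, Over.mk_hom]
      rw [← Over.w (c j), ← Over.w (c i), pullback.condition_assoc])
    have := h i j W p q (by ext1; exact pullback.condition)
    exact congrArg (fun φ => φ.left) this
  refine ⟨Over.homMk g (Scheme.Cover.hom_ext hc.openCover _ _ fun i => ?_), fun i => ?_⟩
  · revert i
    change ∀ i : I, (c i).left ≫ g ≫ Y.hom = (c i).left ≫ Z.hom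
    intro i
    rw [reassoc_of% hg, Over.w, Over.w]
  · ext1
    exact hg i

/-- Families of jets can be glued. -/
lemma exists_jet (hc : IsCover c) (f : ∀ i, (prodFatPoint k m).obj (U i) ⟶ Y)
    (h : ∀ (i j : I) (W : Over (Spec (.of k))) (p : W ⟶ U i) (q : W ⟶ U j), p ≫ c i = q ≫ c j →
        (prodFatPoint k m).map p ≫ f i = (prodFatPoint k m).map q ≫ f j) :
    ∃ g : (prodFatPoint k m).obj Z ⟶ Y, ∀ i, (prodFatPoint k m).map (c i) ≫ g = f i := by
  refine (hc.prod m).exists_hom f fun i j W p q hpq => ?_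
  have hpq' : (p.left ≫ prodFst m (U i)) ≫ (c i).left = (q.left ≫ prodFst m (U j)) ≫ (c j).left := by
    have := congrArg (fun φ => φ.left ≫ prodFst m Z) hpq
    simpa [prodFatPoint_map_left_fst] using this
  let V : Over (Spec (.of k)) := Over.mk ((p.left ≫ prodFst m (U i)) ≫ (U i).hom)
  let a : V ⟶ U i := Over.homMk (p.left ≫ prodFst m (U i))
  let b : V ⟶ U j := Over.homMk (q.left ≫ prodFst m (U j)) (by
    have := congrArg (· ≫ Z.hom) hpq'
    simpa [V] using this.symm)
  have hab := h i j V a b (by ext1; exact hpq')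
  let r := (isPullback_prodFst (m := m) a).lift p.left (𝟙 W.left) (by simp [a])
  have hr₁ : r ≫ ((prodFatPoint k m).map a).left = p.left := IsPullback.lift_fst _ _ _ _
  have hr₂ : r ≫ ((prodFatPoint k m).map b).left = q.left := by
    apply prodFatPoint_hom_ext
    · rw [Category.assoc, prodFatPoint_map_left_fst, IsPullback.lift_snd_assoc]
      exact Category.id_comp _
    · rw [Category.assoc, prodFatPoint_map_left_snd, ← prodFatPoint_map_left_snd m a,
        reassoc_of% hr₁]
      have := congrArg (fun φ => φ.left ≫ prodSnd m Z) hpq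
      simpa [prodFatPoint_map_left_snd] using this
  ext1
  rw [Over.comp_left, Over.comp_left, ← hr₁, ← hr₂, Category.assoc, Category.assoc]
  exact congrArg (fun φ => r ≫ φ.left) hab

end IsCover

/-- The sections of the structure sheaf of a `k`-scheme form a `k`-algebra. -/
instance sectionsAlgebra (X : Over (Spec (.of k))) (U : X.left.Opens) : Algebra k Γ(X.left, U) :=
  ((structureMap X).app (op U)).hom.toAlgebra

lemma ofHom_algebraMap (X : Over (Spec (.of k))) (U : X.left.Opens) :
    CommRingCat.ofHom (algebraMap k Γ(X.left, U)) =
      (Scheme.ΓSpecIso (.of k)).inv ≫ X.hom.appLE ⊤ U le_top := by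
  refine Eq.trans ?_ (congrArg (fun φ => (Scheme.ΓSpecIso (.of k)).inv ≫ φ)
    (Scheme.Hom.map_appLE X.hom (U := ⊤) (V := U) le_top (𝟙 _)))
  rfl

lemma SpecMap_algebraMap (X : Over (Spec (.of k))) {U : X.left.Opens} (hU : IsAffineOpen U) :
    Spec.map (CommRingCat.ofHom (algebraMap k Γ(X.left, U))) = hU.fromSpec ≫ X.hom := by
  rw [ofHom_algebraMap, Spec.map_comp,
    ← IsAffineOpen.SpecMap_appLE_fromSpec X.hom (isAffineOpen_top (Spec (.of k))) hU le_top]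
  congr 1
  rw [IsAffineOpen.fromSpec_top, Scheme.isoSpec_Spec_inv]

/-- The inclusion of an affine open subset, as a morphism from the spectrum of its sections. -/
def fromSpecOver (X : Over (Spec (.of k))) {U : X.left.Opens} (hU : IsAffineOpen U) :
    specOver k Γ(X.left, U) ⟶ X :=
  Over.homMk hU.fromSpec (SpecMap_algebraMap X hU).symm

instance (X : Over (Spec (.of k))) {U : X.left.Opens} (hU : IsAffineOpen U) :
    IsOpenImmersion (fromSpecOver X hU).left :=
  hU.isOpenImmersion_fromSpec

lemma range_fromSpecOver (X : Over (Spec (.of k))) {U : X.left.Opens} (hU : IsAffineOpen U) :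
    Set.range (fromSpecOver X hU).left = U :=
  hU.range_fromSpec

lemma isCover_fromSpecOver (X : Over (Spec (.of k))) :
    IsCover fun U : {U : X.left.Opens // IsAffineOpen U} => fromSpecOver X U.2 where
  isOpenImmersion U := inferInstance
  exists_mem_range z := by
    obtain ⟨U, hU, hz, -⟩ := X.left.isBasis_affineOpens.exists_subset_of_mem_open
      (Set.mem_univ z) isOpen_univ
    obtain ⟨V, hV, rfl⟩ := hU
    have hV : IsAffineOpen V := hV
    exact ⟨⟨V, hV⟩, by rwa [range_fromSpecOver]⟩

/-- A family of jets of `Y` over `J` represents the functor of jets if it does so for jets over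
affine schemes. -/
lemma bijective_of_affine {Y J : Over (Spec (.of k))} (Λ : (prodFatPoint k m).obj J ⟶ Y)
    (H : ∀ (C : Type u) [CommRing C] [Algebra k C], Function.Bijective
      fun f : specOver k C ⟶ J => (prodFatPoint k m).map f ≫ Λ) (Z : Over (Spec (.of k))) :
    Function.Bijective fun f : Z ⟶ J => (prodFatPoint k m).map f ≫ Λ := by
  have hinj (Z : Over (Spec (.of k))) : Function.Injective
      fun f : Z ⟶ J => (prodFatPoint k m).map f ≫ Λ := by
    intro f g hfg
    refine (isCover_fromSpecOver Z).hom_ext fun i => (H _).1 ?_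
    simp only [Functor.map_comp, Category.assoc] at hfg ⊢
    rw [hfg]
  refine ⟨hinj Z, fun φ => ?_⟩
  have hc := isCover_fromSpecOver Z
  choose f hf using fun U : {U : Z.left.Opens // IsAffineOpen U} => (H Γ(Z.left, U.1)).2
    ((prodFatPoint k m).map (fromSpecOver Z U.2) ≫ φ)
  dsimp only at hf
  obtain ⟨g, hg⟩ := hc.exists_hom f (by
    intro i j W p q hpq
    apply hinj
    simp only [Functor.map_comp, Category.assoc]
    rw [hf i, hf j, ← Functor.map_comp_assoc, hpq, Functor.map_comp_assoc])
  refine ⟨g, (hc.prod m).hom_ext fun i => ?_⟩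
  dsimp only
  rw [← Functor.map_comp_assoc, hg]
  exact hf i

/-- A family of jets of `Y` over `J` which induces bijections between morphisms to `J` and jets. -/
def representableByOfBijective {Y J : Over (Spec (.of k))} (Λ : (prodFatPoint k m).obj J ⟶ Y)
    (H : ∀ Z : Over (Spec (.of k)), Function.Bijective fun f : Z ⟶ J => (prodFatPoint k m).map f ≫ Λ) :
    (jetFunctor Y m).RepresentableBy J where
  homEquiv {Z} := Equiv.ofBijective _ (H Z)
  homEquiv_comp f g := by
    change (prodFatPoint k m).map (f ≫ g) ≫ Λ = (prodFatPoint k m).map f ≫ (prodFatPoint k m).map g ≫ Λ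
    rw [Functor.map_comp, Category.assoc]

lemma homEquiv_eq {Y J : Over (Spec (.of k))} (hJ : (jetFunctor Y m).RepresentableBy J)
    {Z : Over (Spec (.of k))} (f : Z ⟶ J) :
    hJ.homEquiv f = (prodFatPoint k m).map f ≫ universalFamily hJ :=
  hJ.homEquiv_eq f

lemma bijective_universalFamily {Y J : Over (Spec (.of k))} (hJ : (jetFunctor Y m).RepresentableBy J)
    (Z : Over (Spec (.of k))) :
    Function.Bijective fun f : Z ⟶ J => (prodFatPoint k m).map f ≫ universalFamily hJ := by
  have : (fun f : Z ⟶ J => (prodFatPoint k m).map f ≫ universalFamily hJ) = hJ.homEquiv :=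
    funext fun f => (homEquiv_eq hJ f).symm
  rw [this]
  exact hJ.homEquiv.bijective

end Locality

end JetLocal

/-! ### Jet schemes over open subsets -/

section JetOpen

open TensorProduct Limits

section OpenSubsets

variable {k : Type u} [Field k] {m : ℕ}

/-- The scheme `Spec k[t]/(t^{m+1})` has a single point, since `t` is nilpotent. -/
lemma surjective_origin : Surjective (fatPoint.origin k m) := by
  constructor
  intro p
  have hsurj : Function.Surjective (TruncatedPolynomial.toField k m : TruncatedPolynomial k m →+* k) :=
    fun c => ⟨algebraMap k _ c, (TruncatedPolynomial.toField k m).commutes c⟩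
  have hrange := _root_.range_comap_of_surjective _ _ hsurj
  have hp : (p : PrimeSpectrum (TruncatedPolynomial k m)) ∈ Set.range
      (PrimeSpectrum.comap (TruncatedPolynomial.toField k m : TruncatedPolynomial k m →+* k)) := by
    rw [hrange]
    intro r hr
    obtain ⟨q, rfl⟩ := Ideal.Quotient.mk_surjective r
    have h0 : Polynomial.aeval (0 : k) q = 0 := hr
    rw [← Polynomial.coeff_zero_eq_aeval_zero, ← Polynomial.X_dvd_iff] at h0
    obtain ⟨q, rfl⟩ := h0
    have h0 : (Ideal.Quotient.mk (Ideal.span {(Polynomial.X ^ (m + 1) : Polynomial k)}) Polynomial.X) ^ (m + 1)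
        = 0 := by
      rw [← map_pow]
      exact Ideal.Quotient.eq_zero_iff_mem.mpr (Ideal.subset_span rfl)
    have hX : (Ideal.Quotient.mk (Ideal.span {(Polynomial.X ^ (m + 1) : Polynomial k)}) Polynomial.X) ^ (m + 1)
        ∈ p.asIdeal := by
      rw [h0]
      exact Submodule.zero_mem _
    rw [map_mul]
    exact Ideal.mul_mem_right _ _ (p.2.mem_of_pow_mem _ hX)
  obtain ⟨x, hx⟩ := hp
  exact ⟨x, hx⟩

/-- The product `Z × Spec k[t]/(t^{m+1})` has the same points as `Z`. -/
lemma surjective_zeroSection (Z : Over (Spec (.of k))) : Surjective (zeroSection Z m).left := by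
  have h : IsPullback (zeroSection Z m).left Z.hom (prodSnd m Z) (fatPoint.origin k m) := by
    refine IsPullback.of_right (h₁₂ := prodFst m Z) (v₁₃ := Z.hom) (h₂₂ := (fatPoint k m).hom) ?_
      (zeroSection_left_snd m Z) (IsPullback.of_hasPullback Z.hom (fatPoint k m).hom)
    rw [zeroSection_left_fst, fatPoint.origin_comp]
    exact IsPullback.of_horiz_isIso ⟨by simp⟩
  exact MorphismProperty.of_isPullback (P := @Surjective) h.flip surjective_origin

instance mono_of_isOpenImmersion {X' X : Over (Spec (.of k))} (i : X' ⟶ X) [IsOpenImmersion i.left] :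
    Mono i :=
  Over.mono_of_mono_left i

lemma exists_lift_of_range_subset {Z X' X : Over (Spec (.of k))} (i : X' ⟶ X) [IsOpenImmersion i.left]
    (f : Z ⟶ X) (h : Set.range f.left ⊆ Set.range i.left) : ∃ g : Z ⟶ X', g ≫ i = f := by
  refine ⟨Over.homMk (IsOpenImmersion.lift i.left f.left h) ?_, ?_⟩
  · rw [← Over.w i, IsOpenImmersion.lift_fac_assoc, Over.w]
  · ext1
    exact IsOpenImmersion.lift_fac _ _ _

/-- A family of jets takes values in an open subscheme if its origins do. -/
lemma exists_jet_lift {Z X' X : Over (Spec (.of k))} (i : X' ⟶ X) [IsOpenImmersion i.left]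
    (φ : (prodFatPoint k m).obj Z ⟶ X)
    (h : Set.range (zeroSection Z m ≫ φ).left ⊆ Set.range i.left) :
    ∃ ψ : (prodFatPoint k m).obj Z ⟶ X', ψ ≫ i = φ := by
  apply exists_lift_of_range_subset
  rintro _ ⟨z, rfl⟩
  obtain ⟨y, rfl⟩ := (surjective_zeroSection (m := m) Z).surj z
  exact h ⟨y, rfl⟩

variable {X J : Over (Spec (.of k))} (hJ : (jetFunctor X m).RepresentableBy J)

/-- Over an open subset `X'` of `X`, the jet scheme of `X` restricts to a jet scheme of `X'`. -/
lemma bijective_restrict {X' J' : Over (Spec (.of k))} (i : X' ⟶ X) [IsOpenImmersion i.left]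
    (j : J' ⟶ J) [IsOpenImmersion j.left]
    (hij : Set.range j.left = (jetProjection hJ).left ⁻¹' Set.range i.left)
    (Λ : (prodFatPoint k m).obj J' ⟶ X') (hΛ : Λ ≫ i = (prodFatPoint k m).map j ≫ universalFamily hJ)
    (Z : Over (Spec (.of k))) : Function.Bijective fun f : Z ⟶ J' => (prodFatPoint k m).map f ≫ Λ := by
  constructor
  · intro f g hfg
    rw [← cancel_mono j]
    apply (bijective_universalFamily hJ Z).1
    dsimp only at hfg ⊢
    rw [Functor.map_comp_assoc, Functor.map_comp_assoc, ← hΛ, reassoc_of% hfg]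
  · intro φ
    obtain ⟨g, hg⟩ := (bijective_universalFamily hJ Z).2 (φ ≫ i)
    dsimp only at hg
    obtain ⟨g', rfl⟩ := exists_lift_of_range_subset j g (by
      rw [hij]
      rintro _ ⟨z, rfl⟩
      have : g ≫ jetProjection hJ = (zeroSection Z m ≫ φ) ≫ i := by
        rw [jetProjection, ← Category.assoc, ← zeroSection_naturality, Category.assoc, hg, Category.assoc]
      refine ⟨(zeroSection Z m ≫ φ).left z, ?_⟩
      exact (congrArg (fun ψ => ψ.left z) this).symm)
    refine ⟨g', ?_⟩
    rw [← cancel_mono i, Category.assoc, hΛ, ← Functor.map_comp_assoc, hg]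

lemma exists_restrict {X' J' : Over (Spec (.of k))} (i : X' ⟶ X) [IsOpenImmersion i.left]
    (j : J' ⟶ J) (hij : Set.range j.left ⊆ (jetProjection hJ).left ⁻¹' Set.range i.left) :
    ∃ Λ : (prodFatPoint k m).obj J' ⟶ X', Λ ≫ i = (prodFatPoint k m).map j ≫ universalFamily hJ := by
  apply exists_jet_lift
  rw [← Category.assoc, zeroSection_naturality, Category.assoc]
  rintro _ ⟨z, rfl⟩
  exact hij ⟨z, rfl⟩

variable {U V : X.left.Opens} (hU : IsAffineOpen U) (hV : IsAffineOpen V)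

/-- The jet scheme of an affine scheme. -/
def affineJetScheme (A : Type u) [CommRing A] [Algebra k A] :
    (jetFunctor (specOver k A) m).RepresentableBy (specOver k (JetAlgebra k m A)) :=
  representableByOfBijective (affineJet m (universalJet k m A))
    (bijective_of_affine _ (isUniversalJet_iff.mp (isUniversalJet_universalJet m A)))

include hJ hU in
/-- The projection from the jet scheme is affine: the preimage of an affine open subset `U` is a jet
scheme of `U`, so it is isomorphic to the affine one. -/
lemma isAffineOpen_preimage : IsAffineOpen ((jetProjection hJ).left ⁻¹ᵁ U) := by
  let W := (jetProjection hJ).left ⁻¹ᵁ U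
  let j : Over.mk (W.ι ≫ J.hom) ⟶ J := Over.homMk W.ι
  have : IsOpenImmersion j.left := inferInstanceAs (IsOpenImmersion W.ι)
  have hij : Set.range j.left = (jetProjection hJ).left ⁻¹' Set.range (fromSpecOver X hU).left := by
    rw [range_fromSpecOver]
    exact Scheme.Opens.range_ι W
  obtain ⟨Λ, hΛ⟩ := exists_restrict hJ (fromSpecOver X hU) j hij.le
  let e := (affineJetScheme (k := k) (m := m) Γ(X.left, U)).uniqueUpToIso
    (representableByOfBijective Λ (bijective_restrict hJ _ j hij Λ hΛ))
  have : IsIso e.hom.left := inferInstanceAs (IsIso ((Over.forget _).map e.hom))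
  have : IsAffine (specOver k (JetAlgebra k m Γ(X.left, U))).left := inferInstanceAs (IsAffine (Spec _))
  exact IsAffine.of_isIso (inv e.hom.left)

lemma exists_jetHom : ∃ γ : Γ(X.left, U) →ₐ[k]
    Γ(J.left, (jetProjection hJ).left ⁻¹ᵁ U) ⊗[k] JetRing k m,
    affineJet m γ ≫ fromSpecOver X hU =
      (prodFatPoint k m).map (fromSpecOver J (isAffineOpen_preimage hJ hU)) ≫ universalFamily hJ := by
  obtain ⟨Λ, hΛ⟩ := exists_restrict hJ (fromSpecOver X hU)
    (fromSpecOver J (isAffineOpen_preimage hJ hU)) (by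
      rw [range_fromSpecOver, range_fromSpecOver]; rfl)
  obtain ⟨γ, rfl⟩ := affineJet_bijective.2 Λ
  exact ⟨γ, hΛ⟩

/-- The homomorphism `𝒪(U) → 𝒪(π⁻¹U)[t]/(t^{m+1})` given by the universal family of jets, for an
affine open subset `U`. -/
def jetHom : Γ(X.left, U) →ₐ[k] Γ(J.left, (jetProjection hJ).left ⁻¹ᵁ U) ⊗[k] JetRing k m :=
  (exists_jetHom hJ hU).choose

lemma affineJet_jetHom : affineJet m (jetHom hJ hU) ≫ fromSpecOver X hU =
    (prodFatPoint k m).map (fromSpecOver J (isAffineOpen_preimage hJ hU)) ≫ universalFamily hJ :=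
  (exists_jetHom hJ hU).choose_spec

lemma isUniversalJet_jetHom : IsUniversalJet (jetHom hJ hU) :=
  isUniversalJet_iff.mpr fun C _ _ => bijective_restrict hJ _ _
    (by rw [range_fromSpecOver, range_fromSpecOver]; rfl) _ (affineJet_jetHom hJ hU) _

/-- Restriction of sections, as a homomorphism of `k`-algebras. -/
def resAlgHom (X : Over (Spec (.of k))) {U V : X.left.Opens} (h : V ≤ U) :
    Γ(X.left, U) →ₐ[k] Γ(X.left, V) :=
  { (X.left.presheaf.map (homOfLE h).op).hom with
    commutes' := fun r =>
      congrArg (fun φ => φ.hom r) ((structureMap X).naturality (homOfLE h).op).symm }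

lemma specMap_resAlgHom (h : V ≤ U) :
    specMap (resAlgHom X h) ≫ fromSpecOver X hU = fromSpecOver X hV := by
  ext1
  exact hU.map_fromSpec hV (homOfLE h).op

lemma map_resAlgHom_jetHom (h : V ≤ U) (a : Γ(X.left, U)) :
    Algebra.TensorProduct.map (resAlgHom J ((jetProjection hJ).left.preimage_mono h))
      (AlgHom.id k (JetRing k m)) (jetHom hJ hU a) = jetHom hJ hV (resAlgHom X h a) := by
  suffices (Algebra.TensorProduct.map (resAlgHom J ((jetProjection hJ).left.preimage_mono h))
      (AlgHom.id k (JetRing k m))).comp (jetHom hJ hU) = (jetHom hJ hV).comp (resAlgHom X h) from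
    congrArg (fun f => f a) this
  apply affineJet_bijective.1
  rw [← cancel_mono (fromSpecOver X hU), ← map_affineJet, Category.assoc, affineJet_jetHom,
    ← Functor.map_comp_assoc, specMap_resAlgHom _ (isAffineOpen_preimage hJ hV), ← affineJet_jetHom]
  simp only [affineJet, specMap_comp, Category.assoc]
  rw [specMap_resAlgHom hU hV]

/-- Modulo `t`, the universal jet is the projection. -/
lemma jetZero_jetHom (a : Γ(X.left, U)) :
    jetZero k m _ (jetHom hJ hU a) = ((jetProjection hJ).left.app U).hom a := by
  have h : specMap ((jetZero k m _).comp (jetHom hJ hU)) ≫ fromSpecOver X hU =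
      fromSpecOver J (isAffineOpen_preimage hJ hU) ≫ jetProjection hJ := by
    rw [← zeroSection_affineJet, Category.assoc, affineJet_jetHom, ← Category.assoc,
      zeroSection_naturality, Category.assoc]
    rfl
  have h₂ := IsAffineOpen.SpecMap_appLE_fromSpec (jetProjection hJ).left hU
    (isAffineOpen_preimage hJ hU) le_rfl
  have h₃ := (congrArg (fun f => f.left) h).trans h₂.symm
  have h₄ : Spec.map (CommRingCat.ofHom ((jetZero k m _).comp (jetHom hJ hU)).toRingHom) = _ :=
    (cancel_mono hU.fromSpec).mp h₃
  have h₅ := Spec.map_injective h₄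
  rw [Scheme.Hom.appLE_eq_app] at h₅
  exact congrArg (fun φ => φ.hom a) h₅

end OpenSubsets

end JetOpen

/-! ### Existence of jet schemes -/

section JetRepr

open TensorProduct Limits

section Representability

variable {k : Type u} [Field k] {m : ℕ}

/-- A family of jets over `J` represents the functor of jets if, for every affine open subset `U` of
the target, it does so over the open subset of `J` on which the origins of the jets lie in `U`. -/
lemma bijective_of_forall_affine {X J : Over (Spec (.of k))} (Λ : (prodFatPoint k m).obj J ⟶ X)
    (H : ∀ U : X.left.affineOpens, ∃ (J' : Over (Spec (.of k))) (j : J' ⟶ J)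
      (_ : IsOpenImmersion j.left), Set.range j.left = (zeroSection J m ≫ Λ).left ⁻¹' U.1 ∧
      ∀ (Z : Over (Spec (.of k))) (φ : (prodFatPoint k m).obj Z ⟶ X),
        Set.range (zeroSection Z m ≫ φ).left ⊆ U.1 →
          ∃! f : Z ⟶ J', (prodFatPoint k m).map f ≫ (prodFatPoint k m).map j ≫ Λ = φ)
    (Z : Over (Spec (.of k))) : Function.Bijective fun f : Z ⟶ J => (prodFatPoint k m).map f ≫ Λ := by
  choose J' j hj hrange hbij using H
  -- the part of the base of a family of jets where the origins lie in `U`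
  let W {Z : Over (Spec (.of k))} (φ : (prodFatPoint k m).obj Z ⟶ X) (U : X.left.affineOpens) :
      Z.left.Opens := (zeroSection Z m ≫ φ).left ⁻¹ᵁ U.1
  let c {Z : Over (Spec (.of k))} (φ : (prodFatPoint k m).obj Z ⟶ X) (U : X.left.affineOpens) :
      Over.mk ((W φ U).ι ≫ Z.hom) ⟶ Z := Over.homMk (W φ U).ι
  have hc {Z : Over (Spec (.of k))} (φ : (prodFatPoint k m).obj Z ⟶ X) : IsCover (c φ) :=
    { isOpenImmersion := fun U => inferInstanceAs (IsOpenImmersion (W φ U).ι)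
      exists_mem_range := fun z => by
        obtain ⟨U, hU, hz, -⟩ := X.left.isBasis_affineOpens.exists_subset_of_mem_open
          (Set.mem_univ ((zeroSection Z m ≫ φ).left z)) isOpen_univ
        obtain ⟨V, hV, rfl⟩ := hU
        refine ⟨⟨V, hV⟩, ?_⟩
        have : Set.range (W φ ⟨V, hV⟩).ι = _ := Scheme.Opens.range_ι _
        exact this.symm ▸ hz }
  have hcW {Z : Over (Spec (.of k))} (φ : (prodFatPoint k m).obj Z ⟶ X) (U : X.left.affineOpens)
      {Y : Over (Spec (.of k))} (g : Y ⟶ Over.mk ((W φ U).ι ≫ Z.hom)) :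
      Set.range (zeroSection Y m ≫ (prodFatPoint k m).map g ≫ (prodFatPoint k m).map (c φ U) ≫ φ).left
        ⊆ U.1 := by
    rw [← Category.assoc, zeroSection_naturality, Category.assoc, ← Category.assoc (zeroSection _ _),
      zeroSection_naturality, Category.assoc]
    rintro _ ⟨z, rfl⟩
    exact (g.left z).2
  have hinj (Z : Over (Spec (.of k))) : Function.Injective
      fun f : Z ⟶ J => (prodFatPoint k m).map f ≫ Λ := by
    intro f g hfg
    dsimp only at hfg
    have key (U : X.left.affineOpens) (f : Z ⟶ J) : ∀ φ, (prodFatPoint k m).map f ≫ Λ = φ →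
        ∃ f', f' ≫ j U = c φ U ≫ f := by
      rintro _ rfl
      apply exists_lift_of_range_subset
      rw [hrange]
      have := hcW ((prodFatPoint k m).map f ≫ Λ) U (𝟙 _)
      rw [CategoryTheory.Functor.map_id, Category.id_comp, ← Functor.map_comp_assoc, ← Category.assoc,
        zeroSection_naturality, Category.assoc] at this
      rintro _ ⟨z, rfl⟩
      exact this ⟨z, rfl⟩
    refine (hc ((prodFatPoint k m).map f ≫ Λ)).hom_ext fun U => ?_
    obtain ⟨f', hf'⟩ := key U f _ rfl
    obtain ⟨g', hg'⟩ := key U g _ hfg.symm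
    rw [← hf', ← hg']
    congr 1
    have := hcW ((prodFatPoint k m).map f ≫ Λ) U (𝟙 _)
    rw [CategoryTheory.Functor.map_id, Category.id_comp] at this
    refine (hbij U _ _ this).unique ?_ ?_
    · rw [← Functor.map_comp_assoc, hf', Functor.map_comp_assoc]
    · rw [← Functor.map_comp_assoc, hg', Functor.map_comp_assoc, hfg]
  refine ⟨hinj Z, fun φ => ?_⟩
  have hex (U : X.left.affineOpens) := (hbij U (Over.mk ((W φ U).ι ≫ Z.hom))
    ((prodFatPoint k m).map (c φ U) ≫ φ) (by simpa using hcW φ U (𝟙 _))).exists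
  choose f hf using hex
  obtain ⟨g, hg⟩ := (hc φ).exists_hom (fun U => f U ≫ j U) (by
    intro U V Y p q hpq
    apply hinj
    simp only [Functor.map_comp, Category.assoc]
    rw [hf U, hf V, ← Functor.map_comp_assoc, hpq, Functor.map_comp_assoc])
  refine ⟨g, ((hc φ).prod m).hom_ext fun U => ?_⟩
  dsimp only
  rw [← Functor.map_comp_assoc, hg, Functor.map_comp_assoc]
  exact hf U

lemma isAffineOpen_coe {X : Scheme.{u}} (U : X.affineOpens) : IsAffineOpen U.1 := U.2

/-- The family of jets of `X` over the jet scheme of an affine open subset. -/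
def localJet (X : Over (Spec (.of k))) (m : ℕ) (U : X.left.affineOpens) :
    (prodFatPoint k m).obj (specOver k (JetAlgebra k m Γ(X.left, U))) ⟶ X :=
  affineJet m (universalJet k m Γ(X.left, U)) ≫ fromSpecOver X (isAffineOpen_coe U)

lemma existsUnique_localJet (X : Over (Spec (.of k))) (U : X.left.affineOpens)
    (Z : Over (Spec (.of k))) (φ : (prodFatPoint k m).obj Z ⟶ X)
    (h : Set.range (zeroSection Z m ≫ φ).left ⊆ U.1) :
    ∃! f, (prodFatPoint k m).map f ≫ localJet X m U = φ := by
  obtain ⟨ψ, rfl⟩ := exists_jet_lift (fromSpecOver X (isAffineOpen_coe U)) φ (by rwa [range_fromSpecOver])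
  have hb := bijective_of_affine _ (isUniversalJet_iff.mp
    (isUniversalJet_universalJet (k := k) m Γ(X.left, U))) Z
  obtain ⟨f, hf⟩ := hb.2 ψ
  refine ⟨f, ?_, fun g hg => hb.1 ?_⟩
  · dsimp only [localJet] at hf ⊢
    rw [reassoc_of% hf]
  · dsimp only [localJet] at hf hg ⊢
    rw [hf, ← cancel_mono (fromSpecOver X (isAffineOpen_coe U)), Category.assoc, hg]

lemma range_localJet (X : Over (Spec (.of k))) (U : X.left.affineOpens) :
    Set.range (zeroSection _ m ≫ localJet X m U).left ⊆ U.1 := by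
  rw [localJet, ← Category.assoc]
  rintro _ ⟨z, rfl⟩
  exact (range_fromSpecOver X (isAffineOpen_coe U)).le ⟨_, rfl⟩

lemma range_localJet_comp (X : Over (Spec (.of k))) (U : X.left.affineOpens)
    {Z : Over (Spec (.of k))} (f : Z ⟶ specOver k (JetAlgebra k m Γ(X.left, U))) :
    Set.range (zeroSection Z m ≫ (prodFatPoint k m).map f ≫ localJet X m U).left ⊆ U.1 := by
  rw [← Category.assoc, zeroSection_naturality, Category.assoc, Over.comp_left]
  rintro _ ⟨z, rfl⟩
  rw [Scheme.Hom.comp_apply]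
  exact range_localJet X U (Set.mem_range_self (f.left z))

/-- The transition map between the jet schemes of affine open subsets. -/
def localJetMap (X : Over (Spec (.of k))) (m : ℕ) {U V : X.left.affineOpens} (h : U ≤ V) :
    specOver k (JetAlgebra k m Γ(X.left, U)) ⟶ specOver k (JetAlgebra k m Γ(X.left, V)) :=
  (existsUnique_localJet X V _ (localJet X m U) ((range_localJet X U).trans h)).choose

lemma map_localJetMap (X : Over (Spec (.of k))) {U V : X.left.affineOpens} (h : U ≤ V) :
    (prodFatPoint k m).map (localJetMap X m h) ≫ localJet X m V = localJet X m U :=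
  (existsUnique_localJet X V _ (localJet X m U) ((range_localJet X U).trans h)).choose_spec.1

lemma localJet_hom_ext (X : Over (Spec (.of k))) {U : X.left.affineOpens} {Z : Over (Spec (.of k))}
    {f g : Z ⟶ specOver k (JetAlgebra k m Γ(X.left, U))}
    (h : (prodFatPoint k m).map f ≫ localJet X m U = (prodFatPoint k m).map g ≫ localJet X m U) :
    f = g :=
  (existsUnique_localJet X U Z _ (range_localJet_comp X U g)).unique h rfl

lemma localJetMap_self (X : Over (Spec (.of k))) (m : ℕ) (U : X.left.affineOpens) :
    localJetMap X m (le_refl U) = 𝟙 _ := by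
  apply localJet_hom_ext
  rw [map_localJetMap, CategoryTheory.Functor.map_id, Category.id_comp]

lemma localJetMap_comp (X : Over (Spec (.of k))) (m : ℕ) {U V W : X.left.affineOpens} (h : U ≤ V)
    (h' : V ≤ W) : localJetMap X m h ≫ localJetMap X m h' = localJetMap X m (h.trans h') := by
  apply localJet_hom_ext
  rw [map_localJetMap, Functor.map_comp, Category.assoc, map_localJetMap, map_localJetMap]

/-- The projection from the jet scheme of an affine open subset `U` to `U`. -/
def localProjection (X : Over (Spec (.of k))) (m : ℕ) (U : X.left.affineOpens) :
    (specOver k (JetAlgebra k m Γ(X.left, U))).left ⟶ U.1 :=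
  IsOpenImmersion.lift U.1.ι (zeroSection _ m ≫ localJet X m U).left
    ((range_localJet X U).trans (Scheme.Opens.range_ι U.1).ge)

lemma localProjection_comp (X : Over (Spec (.of k))) (U : X.left.affineOpens) :
    localProjection X m U ≫ U.1.ι = (zeroSection _ m ≫ localJet X m U).left :=
  IsOpenImmersion.lift_fac _ _ _

lemma isPullback_localJetMap (X : Over (Spec (.of k))) {U V : X.left.affineOpens} (h : U ≤ V) :
    IsPullback (localJetMap X m h).left (localProjection X m U) (localProjection X m V)
      (X.left.homOfLE h) := by
  have w : (localJetMap X m h).left ≫ localProjection X m V =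
      localProjection X m U ≫ X.left.homOfLE h := by
    rw [← cancel_mono V.1.ι, Category.assoc, Category.assoc, Scheme.homOfLE_ι, localProjection_comp,
      localProjection_comp, ← Over.comp_left, ← Category.assoc, ← zeroSection_naturality,
      Category.assoc, map_localJetMap]
  have key (s : PullbackCone (localProjection X m V) (X.left.homOfLE h)) :
      ∃ l, l ≫ (localJetMap X m h).left = s.fst ∧ l ≫ localProjection X m U = s.snd := by
    let a : Over.mk (s.fst ≫ (specOver k (JetAlgebra k m Γ(X.left, V))).hom) ⟶
      specOver k (JetAlgebra k m Γ(X.left, V)) := Over.homMk s.fst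
    have ha : (zeroSection _ m ≫ (prodFatPoint k m).map a ≫ localJet X m V).left = s.snd ≫ U.1.ι := by
      rw [← Category.assoc, zeroSection_naturality, Category.assoc, Over.comp_left,
        ← localProjection_comp]
      have := s.condition =≫ V.1.ι
      simpa [a] using this
    obtain ⟨l, hl, -⟩ := existsUnique_localJet X U _ ((prodFatPoint k m).map a ≫ localJet X m V) (by
      rw [ha]
      rintro _ ⟨z, rfl⟩
      exact (s.snd z).2)
    have hl' : l ≫ localJetMap X m h = a := by
      apply localJet_hom_ext
      rw [Functor.map_comp, Category.assoc, map_localJetMap, hl]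
    refine ⟨l.left, congrArg (fun f => f.left) hl', ?_⟩
    rw [← cancel_mono U.1.ι, ← ha, Category.assoc, localProjection_comp, ← hl, ← Over.comp_left,
      ← Category.assoc, ← zeroSection_naturality, Category.assoc]
  have hmono {T : Scheme.{u}} {f g : T ⟶ (specOver k (JetAlgebra k m Γ(X.left, U))).left}
      (hfg : f ≫ (localJetMap X m h).left = g ≫ (localJetMap X m h).left) : f = g := by
    let f' : Over.mk (f ≫ (specOver k (JetAlgebra k m Γ(X.left, U))).hom) ⟶
      specOver k (JetAlgebra k m Γ(X.left, U)) := Over.homMk f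
    let g' : Over.mk (f ≫ (specOver k (JetAlgebra k m Γ(X.left, U))).hom) ⟶
      specOver k (JetAlgebra k m Γ(X.left, U)) := Over.homMk g (by
        have := hfg =≫ (specOver k (JetAlgebra k m Γ(X.left, V))).hom
        rw [Category.assoc, Category.assoc, Over.w] at this
        exact this.symm)
    have h₁ : f' ≫ localJetMap X m h = g' ≫ localJetMap X m h := by
      ext1
      exact hfg
    have h₂ : f' = g' := by
      apply localJet_hom_ext
      rw [← map_localJetMap X h, ← Functor.map_comp_assoc, h₁, Functor.map_comp_assoc]
    exact congrArg (fun f => f.left) h₂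
  choose l hl₁ hl₂ using key
  exact ⟨⟨w⟩, ⟨PullbackCone.IsLimit.mk w l hl₁ hl₂ fun s n hn _ => hmono (hn.trans (hl₁ s).symm)⟩⟩

/-- The jet schemes of the affine open subsets of `X`, as a datum for gluing over `X`. -/
def jetGluingData (X : Over (Spec (.of k))) (m : ℕ) :
    X.left.directedAffineCover.RelativeGluingData where
  functor :=
    { obj := fun U : X.left.affineOpens => (specOver k (JetAlgebra k m Γ(X.left, U.1))).left
      map := fun {U V} h => (localJetMap X m (U := U) (V := V) (leOfHom h)).left
      map_id := fun U => congrArg (fun f => f.left) (localJetMap_self X m U)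
      map_comp := fun f g =>
        congrArg (fun f => f.left) (localJetMap_comp X m (leOfHom f) (leOfHom g)).symm }
  natTrans :=
    { app := fun U => localProjection X m U
      naturality := fun _ _ h => (isPullback_localJetMap X (leOfHom h)).w }
  equifibered _ _ h := isPullback_localJetMap X (leOfHom h)

/-- The jet scheme of `X`, glued from the jet schemes of the affine open subsets. -/
def gluedJetScheme (X : Over (Spec (.of k))) (m : ℕ) : Over (Spec (.of k)) :=
  Over.mk ((jetGluingData X m).toBase ≫ X.hom)

/-- The inclusion of the jet scheme of an affine open subset. -/
def gluedι (X : Over (Spec (.of k))) (m : ℕ) (U : X.left.affineOpens) :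
    specOver k (JetAlgebra k m Γ(X.left, U)) ⟶ gluedJetScheme X m :=
  Over.homMk (colimit.ι (jetGluingData X m).functor U) (by
    have := (jetGluingData X m).ι_toBase U =≫ X.hom
    have h₂ := localProjection_comp (m := m) X U =≫ X.hom
    rw [Over.w] at h₂
    simp only [Category.assoc] at this h₂
    exact this.trans h₂)

lemma isCover_gluedι (X : Over (Spec (.of k))) : IsCover (gluedι X m) where
  isOpenImmersion U := (jetGluingData X m).cover.map_prop U
  exists_mem_range z := by
    obtain ⟨U, y, hy⟩ := (jetGluingData X m).cover.exists_eq z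
    exact ⟨U, y, hy⟩

lemma gluedι_left_toBase (X : Over (Spec (.of k))) (U : X.left.affineOpens) :
    (gluedι X m U).left ≫ (jetGluingData X m).toBase = (zeroSection _ m ≫ localJet X m U).left :=
  ((jetGluingData X m).ι_toBase U).trans (localProjection_comp X U)

lemma localJetMap_gluedι (X : Over (Spec (.of k))) {U V : X.left.affineOpens} (h : U ≤ V) :
    localJetMap X m h ≫ gluedι X m V = gluedι X m U := by
  ext1
  exact colimit.w (jetGluingData X m).functor (homOfLE h)

lemma exists_gluedJet (X : Over (Spec (.of k))) (m : ℕ) :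
    ∃ Λ : (prodFatPoint k m).obj (gluedJetScheme X m) ⟶ X,
      ∀ U, (prodFatPoint k m).map (gluedι X m U) ≫ Λ = localJet X m U := by
  refine (isCover_gluedι X).exists_jet (localJet X m) fun U V W p q hpq => ?_
  have hmap {K U : X.left.affineOpens} (h : K ≤ U) : IsOpenImmersion (localJetMap X m h).left :=
    MorphismProperty.of_isPullback (P := @IsOpenImmersion) (isPullback_localJetMap X h).flip
      inferInstance
  have := (isCover_gluedι (m := m) X).isOpenImmersion V
  -- the part of `W` which maps to the jet scheme of an affine open subset of `U ∩ V`
  let O (K : {K : X.left.affineOpens // K ≤ U ∧ K ≤ V}) : W.left.Opens :=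
    have := hmap K.2.1
    p.left ⁻¹ᵁ (localJetMap X m K.2.1).left.opensRange
  let c (K : {K : X.left.affineOpens // K ≤ U ∧ K ≤ V}) : Over.mk ((O K).ι ≫ W.hom) ⟶ W :=
    Over.homMk (O K).ι
  have hrange (K) : Set.range (c K).left = p.left ⁻¹' Set.range (localJetMap X m K.2.1).left :=
    Scheme.Opens.range_ι _
  have hc : IsCover c :=
    { isOpenImmersion := fun K => inferInstanceAs (IsOpenImmersion (O K).ι)
      exists_mem_range := fun w => by
        have hw : (jetGluingData X m).cover.f U (p.left w) = (jetGluingData X m).cover.f V (q.left w) :=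
          congrArg (fun f => f.left w) hpq
        obtain ⟨K, i, j, y, hy, -⟩ := (jetGluingData X m).cover.exists_of_f_eq_f _ _ hw
        refine ⟨⟨K, leOfHom i, leOfHom j⟩, ?_⟩
        rw [hrange]
        exact ⟨y, hy⟩ }
  refine (hc.prod m).hom_ext fun K => ?_
  have := hmap K.2.1
  obtain ⟨p', hp'⟩ := exists_lift_of_range_subset (localJetMap X m K.2.1) (c K ≫ p) (by
    rw [Over.comp_left]
    rintro _ ⟨w, rfl⟩
    rw [Scheme.Hom.comp_apply]
    exact (hrange K).le (Set.mem_range_self w))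
  have hq' : p' ≫ localJetMap X m K.2.2 = c K ≫ q := by
    rw [← cancel_mono (gluedι X m V), Category.assoc, Category.assoc, localJetMap_gluedι, ← hpq,
      ← reassoc_of% hp', localJetMap_gluedι]
  rw [← Functor.map_comp_assoc, ← Functor.map_comp_assoc, ← hp', ← hq', Functor.map_comp_assoc,
    Functor.map_comp_assoc, map_localJetMap, map_localJetMap]

lemma isRepresentable_jetFunctor (X : Over (Spec (.of k))) (m : ℕ) :
    (jetFunctor X m).IsRepresentable := by
  obtain ⟨Λ, hΛ⟩ := exists_gluedJet X m
  refine ⟨_, ⟨representableByOfBijective Λ (bijective_of_forall_affine Λ fun U =>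
    ⟨_, gluedι X m U, (isCover_gluedι X).isOpenImmersion U, ?_, fun Z φ h => ?_⟩)⟩⟩
  · have h : (zeroSection _ m ≫ Λ).left = (jetGluingData X m).toBase := by
      refine Scheme.Cover.hom_ext (isCover_gluedι X).openCover _ _ fun V => ?_
      revert V
      change ∀ V : X.left.affineOpens, (gluedι X m V).left ≫ (zeroSection _ m ≫ Λ).left =
        (gluedι X m V).left ≫ (jetGluingData X m).toBase
      intro V
      rw [gluedι_left_toBase]
      rw [← hΛ, ← Category.assoc, zeroSection_naturality, Category.assoc]
      rfl
    rw [h]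
    have := (jetGluingData X m).preimage_toBase_eq_range_ι U
    have h₂ : Set.range (X.left.directedAffineCover.f U) = U.1 := Scheme.Opens.range_ι U.1
    rw [h₂] at this
    exact this.symm
  · rw [hΛ]
    exact existsUnique_localJet X U Z φ h

end Representability

end JetRepr

/-! ### Differentials on schemes -/

section Differentials

open TensorProduct

section Coordinates

variable {k : Type u} [Field k] {ι : Type} [Fintype ι] {Y : Over (Spec (.of k))}

/-- Functions on an open subset whose differentials form a basis of the module of differentials of
the ring of functions. -/
def IsCoordinates (U : Y.left.Opens) (x : ι → Γ(Y.left, U)) : Prop :=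
  Function.Bijective fun r : ι → Γ(Y.left, U) => ∑ i, r i • KaehlerDifferential.D k Γ(Y.left, U) (x i)

variable (Y) in
/-- The presheaf `U ↦ Ω_{𝒪(U)/k}`. -/
abbrev presheafDifferentials : Y.left.PresheafOfModules :=
  PresheafOfModules.DifferentialsConstruction.relativeDifferentials' (structureMap Y)

variable (Y) in
/-- The sections of the presheaf of differentials. Both sides are the same module; the map fixes the
`𝒪(U)`-module structure in use. -/
def presheafDifferentialsEquiv (U : Y.left.Opens) :
    Ω[Γ(Y.left, U)⁄k] ≃ₗ[Γ(Y.left, U)] (presheafDifferentials Y).obj (op U) :=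
  LinearEquiv.refl _ _

lemma res_presheafDifferentialsEquiv_D {U V : Y.left.Opens} (h : V ≤ U) (a : Γ(Y.left, U)) :
    res (presheafDifferentials Y) h
      (presheafDifferentialsEquiv Y U (KaehlerDifferential.D k Γ(Y.left, U) a)) =
      presheafDifferentialsEquiv Y V (KaehlerDifferential.D k Γ(Y.left, V) (ores Y.left h a)) :=
  PresheafOfModules.DifferentialsConstruction.relativeDifferentials'_map_d (structureMap Y)
    (homOfLE h).op a

/-- The differential of a function, as a section of the sheaf of differentials. -/
def differential {U : Y.left.Opens} (a : Γ(Y.left, U)) : (cotangentSheaf Y).val.obj (op U) :=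
  toSheafify (presheafDifferentials Y) U
    (presheafDifferentialsEquiv Y U (KaehlerDifferential.D k Γ(Y.left, U) a))

lemma res_differential {U V : Y.left.Opens} (h : V ≤ U) (a : Γ(Y.left, U)) :
    res (cotangentSheaf Y).val h (differential a) = differential (ores Y.left h a) :=
  (res_toSheafify _ _ _).trans (congrArg _ (res_presheafDifferentialsEquiv_D h a))

lemma differential_eq_sum {U : Y.left.Opens} {y : Γ(Y.left, U)} {x g : ι → Γ(Y.left, U)}
    (h : KaehlerDifferential.D k Γ(Y.left, U) y =
      ∑ i, g i • KaehlerDifferential.D k Γ(Y.left, U) (x i)) :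
    differential y = ∑ i, g i • differential (x i) := by
  let φ := (toSheafify (presheafDifferentials Y) U).comp (presheafDifferentialsEquiv Y U).toLinearMap
  have := congrArg φ h
  rw [map_sum] at this
  simp only [map_smul] at this
  exact this

lemma IsCoordinates.basicOpen {U : Y.left.Opens} (hU : IsAffineOpen U) {x : ι → Γ(Y.left, U)}
    (hx : IsCoordinates U x) (f : Γ(Y.left, U)) :
    IsCoordinates (Y.left.basicOpen f) fun i => ores Y.left (Y.left.basicOpen_le f) (x i) := by
  let := (resAlgHom Y (Y.left.basicOpen_le f)).toRingHom.toAlgebra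
  have : IsScalarTower k Γ(Y.left, U) Γ(Y.left, Y.left.basicOpen f) :=
    IsScalarTower.of_algebraMap_eq fun c => ((resAlgHom Y (Y.left.basicOpen_le f)).commutes c).symm
  have : IsLocalization.Away f Γ(Y.left, Y.left.basicOpen f) := hU.isLocalization_basicOpen f
  exact bijective_D_of_isLocalization (Submonoid.powers f) hx

lemma IsCoordinates.isFrame {U : Y.left.Opens} (hU : IsAffineOpen U) {x : ι → Γ(Y.left, U)}
    (hx : IsCoordinates U x) : IsFrame (cotangentSheaf Y).val U fun i => differential (x i) := by
  refine isFrame_sheafify (presheafDifferentials Y) {W | ∃ f : Γ(Y.left, U), Y.left.basicOpen f = W}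
    (fun V hV y hy => ?_) ?_
  · obtain ⟨f, hf, hy⟩ := hU.exists_basicOpen_le ⟨y, hy⟩ (hV hy)
    exact ⟨_, ⟨f, rfl⟩, hf, hy⟩
  · rintro _ ⟨f, rfl⟩ hW
    simp only [res_presheafDifferentialsEquiv_D]
    exact hx.basicOpen hU f

/-- Frames over overlapping open subsets have the same number of elements. -/
lemma IsFrame.card_eq {X : Scheme.{u}} {P : X.PresheafOfModules} {ι' : Type} [Fintype ι']
    {U V : X.Opens} {e : ι → P.obj (op U)} {e' : ι' → P.obj (op V)} (he : IsFrame P U e)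
    (he' : IsFrame P V e') {x : X} (hU : x ∈ U) (hV : x ∈ V) : Fintype.card ι = Fintype.card ι' := by
  have : Nonempty ↥(U ⊓ V) := ⟨⟨x, hU, hV⟩⟩
  have : Nontrivial Γ(X, U ⊓ V) := inferInstance
  let f : (ι → Γ(X, U ⊓ V)) ≃ₗ[Γ(X, U ⊓ V)] P.obj (op (U ⊓ V)) := LinearEquiv.ofBijective
    (Fintype.linearCombination _ fun i => res P inf_le_left (e i)) (he _ inf_le_left)
  let f' : (ι' → Γ(X, U ⊓ V)) ≃ₗ[Γ(X, U ⊓ V)] P.obj (op (U ⊓ V)) := LinearEquiv.ofBijective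
    (Fintype.linearCombination _ fun i => res P inf_le_right (e' i)) (he' _ inf_le_right)
  have := (f.trans f'.symm).finrank_eq
  simpa using this

end Coordinates

section Dimension

/-- A chain of irreducible closed subsets can be traced on any open subset which meets its smallest
member. -/
lemma topologicalKrullDim_le_of_cover {X : Type*} [TopologicalSpace X] {N : WithBot ℕ∞}
    (h : ∀ x : X, ∃ U : TopologicalSpace.Opens X, x ∈ U ∧ topologicalKrullDim U ≤ N) :
    topologicalKrullDim X ≤ N := by
  rw [topologicalKrullDim, Order.krullDim_eq_iSup_coheight]
  refine iSup_le fun Z => ?_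
  obtain ⟨x, hx⟩ := Z.2.nonempty
  obtain ⟨U, hxU, hU⟩ := h x
  have hemb : Topology.IsOpenEmbedding ((↑) : U → X) := U.2.isOpenEmbedding_subtypeVal
  let e := TopologicalSpace.IrreducibleCloseds.orderIsoOfIsOpenEmbedding _ hemb
  let Z' : TopologicalSpace.IrreducibleCloseds U := e.symm ⟨Z, ⟨⟨x, hxU⟩, hx⟩⟩
  have hZ' : TopologicalSpace.IrreducibleCloseds.map _ hemb.continuous Z' = Z :=
    congrArg Subtype.val (e.apply_symm_apply ⟨Z, ⟨⟨x, hxU⟩, hx⟩⟩)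
  rw [← hZ', hemb.coheight_map]
  exact (Order.coheight_le_krullDim Z').trans hU

lemma topologicalKrullDim_eq_of_isAffineOpen {Y : Scheme.{u}} {U : Y.Opens} (hU : IsAffineOpen U) :
    topologicalKrullDim U = ringKrullDim Γ(Y, U) := by
  rw [← PrimeSpectrum.topologicalKrullDim_eq_ringKrullDim]
  exact IsHomeomorph.topologicalKrullDim_eq _ hU.isoSpec.hom.homeomorph.isHomeomorph

/-- The dimension of a scheme is the largest dimension of the members of an affine open cover. -/
lemma dim_eq_of_cover {Y : Scheme.{u}} {N : ℕ}
    (h : ∀ y : Y, ∃ U : Y.Opens, y ∈ U ∧ IsAffineOpen U ∧ ringKrullDim Γ(Y, U) ≤ N)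
    {V : Y.Opens} (hV : IsAffineOpen V) (hN : N ≤ ringKrullDim Γ(Y, V)) : dim Y = N := by
  have : topologicalKrullDim Y = N := by
    apply le_antisymm
    · refine topologicalKrullDim_le_of_cover fun y => ?_
      obtain ⟨U, hy, hU, hle⟩ := h y
      exact ⟨U, hy, (topologicalKrullDim_eq_of_isAffineOpen hU).trans_le hle⟩
    · rw [← topologicalKrullDim_eq_of_isAffineOpen hV] at hN
      exact hN.trans (topologicalKrullDim_subspace_le Y V)
  rw [dim, this]
  rfl

end Dimension

end Differentials

/-! ### Charts -/

section Charts

open TensorProduct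

section Charts

variable {k : Type u} [Field k] {X : Over (Spec (.of k))}

lemma IsVariety.isIntegral (hX : IsVariety X) : IsIntegral X.left :=
  have := hX.irreducible
  have := hX.reduced
  isIntegral_of_irreducibleSpace_of_isReduced _

lemma IsVariety.finiteType (hX : IsVariety X) {U : X.left.Opens} (hU : IsAffineOpen U) :
    Algebra.FiniteType k Γ(X.left, U) := by
  have := hX.locallyOfFiniteType
  have h := X.hom.finiteType_appLE (isAffineOpen_top (Spec (.of k))) hU le_top
  have e : algebraMap k Γ(X.left, U) = (X.hom.appLE ⊤ U le_top).hom.comp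
      (Scheme.ΓSpecIso (.of k)).inv.hom :=
    congrArg (fun f => f.hom) (ofHom_algebraMap X U)
  have : (algebraMap k Γ(X.left, U)).FiniteType := by
    rw [e]
    exact h.comp (RingHom.FiniteType.of_surjective _
      (Scheme.ΓSpecIso (.of k)).commRingCatIsoToRingEquiv.symm.surjective)
  exact this

/-- A non-singular variety has local coordinates at each point. -/
lemma exists_isCoordinates [IsAlgClosed k] (hX : IsVariety X) (hns : IsNonsingular X.left)
    {U : X.left.Opens} (hU : IsAffineOpen U) {p : X.left} (hp : p ∈ U) :
    ∃ (n : ℕ) (f : Γ(X.left, U)) (x : Fin n → Γ(X.left, X.left.basicOpen f)),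
      p ∈ X.left.basicOpen f ∧ ringKrullDim Γ(X.left, U) = n ∧ IsCoordinates _ x := by
  have := hX.isIntegral
  have := hX.finiteType hU
  have : Nonempty U := ⟨⟨p, hp⟩⟩
  have : IsDomain Γ(X.left, U) := inferInstance
  -- local rings are only controlled over maximal ideals, so `p` is specialized to a closed point
  obtain ⟨𝔪, h𝔪, hle⟩ := Ideal.exists_le_maximal (hU.primeIdealOf ⟨p, hp⟩).asIdeal
    (hU.primeIdealOf ⟨p, hp⟩).2.ne_top
  let y : PrimeSpectrum Γ(X.left, U) := ⟨𝔪, h𝔪.isPrime⟩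
  have hy : hU.fromSpec y ∈ U := by
    have : hU.fromSpec y ∈ Set.range hU.fromSpec := ⟨y, rfl⟩
    rwa [hU.range_fromSpec] at this
  let L := X.left.presheaf.stalk (hU.fromSpec y)
  let : Algebra Γ(X.left, U) L := TopCat.Presheaf.algebra_section_stalk X.left.presheaf ⟨_, hy⟩
  let : Algebra k L := ((algebraMap Γ(X.left, U) L).comp (algebraMap k Γ(X.left, U))).toAlgebra
  have : IsScalarTower k Γ(X.left, U) L := IsScalarTower.of_algebraMap_eq fun _ => rfl
  have : IsLocalization.AtPrime L 𝔪 := hU.isLocalization_stalk' y hy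
  have : IsRegularLocalRing L := hns _
  obtain ⟨n, x, hn, hx⟩ := exists_bijective_D_of_isRegularLocalRing (k := k) 𝔪 L
  obtain ⟨f, hf, hx⟩ := exists_notMem_bijective_D 𝔪 L hx
  refine ⟨n, f, fun i => ores X.left (X.left.basicOpen_le f) (x i), ?_, hn, ?_⟩
  · have h1 : hU.primeIdealOf ⟨p, hp⟩ ∈ PrimeSpectrum.basicOpen f := fun h => hf (hle h)
    rw [← hU.fromSpec_preimage_basicOpen] at h1
    have h2 : hU.fromSpec (hU.primeIdealOf ⟨p, hp⟩) ∈ X.left.basicOpen f := h1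
    rwa [hU.fromSpec_primeIdealOf] at h2
  · let := (resAlgHom X (X.left.basicOpen_le f)).toRingHom.toAlgebra
    have : IsScalarTower k Γ(X.left, U) Γ(X.left, X.left.basicOpen f) :=
      IsScalarTower.of_algebraMap_eq fun c => ((resAlgHom X (X.left.basicOpen_le f)).commutes c).symm
    have : IsLocalization.Away f Γ(X.left, X.left.basicOpen f) := hU.isLocalization_basicOpen f
    exact hx _

/-- All nonempty affine open subsets of a non-singular variety have the same dimension, and each
point has local coordinates in that number. -/
lemma IsVariety.exists_dim [IsAlgClosed k] (hX : IsVariety X) (hns : IsNonsingular X.left) :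
    (∀ (U : X.left.Opens), IsAffineOpen U → (∃ p, p ∈ U) → ringKrullDim Γ(X.left, U) = dim X.left) ∧
    ∀ p : X.left, ∃ (U : X.left.Opens) (_ : IsAffineOpen U) (x : Fin (dim X.left) → Γ(X.left, U)),
      p ∈ U ∧ IsCoordinates U x := by
  have := hX.irreducible
  let η : X.left := genericPoint X.left
  have hη {U : X.left.Opens} {p : X.left} (hp : p ∈ U) : η ∈ U :=
    (genericPoint_specializes p).mem_open U.2 hp
  have haff (p : X.left) : ∃ U : X.left.Opens, IsAffineOpen U ∧ p ∈ U := by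
    obtain ⟨_, ⟨V, hV, rfl⟩, hz, -⟩ := X.left.isBasis_affineOpens.exists_subset_of_mem_open
      (Set.mem_univ p) isOpen_univ
    exact ⟨V, hV, hz⟩
  have key {U V : X.left.Opens} (hU : IsAffineOpen U) (hV : IsAffineOpen V) {n n' : ℕ}
      {x : Fin n → Γ(X.left, U)} {y : Fin n' → Γ(X.left, V)} (hx : IsCoordinates U x)
      (hy : IsCoordinates V y) {p q : X.left} (hp : p ∈ U) (hq : q ∈ V) : n = n' := by
    simpa using (hx.isFrame hU).card_eq (hy.isFrame hV) (hη hp) (hη hq)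
  obtain ⟨U₀, hU₀, hη₀⟩ := haff η
  obtain ⟨n, f, x, hf, hn, hx⟩ := exists_isCoordinates hX hns hU₀ hη₀
  have hdim {U : X.left.Opens} (hU : IsAffineOpen U) {p : X.left} (hp : p ∈ U) :
      ringKrullDim Γ(X.left, U) = n := by
    obtain ⟨n', f', x', hf', hn', hx'⟩ := exists_isCoordinates hX hns hU hp
    rw [hn', key (hU₀.basicOpen f) (hU.basicOpen f') hx hx' hf hf']
  have hX' : dim X.left = n := by
    refine dim_eq_of_cover (fun p => ?_) hU₀ (hdim hU₀ hη₀).ge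
    obtain ⟨U, hU, hp⟩ := haff p
    exact ⟨U, hp, hU, (hdim hU hp).le⟩
  rw [hX']
  refine ⟨fun U hU ⟨p, hp⟩ => hdim hU hp, fun p => ?_⟩
  obtain ⟨U, hU, hp⟩ := haff p
  obtain ⟨n', f', x', hf', hn', hx'⟩ := exists_isCoordinates hX hns hU hp
  obtain rfl := key (hU₀.basicOpen f) (hU.basicOpen f') hx hx' hf hf'
  exact ⟨_, hU.basicOpen f', x', hf', hx'⟩

variable {m : ℕ} {J : Over (Spec (.of k))} (hJ : (jetFunctor X m).RepresentableBy J)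

/-- The functions `x^{(j)}` on the jet scheme for local coordinates `x`: the coefficients of `t^j` of
the universal family of jets. -/
def jetCoordinates {n : ℕ} {U : X.left.Opens} (hU : IsAffineOpen U) (x : Fin n → Γ(X.left, U))
    (p : Fin n × Fin (m + 1)) : Γ(J.left, (jetProjection hJ).left ⁻¹ᵁ U) :=
  jetCoeff m p.2 (jetHom hJ hU (x p.1))

lemma IsCoordinates.jetCoordinates {n : ℕ} {U : X.left.Opens} (hU : IsAffineOpen U)
    {x : Fin n → Γ(X.left, U)} (hx : IsCoordinates U x) :
    IsCoordinates (Y := J) ((jetProjection hJ).left ⁻¹ᵁ U) (jetCoordinates hJ hU x) :=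
  (isUniversalJet_jetHom hJ hU).bijective_D hx

lemma ores_jetCoordinates {n : ℕ} {U V : X.left.Opens} (hU : IsAffineOpen U) (hV : IsAffineOpen V)
    (h : V ≤ U) (x : Fin n → Γ(X.left, U)) (p : Fin n × Fin (m + 1)) :
    ores J.left ((jetProjection hJ).left.preimage_mono h) (jetCoordinates hJ hU x p) =
      jetCoordinates hJ hV (fun i => ores X.left h (x i)) p := by
  refine (jetCoeff_map m (resAlgHom J ((jetProjection hJ).left.preimage_mono h)) p.2 _).symm.trans ?_
  rw [map_resAlgHom_jetHom hJ hU hV h]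
  rfl

include hJ in
/-- The dimension of the jet scheme of a non-singular variety. -/
lemma dim_jetScheme [IsAlgClosed k] (hX : IsVariety X) (hns : IsNonsingular X.left) :
    dim J.left = dim X.left * (m + 1) := by
  obtain ⟨hdim, hcoord⟩ := hX.exists_dim hns
  have := hX.irreducible
  have := hX.isIntegral
  have hle {U : X.left.Opens} (hU : IsAffineOpen U) {x : Fin (dim X.left) → Γ(X.left, U)}
      (hx : IsCoordinates U x) :
      ringKrullDim Γ(J.left, (jetProjection hJ).left ⁻¹ᵁ U) ≤ ((dim X.left * (m + 1) : ℕ) : WithBot ℕ∞) := by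
    have := hX.finiteType hU
    have := (isUniversalJet_jetHom hJ hU).finiteType
    have h := hx.jetCoordinates hJ hU
    have := ringKrullDim_le_of_span_eq_top (k := k) (x := JetSchemes.jetCoordinates hJ hU x) (by
      rw [eq_top_iff]
      rintro ω -
      obtain ⟨r, rfl⟩ := h.2 ω
      exact Submodule.sum_mem _ fun i _ => Submodule.smul_mem _ _ (Submodule.subset_span ⟨i, rfl⟩))
    simpa using this
  -- the generic point has a neighbourhood with étale coordinates
  obtain ⟨U, hU, x, hη, hx⟩ := hcoord (genericPoint X.left)
  have := hX.finiteType hU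
  have : Nonempty U := ⟨⟨_, hη⟩⟩
  have : IsDomain Γ(X.left, U) := inferInstance
  obtain ⟨f, hf, het⟩ := exists_formallyEtale_mvPolynomial (k := k) (A := Γ(X.left, U))
  have hf' : ∃ p, p ∈ X.left.basicOpen f := by
    by_contra! h
    exact hf ((basicOpen_eq_bot_iff f).mp (by ext p; simpa using h p))
  let := (resAlgHom X (X.left.basicOpen_le f)).toRingHom.toAlgebra
  have : IsScalarTower k Γ(X.left, U) Γ(X.left, X.left.basicOpen f) :=
    IsScalarTower.of_algebraMap_eq fun c => ((resAlgHom X (X.left.basicOpen_le f)).commutes c).symm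
  have : IsLocalization.Away f Γ(X.left, X.left.basicOpen f) := hU.isLocalization_basicOpen f
  obtain ⟨n', _, _, _⟩ := het Γ(X.left, X.left.basicOpen f)
  obtain ⟨p, hp⟩ := hf'
  have : Nonempty (X.left.basicOpen f) := ⟨⟨p, hp⟩⟩
  refine dim_eq_of_cover (V := (jetProjection hJ).left ⁻¹ᵁ X.left.basicOpen f) (fun y => ?_)
    (isAffineOpen_preimage hJ (hU.basicOpen f)) ?_
  · obtain ⟨V, hV, z, hy, hz⟩ := hcoord ((jetProjection hJ).left y)
    exact ⟨_, hy, isAffineOpen_preimage hJ hV, hle hV hz⟩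
  · exact (isUniversalJet_jetHom hJ (hU.basicOpen f)).le_ringKrullDim n'
      (hdim _ (hU.basicOpen f) ⟨p, hp⟩) (hx.basicOpen hU f)

end Charts

end Charts

/-! ### The canonical sheaf of the jet scheme -/

section Canon

open TensorProduct

section CanonicalSheaf

variable {k : Type u} [Field k] {X : Over (Spec (.of k))}

/-- The section `dx₁ ∧ ⋯ ∧ dxₙ` of an exterior power of the sheaf of differentials. -/
def volumeForm {n : ℕ} {U : X.left.Opens} (x : Fin n → Γ(X.left, U)) :
    (exteriorPower (cotangentSheaf X) n).val.obj (op U) :=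
  wedgeSection (cotangentSheaf X) fun i => differential (x i)

lemma res_volumeForm {n : ℕ} {U V : X.left.Opens} (h : V ≤ U) (x : Fin n → Γ(X.left, U)) :
    res (exteriorPower (cotangentSheaf X) n).val h (volumeForm x) =
      volumeForm fun i => ores X.left h (x i) :=
  (res_wedgeSection _ h _).trans (congrArg _ (funext fun _ => res_differential h _))

lemma IsCoordinates.isGenerator {n : ℕ} {U : X.left.Opens} (hU : IsAffineOpen U)
    {x : Fin n → Γ(X.left, U)} (hx : IsCoordinates U x) :
    IsGenerator (exteriorPower (cotangentSheaf X) n).val U (volumeForm x) :=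
  (hx.isFrame hU).wedgeSection

lemma volumeForm_eq_det_smul {n : ℕ} {U : X.left.Opens} {x y : Fin n → Γ(X.left, U)}
    (G : Matrix (Fin n) (Fin n) Γ(X.left, U)) (h : ∀ i, KaehlerDifferential.D k Γ(X.left, U) (y i) =
      ∑ l, G i l • KaehlerDifferential.D k Γ(X.left, U) (x l)) :
    volumeForm y = G.det • volumeForm x :=
  wedgeSection_sum _ _ _ G fun i => differential_eq_sum (h i)

lemma IsCoordinates.reindex {ι κ : Type} [Fintype ι] [Fintype κ] {U : X.left.Opens}
    {x : ι → Γ(X.left, U)} (hx : IsCoordinates U x) (e : κ ≃ ι) : IsCoordinates U (x ∘ e) := by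
  have : (fun r : κ → Γ(X.left, U) => ∑ i, r i • KaehlerDifferential.D k Γ(X.left, U) ((x ∘ e) i)) =
      (fun r : ι → Γ(X.left, U) => ∑ i, r i • KaehlerDifferential.D k Γ(X.left, U) (x i)) ∘
        (fun r => r ∘ e.symm) := by
    funext r
    exact Fintype.sum_equiv e _ _ fun i => by simp
  rw [IsCoordinates, this]
  exact hx.comp (e.arrowCongr (Equiv.refl _)).bijective

lemma ores_app {X J : Scheme.{u}} (π : J ⟶ X) {U V : X.Opens} (h : V ≤ U) (g : Γ(X, U)) :
    ores J (π.preimage_mono h) ((π.app U).hom g) = (π.app V).hom (ores X h g) :=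
  (congrArg (fun φ => φ.hom g) (π.naturality (homOfLE h).op)).symm

variable {m : ℕ} {J : Over (Spec (.of k))} (hJ : (jetFunctor X m).RepresentableBy J)

/-- A change of coordinates multiplies the volume form of the jet scheme by the `(m+1)`-st power of
the Jacobian determinant. -/
lemma exists_transition {n N : ℕ} (e : Fin N ≃ Fin n × Fin (m + 1)) {U : X.left.Opens}
    (hU : IsAffineOpen U) {x : Fin n → Γ(X.left, U)} (hx : IsCoordinates U x)
    (y : Fin n → Γ(X.left, U)) :
    ∃ g : Γ(X.left, U),
      tensorPowerSection _ (volumeForm y) (m + 1) = g • tensorPowerSection _ (volumeForm x) (m + 1) ∧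
      volumeForm (X := J) (jetCoordinates hJ hU y ∘ e) = ((jetProjection hJ).left.app U).hom g •
        volumeForm (X := J) (jetCoordinates hJ hU x ∘ e) := by
  choose G hG using fun i => hx.2 (KaehlerDifferential.D k Γ(X.left, U) (y i))
  have hG' : ∀ i, KaehlerDifferential.D k Γ(X.left, U) (y i) =
      ∑ l, Matrix.of G i l • KaehlerDifferential.D k Γ(X.left, U) (x l) := fun i => (hG i).symm
  refine ⟨(Matrix.of G).det ^ (m + 1), ?_, ?_⟩
  · rw [volumeForm_eq_det_smul _ hG', tensorPowerSection_smul]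
  · have hdet : ((jetMatrix (jetHom hJ hU) (Matrix.of G)).submatrix e e).det =
        ((jetProjection hJ).left.app U).hom ((Matrix.of G).det ^ (m + 1)) := by
      rw [Matrix.det_submatrix_equiv_self, det_jetMatrix, ← jetZero_apply, jetZero_jetHom, map_pow]
    rw [← hdet]
    refine volumeForm_eq_det_smul (X := J) _ fun i => ?_
    refine (D_jetCoeff_eq_sum_jetMatrix (jetHom hJ hU) hG' (e i)).trans ?_
    exact (Fintype.sum_equiv e _ _ fun i => rfl).symm

/-- The canonical sheaf of the jet scheme is the pullback of `ω_X^{⊗ (m+1)}`. -/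
theorem nonempty_canonicalSheaf_iso [IsAlgClosed k] (hX : IsVariety X) (hns : IsNonsingular X.left) :
    Nonempty (canonicalSheaf J ≅ (Scheme.Modules.pullback (jetProjection hJ).left).obj
      (tensorPower (canonicalSheaf X) (m + 1))) := by
  obtain ⟨-, hcoord⟩ := hX.exists_dim hns
  have hdim := dim_jetScheme hJ hX hns
  let e : Fin (dim J.left) ≃ Fin (dim X.left) × Fin (m + 1) :=
    (finCongr hdim).trans finProdFinEquiv.symm
  let π := (jetProjection hJ).left
  -- the coordinate systems on affine open subsets of `X`
  let I : Type u := {c : (U : X.left.affineOpens) × (Fin (dim X.left) → Γ(X.left, U.1)) //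
    IsCoordinates c.1.1 c.2}
  let U (c : I) : X.left.Opens := c.1.1.1
  have hU (c : I) : IsAffineOpen (U c) := c.1.1.2
  let x (c : I) : Fin (dim X.left) → Γ(X.left, U c) := c.1.2
  have hx (c : I) : IsCoordinates (U c) (x c) := c.2
  let t (c : I) : (tensorPower (canonicalSheaf X) (m + 1)).val.obj (op (U c)) :=
    tensorPowerSection (canonicalSheaf X) (volumeForm (x c)) (m + 1)
  let l (c : I) : (canonicalSheaf J).val.obj (op (π ⁻¹ᵁ U c)) :=
    volumeForm (X := J) (jetCoordinates hJ (hU c) (x c) ∘ e)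
  have ht (c : I) : IsGenerator (tensorPower (canonicalSheaf X) (m + 1)).val (U c) (t c) :=
    ((hx c).isGenerator (hU c)).tensorPowerSection (m + 1)
  have hl (c : I) : IsGenerator (canonicalSheaf J).val (π ⁻¹ᵁ U c) (l c) :=
    (((hx c).jetCoordinates hJ (hU c)).reindex e).isGenerator (isAffineOpen_preimage hJ (hU c))
  have hrt (c : I) {V : X.left.Opens} (h : V ≤ U c) :
      res (tensorPower (canonicalSheaf X) (m + 1)).val h (t c) = tensorPowerSection (canonicalSheaf X)
        (volumeForm fun i => ores X.left h (x c i)) (m + 1) :=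
    (res_tensorPowerSection _ h _ _).trans (congrArg (fun s => tensorPowerSection _ s (m + 1))
      (res_volumeForm h (x c)))
  have hrl (c : I) {V : X.left.Opens} (hV : IsAffineOpen V) (h : V ≤ U c) :
      res (canonicalSheaf J).val (π.preimage_mono h) (l c) =
        volumeForm (X := J) (jetCoordinates hJ hV (fun i => ores X.left h (x c i)) ∘ e) :=
    (res_volumeForm (X := J) (π.preimage_mono h) _).trans (congrArg _ (funext fun i =>
      ores_jetCoordinates hJ (hU c) hV h (x c) (e i)))
  refine nonempty_iso_pullback_of_isGenerator π _ _ (ι := I) (U := U) (fun p => ?_) ht hl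
    fun i j => ?_
  · obtain ⟨V, hV, z, hp, hz⟩ := hcoord p
    exact ⟨⟨⟨⟨V, hV⟩, z⟩, hz⟩, hp⟩
  · obtain ⟨g, hg⟩ := (ht i (U i ⊓ U j) inf_le_left).2
      (res (tensorPower (canonicalSheaf X) (m + 1)).val inf_le_right (t j))
    dsimp only at hg
    refine ⟨g, hg.symm, res_ext _ fun z hz => ?_⟩
    -- near the image of `z`, both coordinate systems live on a common basic open subset
    obtain ⟨f, f', hff', hzf⟩ := exists_basicOpen_le_affine_inter (hU i) (hU j) (π z) hz
    have hWi : X.left.basicOpen f ≤ U i := X.left.basicOpen_le f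
    have hWj : X.left.basicOpen f ≤ U j := hff'.trans_le (X.left.basicOpen_le f')
    have hW : X.left.basicOpen f ≤ U i ⊓ U j := le_inf hWi hWj
    refine ⟨π ⁻¹ᵁ X.left.basicOpen f, π.preimage_mono hW, hzf, ?_⟩
    obtain ⟨g', hg'₁, hg'₂⟩ := exists_transition hJ e ((hU i).basicOpen f)
      ((hx i).basicOpen (hU i) f) fun l => ores X.left hWj (x j l)
    have hgg' : ores X.left hW g = g' := by
      apply (ht i _ hWi).1
      dsimp only
      have := congrArg (res (tensorPower (canonicalSheaf X) (m + 1)).val hW) hg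
      rw [res_smul, res_res, res_res] at this
      rw [this, hrt i, hrt j]
      exact hg'₁
    rw [res_smul, res_res, res_res, ores_app π hW, hgg', hrl i ((hU i).basicOpen f),
      hrl j ((hU i).basicOpen f)]
    exact hg'₂

end CanonicalSheaf

end Canon

end JetSchemes

end

theorem corollary2p7 {k : Type u} [Field k] [IsAlgClosed k] (X : Over (Spec (.of k)))
    (hX : JetSchemes.IsVariety X) (hns : JetSchemes.IsNonsingular X.left) (m : ℕ) :
    (JetSchemes.jetFunctor X m).IsRepresentable ∧
    ∀ (J : Over (Spec (.of k))) (hJ : (JetSchemes.jetFunctor X m).RepresentableBy J),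
      Nonempty (JetSchemes.canonicalSheaf J ≅
        (Scheme.Modules.pullback (JetSchemes.jetProjection hJ).left).obj
          (JetSchemes.tensorPower (JetSchemes.canonicalSheaf X) (m + 1))) := by
  exact ⟨JetSchemes.isRepresentable_jetFunctor X m,
    fun _ hJ => JetSchemes.nonempty_canonicalSheaf_iso hJ hX hns⟩
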